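/- Let $\mathbb{K}$ be a field, let $G$ be a tree (a connected graph without cycles) on the vertex set $[n]=\{1,\dots,n\}$, and let $S=\mathbb{K}[x_1,\dots,x_n,y_1,\dots,y_n]$ with its standard grading. Let $$J_G=\bigl(x_iy_j-x_jy_i \;:\; i<j,\ \{i,j\}\in E(G)\bigr)\subseteq S$$ be the binomial edge ideal of $G$, and suppose that $J_G$ is an almost complete intersection ideal, that is, its minimal number of generators equals $\operatorname{ht}(J_G)+1$. Let $\operatorname{iv}(G)$ be the number of internal vertices of $G$, i.e. of vertices that are not contained in exactly one maximal clique of $G$. Then for all $s\ge 1$, $$2s+\operatorname{iv}(G)-2\ \le\ \operatorname{reg}(S/J_G^s)\ \le\ 2s+\operatorname{iv}(G)-1,$$ where $\operatorname{reg}(M)=\sup\{\,j-i : \operatorname{Tor}_i^S(M,\mathbb{K})_j\neq 0\,\}$ denotes Castelnuovo--Mumford regularity. -/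

import Mathlib

open MvPolynomial

set_option linter.unusedSectionVars false

noncomputable section

namespace BinomialEdge

/-! ### Graded Tor against the residue field, and Castelnuovo–Mumford regularity -/

section Koszul

variable (K : Type*) [Field K] {σ : Type*} [Fintype σ] [LinearOrder σ]
variable (M : Type*) [AddCommGroup M] [Module K M] [Module (MvPolynomial σ K) M]
  [IsScalarTower K (MvPolynomial σ K) M]

/-- The differential of the Koszul complex of all the variables of `S = K[X_v : v ∈ σ]` with
coefficients in the `S`-module `M`. The free module on the exterior monomials
`e_A = e_{v₁} ∧ ⋯ ∧ e_{vᵢ}`, `A = {v₁ < ⋯ < vᵢ}`, tensored with `M`, is `Finset σ → M`, and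
`m ⊗ e_A` is sent to `∑_{v ∈ A} (-1)^{#{u ∈ A | u < v}} X_v m ⊗ e_{A \ {v}}`. -/
def koszulD : (Finset σ → M) →ₗ[MvPolynomial σ K] (Finset σ → M) :=
  LinearMap.pi fun B => ∑ v ∈ Finset.univ \ B,
    (((-1 : MvPolynomial σ K) ^ (B.filter (· < v)).card) * X v) •
      LinearMap.proj (insert v B)

variable {M} in
theorem koszulD_apply (f : Finset σ → M) (B : Finset σ) :
    koszulD K M f B = ∑ v ∈ Finset.univ \ B,
      (((-1 : MvPolynomial σ K) ^ (B.filter (· < v)).card) * X v) • f (insert v B) := by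
  simp [koszulD]

theorem koszul_sign_aux (B : Finset σ) {v w : σ} (hv : v ∉ B) (h : v < w) :
    ((-1 : MvPolynomial σ K) ^ ((insert v B).filter (· < w)).card) =
        -(-1) ^ (B.filter (· < w)).card ∧
      ((-1 : MvPolynomial σ K) ^ ((insert w B).filter (· < v)).card) =
        (-1) ^ (B.filter (· < v)).card := by
  constructor
  · rw [Finset.filter_insert, if_pos h, Finset.card_insert_of_notMem (by simp [hv]), pow_succ]
    ring
  · rw [Finset.filter_insert, if_neg (not_lt.mpr h.le)]

/-- The Koszul differential squares to zero. -/
theorem koszulD_comp_self (f : Finset σ → M) : koszulD K M (koszulD K M f) = 0 := by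
  funext B
  simp only [koszulD_apply, Finset.smul_sum, smul_smul, Pi.zero_apply]
  rw [Finset.sum_sigma']
  refine Finset.sum_involution (fun p _ => ⟨p.2, p.1⟩) ?_ ?_ ?_ ?_
  · rintro ⟨v, w⟩ h
    simp only [Finset.mem_sigma, Finset.mem_sdiff, Finset.mem_univ, true_and,
      Finset.mem_insert, not_or] at h
    obtain ⟨hv, hwv, hw⟩ := h
    simp only
    rw [Finset.insert_comm w v B, ← add_smul]
    rcases lt_or_gt_of_ne hwv with hlt | hlt
    · obtain ⟨h1, h2⟩ := koszul_sign_aux K B hw hlt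
      rw [h1, h2]
      rw [← zero_smul (MvPolynomial σ K) (f (insert v (insert w B)))]
      congr 1
      ring
    · obtain ⟨h1, h2⟩ := koszul_sign_aux K B hv hlt
      rw [h1, h2]
      rw [← zero_smul (MvPolynomial σ K) (f (insert v (insert w B)))]
      congr 1
      ring
  · rintro ⟨v, w⟩ h _ heq
    simp only [Finset.mem_sigma, Finset.mem_sdiff, Finset.mem_univ, true_and,
      Finset.mem_insert, not_or] at h
    simp only [Sigma.mk.injEq, heq_eq_eq] at heq
    exact h.2.1 heq.1
  · rintro ⟨v, w⟩ h
    simp only [Finset.mem_sigma, Finset.mem_sdiff, Finset.mem_univ, true_and,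
      Finset.mem_insert, not_or] at h ⊢
    exact ⟨h.2.2, fun e => h.2.1 e.symm, h.1⟩
  · rintro ⟨v, w⟩ h
    rfl

variable {M}

/-- For `M` graded by `𝓜`: the Koszul chains of homological degree `i` and internal degree `j`,
that is, sums of `m ⊗ e_A` with `#A = i` and `m` homogeneous of degree `j - i`
(each `e_A` has internal degree `#A`). -/
def koszulChain (𝓜 : ℕ → Submodule K M) (i j : ℕ) : Submodule K (Finset σ → M) :=
  Submodule.pi Set.univ fun A => if A.card = i ∧ i ≤ j then 𝓜 (j - i) else ⊥

/-- Koszul cycles of homological degree `i` and internal degree `j`. -/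
def koszulCycle (𝓜 : ℕ → Submodule K M) (i j : ℕ) : Submodule K (Finset σ → M) :=
  koszulChain K 𝓜 i j ⊓ LinearMap.ker ((koszulD K M).restrictScalars K)

/-- Koszul boundaries of homological degree `i` and internal degree `j`. -/
def koszulBoundary (𝓜 : ℕ → Submodule K M) (i j : ℕ) : Submodule K (Finset σ → M) :=
  (koszulChain K 𝓜 (i + 1) j).map ((koszulD K M).restrictScalars K)

/-- `Tor_i^S(M, K)_j` for the graded module `M` over the standard graded polynomial ring `S`,
computed from the Koszul complex of the variables (the minimal graded free resolution of
the `S`-module `K = S / (X_v : v ∈ σ)`). Its `K`-dimension is the graded Betti number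
`β_{i,j}(M)`. -/
abbrev gradedTor (𝓜 : ℕ → Submodule K M) (i j : ℕ) : Type _ :=
  koszulCycle (σ := σ) K 𝓜 i j ⧸
    (koszulBoundary (σ := σ) K 𝓜 i j).submoduleOf (koszulCycle K 𝓜 i j)

variable (σ) in
/-- Graded Betti numbers `β_{i,j}(M) = dim_K Tor_i^S(M, K)_j`. -/
def gradedBetti (𝓜 : ℕ → Submodule K M) (i j : ℕ) : Cardinal :=
  Module.rank K (gradedTor (σ := σ) K 𝓜 i j)

variable (σ) in
/-- Castelnuovo–Mumford regularity `reg M = sup {j - i | β_{i,j}(M) ≠ 0}`, with values in the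
extended reals (so that no boundedness or non-emptiness is presupposed; `reg 0 = -∞`). -/
def regularity (𝓜 : ℕ → Submodule K M) : EReal :=
  ⨆ (i : ℕ) (j : ℕ) (_ : gradedBetti K σ 𝓜 i j ≠ 0), (((j : ℝ) - (i : ℝ) : ℝ) : EReal)

end Koszul

/-- The degree `d` component of `S / I` for `S` a polynomial ring with its standard grading:
the classes of the homogeneous polynomials of degree `d`. -/
def quotientGrading {K : Type*} [Field K] {σ : Type*} (I : Ideal (MvPolynomial σ K)) (d : ℕ) :
    Submodule K (MvPolynomial σ K ⧸ I) :=
  (homogeneousSubmodule σ K d).map (Ideal.Quotient.mkₐ K I).toLinearMap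

/-- `reg (S / I)` for a homogeneous ideal `I` of a polynomial ring `S` over a field. -/
def regQuotient {K : Type*} [Field K] {σ : Type*} [Fintype σ] [LinearOrder σ]
    (I : Ideal (MvPolynomial σ K)) : EReal :=
  regularity K σ (quotientGrading I)

/-! ### Binomial edge ideals, almost complete intersections, internal vertices -/

/-- The index set of the `2n` variables `x_1, …, x_n, y_1, …, y_n`. -/
abbrev Vars (n : ℕ) : Type := Fin n ⊕ₗ Fin n

/-- The binomial edge ideal `J_G = (x_i y_j - x_j y_i : i < j, {i,j} ∈ E(G))`,
with `x_i = X (inlₗ i)` and `y_i = X (inrₗ i)`. -/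
def binomialEdgeIdeal (K : Type*) [Field K] {n : ℕ} (G : SimpleGraph (Fin n)) :
    Ideal (MvPolynomial (Vars n) K) :=
  Ideal.span {f | ∃ i j : Fin n, i < j ∧ G.Adj i j ∧
    f = X (Sum.inlₗ i) * X (Sum.inrₗ j) - X (Sum.inlₗ j) * X (Sum.inrₗ i)}

/-- An almost complete intersection ideal: the minimal number of generators exceeds the height
by exactly one. -/
def IsAlmostCompleteIntersection {R : Type*} [CommRing R] (I : Ideal R) : Prop :=
  I.FG ∧ (Submodule.spanFinrank I : ℕ∞) = I.height + 1

/-- A simplicial vertex: it lies in exactly one maximal clique. -/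
def IsSimplicialVertex {V : Type*} (G : SimpleGraph V) (v : V) : Prop :=
  ∃! C : Set V, Maximal (fun D => G.IsClique D) C ∧ v ∈ C

/-- `iv(G)`: the number of internal (that is, non-simplicial) vertices. -/
def iv {V : Type*} (G : SimpleGraph V) : ℕ :=
  Set.ncard {v | ¬ IsSimplicialVertex G v}

end BinomialEdge

end

/-! Write E for the edge set. The binomials of the edges minimally generate J_G, so the hypothesis
says |E| = ht J_G + 1. Since J_G lies in the ideal generated by the variables at a vertex set T and
by J_{G∖T}, its height is at most 2|T| + |E(G∖T)|. For |T| = 1, 2 this forces all degrees to be at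
most 3 and any two vertices of degree 3 to be adjacent (`degree_le_three`,
`adj_of_degree_eq_three`). A tree has no triangle, so the set D of vertices of degree 3 has at most
two elements. Summing degrees gives |E| = iv(G) + |D| + 1 (`iv_add_card`).

Lower bound. Deleting a suitable vertex t with deg t ≤ |D| + 1 leaves a disjoint union of paths. Its
ideal I is generated by a regular sequence of r = |E| - deg t ≥ iv(G) quadrics, and I^k/I^(k+1) is
free over S/I (`QuadricCI.hasPowerBasis`). Hence a shifted copy of Tor_r(S/I, K) embeds into
Tor_r(S/I^s, K), and it contains a class with j - i = r + 2(s-1). The class survives in S/J_G^s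
because G∖t is an induced subgraph (`not_torVanishes_of_isolate`).

Upper bound. The aim is reg(S/J_G^s) ≤ 2(s-1) + |E| - |D|. If D is empty, G is a path and the
filtration by powers of a complete intersection suffices. Otherwise G is a linear forest F plus one
edge, so J_G = I + (e) with I = J_F a complete intersection and I : e = I : e^m the ideal of F with
cliques inserted. `QuadricCI.regLE_pow_sup` then bounds reg(S/J_G^s) in terms of reg(S/J_G) and
reg(S/(I : e)). Its mechanism is to show that the maps from Tor(S/I^k J_G^m) to Tor(S/J_G^s), k + m
= s, vanish in high degree, from k = s down to k = 0.

The two remaining regularities are found by gluing. A disjoint clique costs at most 1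
(`regLE_sup_cliqueOn`), and so does an edge joining free vertices of different components, because
its binomial is a nonzerodivisor (`IsFreeElement.regularMod`). That last fact is proved by
completing or deleting non-free vertices until the graph is a disjoint union of cliques, whose ideal
is the kernel of a toric map. All statements about Tor are statements about explicit Koszul cycles
modulo an ideal. -/

noncomputable section

attribute [local instance] MvPolynomial.gradedAlgebra

namespace BinomialEdge

/-! ### Koszul cycles and boundaries modulo an ideal -/

section KoszulVanishing

variable {K : Type*} [Field K] {σ : Type*} [Fintype σ] [LinearOrder σ]

/-- The Koszul differential on chains with coefficients in the polynomial ring itself. -/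
abbrev polyD : (Finset σ → MvPolynomial σ K) →ₗ[MvPolynomial σ K] (Finset σ → MvPolynomial σ K) :=
  koszulD K (MvPolynomial σ K)

/-- Koszul chains with coefficients in `S`, of homological degree `i` and internal degree `j`. -/
def IsKoszulChain (i j : ℕ) (z : Finset σ → MvPolynomial σ K) : Prop :=
  ∀ B, z B ≠ 0 → B.card = i ∧ ∃ k, k + i = j ∧ (z B).IsHomogeneous k

/-- `z` is the sum of a Koszul boundary and a chain with coefficients in `A`. -/
def IsBoundaryMod (A : Ideal (MvPolynomial σ K)) (i j : ℕ) (z : Finset σ → MvPolynomial σ K) :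
    Prop :=
  ∃ w, IsKoszulChain (i + 1) j w ∧ ∀ B, z B - polyD w B ∈ A

/-- Every chain of bidegree `(i, j)` that is a cycle modulo `A` is a boundary modulo `A`, that is,
`Tor_i(S / A, K)_j = 0`. -/
def TorVanishes (A : Ideal (MvPolynomial σ K)) (i j : ℕ) : Prop :=
  ∀ z, IsKoszulChain i j z → (∀ B, polyD z B ∈ A) → IsBoundaryMod A i j z

abbrev IsHomog (A : Ideal (MvPolynomial σ K)) : Prop :=
  A.IsHomogeneous (homogeneousSubmodule σ K)

theorem IsKoszulChain.add {i j : ℕ} {z w : Finset σ → MvPolynomial σ K}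
    (hz : IsKoszulChain i j z) (hw : IsKoszulChain i j w) : IsKoszulChain i j (z + w) := by
  intro B hB
  by_cases h1 : z B = 0
  · have : w B ≠ 0 := by intro h; simp [h1, h] at hB
    simpa [h1] using hw B this
  · obtain ⟨hc, k, hk, hh⟩ := hz B h1
    refine ⟨hc, k, hk, hh.add ?_⟩
    by_cases h2 : w B = 0
    · rw [h2]; exact isHomogeneous_zero ..
    · obtain ⟨_, k', hk', hh'⟩ := hw B h2
      obtain rfl : k' = k := by omega
      exact hh'

theorem IsKoszulChain.neg {i j : ℕ} {z : Finset σ → MvPolynomial σ K}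
    (hz : IsKoszulChain i j z) : IsKoszulChain i j (-z) := by
  intro B hB
  obtain ⟨hc, k, hk, hh⟩ := hz B (by simpa using hB)
  exact ⟨hc, k, hk, hh.neg⟩

theorem IsKoszulChain.sub {i j : ℕ} {z w : Finset σ → MvPolynomial σ K}
    (hz : IsKoszulChain i j z) (hw : IsKoszulChain i j w) : IsKoszulChain i j (z - w) := by
  rw [sub_eq_add_neg]; exact hz.add hw.neg

theorem isKoszulChain_zero (i j : ℕ) : IsKoszulChain i j (0 : Finset σ → MvPolynomial σ K) :=
  fun _ hB => absurd rfl hB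

theorem IsKoszulChain.sum {ι : Type*} {i j : ℕ} (s : Finset ι)
    (z : ι → Finset σ → MvPolynomial σ K) (hz : ∀ t ∈ s, IsKoszulChain i j (z t)) :
    IsKoszulChain i j (∑ t ∈ s, z t) :=
  Finset.sum_induction _ _ (fun _ _ => IsKoszulChain.add) (isKoszulChain_zero i j) hz

theorem IsKoszulChain.smul {i j d : ℕ} {m : MvPolynomial σ K} (hm : m.IsHomogeneous d)
    {z : Finset σ → MvPolynomial σ K} (hz : IsKoszulChain i j z) :
    IsKoszulChain i (j + d) (m • z) := by
  intro B hB
  obtain ⟨hc, k, hk, hh⟩ := hz B (by rintro h; simp [h] at hB)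
  exact ⟨hc, d + k, by omega, hm.mul hh⟩

theorem polyD_eq (z : Finset σ → MvPolynomial σ K) (B : Finset σ) :
    polyD z B = ∑ v ∈ Finset.univ \ B,
      (-1) ^ (B.filter (· < v)).card * X v * z (insert v B) := by
  simp only [polyD, koszulD_apply, smul_eq_mul]

theorem IsKoszulChain.polyD {i j : ℕ} {z : Finset σ → MvPolynomial σ K}
    (hz : IsKoszulChain (i + 1) j z) : IsKoszulChain i j (BinomialEdge.polyD z) := by
  intro B hB
  rw [polyD_eq] at hB ⊢
  have key : ∀ v ∈ Finset.univ \ B, z (insert v B) ≠ 0 → B.card = i ∧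
      ∃ k, k + (i + 1) = j ∧ (z (insert v B)).IsHomogeneous k := by
    intro v hv h0
    obtain ⟨hc, hk⟩ := hz _ h0
    rw [Finset.card_insert_of_notMem (by simpa using hv)] at hc
    exact ⟨by omega, hk⟩
  obtain ⟨v, hv, hne⟩ := Finset.exists_ne_zero_of_sum_ne_zero hB
  obtain ⟨hc, k, hk, -⟩ := key v hv (by rintro h; simp [h] at hne)
  refine ⟨hc, k + 1, by omega, ?_⟩
  refine IsHomogeneous.sum _ _ _ fun w hw => ?_
  by_cases h0 : z (insert w B) = 0
  · rw [h0, mul_zero]; exact isHomogeneous_zero ..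
  · obtain ⟨-, k', hk', hh⟩ := key w hw h0
    obtain rfl : k' = k := by omega
    have h1 : ((-1 : MvPolynomial σ K) ^ (B.filter (· < w)).card).IsHomogeneous 0 := by
      have : (-1 : MvPolynomial σ K).IsHomogeneous 0 := (isHomogeneous_one σ K).neg
      simpa using this.pow (B.filter (· < w)).card
    have := (h1.mul (isHomogeneous_X K w)).mul hh
    convert this using 1
    omega

theorem polyD_eq_zero_of_chain_zero {j : ℕ} {z : Finset σ → MvPolynomial σ K}
    (hz : IsKoszulChain 0 j z) : polyD z = 0 := by
  funext B
  rw [polyD_eq]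
  refine Finset.sum_eq_zero fun v hv => ?_
  by_cases h0 : z (insert v B) = 0
  · rw [h0, mul_zero]
  · have := (hz _ h0).1
    simp at this

theorem polyD_mem {A : Ideal (MvPolynomial σ K)} {z : Finset σ → MvPolynomial σ K}
    (hz : ∀ B, z B ∈ A) (B : Finset σ) : polyD z B ∈ A := by
  rw [polyD_eq]
  exact A.sum_mem fun v _ => A.mul_mem_left _ (hz _)

theorem polyD_smul (m : MvPolynomial σ K) (z : Finset σ → MvPolynomial σ K) (B : Finset σ) :
    polyD (m • z) B = m * polyD z B := by
  rw [map_smul]; rfl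

/-! ### Multiplication by a form of positive degree is null-homotopic -/

/-- Exterior multiplication by `e_v`. -/
def wedgeVar (v : σ) (z : Finset σ → MvPolynomial σ K) : Finset σ → MvPolynomial σ K :=
  fun A => if v ∈ A then (-1) ^ (A.filter (· < v)).card * z (A.erase v) else 0

theorem neg_one_pow_mul_self' (n : ℕ) :
    ((-1 : MvPolynomial σ K) ^ n) * (-1) ^ n = 1 := by
  rw [← mul_pow]; simp

/-- Cartan's homotopy formula: exterior multiplication by e_v is a homotopy between 0 and
multiplication by X_v. -/
theorem polyD_wedgeVar (v : σ) (z : Finset σ → MvPolynomial σ K) (B : Finset σ) :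
    polyD (wedgeVar v z) B + wedgeVar v (BinomialEdge.polyD z) B = X v * z B := by
  rw [polyD_eq]
  by_cases hv : v ∈ B
  · have hB : Finset.univ \ B.erase v = insert v (Finset.univ \ B) := by
      ext w; simp only [Finset.mem_sdiff, Finset.mem_univ, true_and, Finset.mem_erase,
        Finset.mem_insert]; tauto
    have hf : (B.erase v).filter (· < v) = B.filter (· < v) := by
      ext w; simp only [Finset.mem_filter, Finset.mem_erase]
      constructor
      · rintro ⟨⟨-, h⟩, h'⟩; exact ⟨h, h'⟩
      · rintro ⟨h, h'⟩; exact ⟨⟨h'.ne, h⟩, h'⟩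
    have h2 : wedgeVar v (BinomialEdge.polyD z) B = (-1) ^ (B.filter (· < v)).card *
        polyD z (B.erase v) := by simp [wedgeVar, hv]
    -- The summand of index v in the differential at B \ {v} is X_v z(B), its two equal signs
    -- cancelling; each other index w contributes two terms of opposite sign, by `koszul_sign_aux`.
    rw [h2, polyD_eq, hB, Finset.sum_insert (by simp [hv]), hf, Finset.insert_erase hv, mul_add,
      ← mul_assoc, ← mul_assoc, neg_one_pow_mul_self', one_mul, ← add_assoc, add_comm _ (X v * z B),
      add_assoc, add_eq_left, Finset.mul_sum, ← Finset.sum_add_distrib]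
    refine Finset.sum_eq_zero fun w hw => ?_
    have hw' : w ∉ B := by simpa using hw
    have hne : w ≠ v := by rintro rfl; exact hw' hv
    have hvB : v ∉ B.erase v := by simp
    have hwB : w ∉ B.erase v := by simp [hw']
    have hins : insert v (B.erase v) = B := Finset.insert_erase hv
    have h3 : wedgeVar v z (insert w B) = (-1) ^ ((insert w B).filter (· < v)).card *
        z (insert w (B.erase v)) := by
      simp [wedgeVar, hv, Finset.erase_insert_of_ne hne]
    rw [h3]
    have e1 : (insert w (insert v (B.erase v))).filter (· < v) =
        (insert w (B.erase v)).filter (· < v) := by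
      rw [Finset.insert_comm, Finset.filter_insert, if_neg (lt_irrefl v)]
    rcases lt_or_gt_of_ne hne with hlt | hlt
    · obtain ⟨h4, h5⟩ := koszul_sign_aux K (B.erase v) hwB hlt
      rw [hins] at h5 e1
      rw [e1, h4, h5, hf]
      ring
    · obtain ⟨h4, h5⟩ := koszul_sign_aux K (B.erase v) hvB hlt
      rw [hins] at h4 e1
      rw [e1, h4, h5, hf]
      ring
  · have h2 : wedgeVar v (BinomialEdge.polyD z) B = 0 := by simp [wedgeVar, hv]
    rw [h2, add_zero, Finset.sum_eq_single v]
    · have h3 : wedgeVar v z (insert v B) = (-1) ^ (B.filter (· < v)).card * z B := by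
        simp [wedgeVar, hv, Finset.filter_insert]
      rw [h3]
      linear_combination (X v * z B) * neg_one_pow_mul_self' (K := K) (σ := σ) (B.filter (· < v)).card
    · intro w hw hne
      have : v ∉ insert w B := by simp [hv, Ne.symm hne]
      simp [wedgeVar, this]
    · intro h; exact absurd (by simp [hv]) h

theorem IsKoszulChain.wedgeVar {i j : ℕ} (v : σ) {z : Finset σ → MvPolynomial σ K}
    (hz : IsKoszulChain i j z) : IsKoszulChain (i + 1) (j + 1) (wedgeVar v z) := by
  intro B hB
  by_cases hv : v ∈ B
  · have h : BinomialEdge.wedgeVar v z B = (-1) ^ (B.filter (· < v)).card * z (B.erase v) := by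
      simp [BinomialEdge.wedgeVar, hv]
    rw [h] at hB ⊢
    obtain ⟨hc, k, hk, hh⟩ := hz _ (right_ne_zero_of_mul hB)
    refine ⟨by rw [← hc, Finset.card_erase_add_one hv], k, by omega, ?_⟩
    have h1 : ((-1 : MvPolynomial σ K) ^ (B.filter (· < v)).card).IsHomogeneous 0 := by
      have : (-1 : MvPolynomial σ K).IsHomogeneous 0 := (isHomogeneous_one σ K).neg
      simpa using this.pow (B.filter (· < v)).card
    simpa using h1.mul hh
  · simp [BinomialEdge.wedgeVar, hv] at hB

theorem wedgeVar_mem {A : Ideal (MvPolynomial σ K)} {z : Finset σ → MvPolynomial σ K} (v : σ)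
    (hz : ∀ B, z B ∈ A) (B : Finset σ) : BinomialEdge.wedgeVar v z B ∈ A := by
  unfold BinomialEdge.wedgeVar
  split_ifs
  · exact A.mul_mem_left _ (hz _)
  · exact A.zero_mem

theorem homogeneousComponent_mul_of_isHomogeneous {d k e : ℕ} {m : MvPolynomial σ K}
    (hm : m.IsHomogeneous d) (he : k + d = e) (p : MvPolynomial σ K) :
    homogeneousComponent e (m * p) = m * homogeneousComponent k p := by
  have h := DirectSum.coe_decompose_mul_of_left_mem_of_le (homogeneousSubmodule σ K)
    (a := m) (b := p) (i := d) (n := e) hm (by omega)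
  rw [show e - d = k by omega] at h
  have h1 := decomposition.decompose'_apply (m * p) e
  have h2 := decomposition.decompose'_apply p k
  rw [← h1, ← h2]
  exact h

theorem homogeneousComponent_mul_of_lt {d e : ℕ} {m : MvPolynomial σ K}
    (hm : m.IsHomogeneous d) (he : e < d) (p : MvPolynomial σ K) :
    homogeneousComponent e (m * p) = 0 := by
  have h := DirectSum.coe_decompose_mul_of_left_mem_of_not_le (homogeneousSubmodule σ K)
    (a := m) (b := p) (i := d) (n := e) hm (by omega)
  rw [← decomposition.decompose'_apply (m * p) e]
  exact h

theorem exists_eq_sum_X_mul {d : ℕ} {m : MvPolynomial σ K} (hm : m.IsHomogeneous (d + 1)) :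
    ∃ c : σ → MvPolynomial σ K, (∀ v, (c v).IsHomogeneous d) ∧ m = ∑ v, c v * X v := by
  have hmem : m ∈ Ideal.span (Set.range (X : σ → MvPolynomial σ K)) := by
    have := (MvPolynomial.mem_ideal_span_X_image (s := Set.univ) (x := m)).2 ?_
    · simpa using this
    · intro a ha
      have hdeg : a.degree = d + 1 := by
        by_contra h
        exact (mem_support_iff.1 ha) (hm.coeff_eq_zero h)
      by_contra hcon
      push Not at hcon
      have : a = 0 := Finsupp.ext fun v => by simpa using hcon v
      simp [this] at hdeg
  obtain ⟨c, hc⟩ := (Submodule.mem_span_range_iff_exists_fun _).1 hmem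
  refine ⟨fun v => homogeneousComponent d (c v),
    fun v => homogeneousComponent_isHomogeneous d (c v), ?_⟩
  calc m = homogeneousComponent (d + 1) m := (homogeneousComponent_eq_self hm).symm
    _ = homogeneousComponent (d + 1) (∑ v, X v * c v) := by
      rw [← hc]; simp only [smul_eq_mul, mul_comm]
    _ = ∑ v, homogeneousComponent (d + 1) (X v * c v) := map_sum _ _ _
    _ = _ := Finset.sum_congr rfl fun v _ => by
      rw [mul_comm _ (X v)]
      exact homogeneousComponent_mul_of_isHomogeneous (isHomogeneous_X K v) rfl (c v)

/-- Forms of positive degree annihilate Tor(-, K): write the form as a combination of variables and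
combine the homotopies of the individual variables. -/
theorem smul_boundaryMod {A : Ideal (MvPolynomial σ K)} {d : ℕ} {m : MvPolynomial σ K}
    (hm : m.IsHomogeneous (d + 1)) {i j : ℕ} {z : Finset σ → MvPolynomial σ K}
    (hz : IsKoszulChain i j z) (hdz : ∀ B, polyD z B ∈ A) :
    IsBoundaryMod A i (j + (d + 1)) (m • z) := by
  obtain ⟨c, hc, rfl⟩ := exists_eq_sum_X_mul hm
  refine ⟨∑ v, c v • wedgeVar v z, ?_, ?_⟩
  · refine IsKoszulChain.sum _ _ fun v _ => ?_
    have := (hz.wedgeVar v).smul (hc v)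
    rwa [add_assoc, add_comm 1 d] at this
  · intro B
    have : (((∑ v, c v * X v) • z) B - polyD (∑ v, c v • wedgeVar v z) B) =
        ∑ v, c v * wedgeVar v (BinomialEdge.polyD z) B := by
      rw [map_sum, Finset.sum_apply, Pi.smul_apply, smul_eq_mul, Finset.sum_mul,
        ← Finset.sum_sub_distrib]
      refine Finset.sum_congr rfl fun v _ => ?_
      rw [polyD_smul, mul_assoc, ← polyD_wedgeVar v z B]
      ring
    rw [this]
    exact A.sum_mem fun v _ => A.mul_mem_left _ (wedgeVar_mem v hdz B)

end KoszulVanishing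

/-! ### The long exact sequence of Tor for a colon ideal -/

section ShortExact

variable {K : Type*} [Field K] {σ : Type*} [Fintype σ] [LinearOrder σ]

theorem exists_homogeneous_coeff {A : Ideal (MvPolynomial σ K)} (hA : IsHomog A)
    {m p : MvPolynomial σ K} {d e : ℕ} (hm : m.IsHomogeneous d) (hp : p.IsHomogeneous e)
    (h : p ∈ A ⊔ Ideal.span {m}) :
    ∃ y, p - m * y ∈ A ∧ (y ≠ 0 → ∃ k, k + d = e ∧ y.IsHomogeneous k) := by
  obtain ⟨a, ha, b, hb, rfl⟩ := Submodule.mem_sup.1 h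
  obtain ⟨c, rfl⟩ := Ideal.mem_span_singleton'.1 hb
  have hcomp := homogeneousComponent_mem_of_mem hA ha e
  by_cases hde : d ≤ e
  · obtain ⟨k, rfl⟩ := Nat.exists_eq_add_of_le' hde
    refine ⟨homogeneousComponent k c, ?_,
      fun _ => ⟨k, rfl, homogeneousComponent_isHomogeneous k c⟩⟩
    have h1 := homogeneousComponent_eq_self hp
    rw [map_add, mul_comm c m, homogeneousComponent_mul_of_isHomogeneous hm rfl] at h1
    rw [mul_comm c m, ← h1, add_sub_cancel_right]
    exact hcomp
  · refine ⟨0, ?_, fun h => absurd rfl h⟩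
    have h1 := homogeneousComponent_eq_self hp
    rw [map_add, mul_comm c m, homogeneousComponent_mul_of_lt hm (by omega), add_zero] at h1
    rw [mul_comm c m, ← h1, mul_zero, sub_zero]
    exact hcomp

/-- Divides a chain by m modulo A while keeping the bidegree. The final alternative guards the
truncated subtraction: if j < d there is no room for a nonzero quotient. -/
theorem IsKoszulChain.exists_coeff {A : Ideal (MvPolynomial σ K)} (hA : IsHomog A)
    {m : MvPolynomial σ K} {d i j : ℕ} (hm : m.IsHomogeneous d)
    {z : Finset σ → MvPolynomial σ K} (hz : IsKoszulChain i j z)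
    (h : ∀ B, z B ∈ A ⊔ Ideal.span {m}) :
    ∃ y, (∀ B, z B - m * y B ∈ A) ∧ IsKoszulChain i (j - d) y ∧ (d ≤ j ∨ y = 0) := by
  have key : ∀ B, ∃ y, z B - m * y ∈ A ∧
      (y ≠ 0 → B.card = i ∧ ∃ k, k + d + i = j ∧ y.IsHomogeneous k) := by
    intro B
    by_cases h0 : z B = 0
    · exact ⟨0, by simp [h0], fun h => absurd rfl h⟩
    · obtain ⟨hc, e, he, hh⟩ := hz B h0
      obtain ⟨y, hy, hy'⟩ := exists_homogeneous_coeff hA hm hh (h B)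
      refine ⟨y, hy, fun hne => ⟨hc, ?_⟩⟩
      obtain ⟨k, hk, hk'⟩ := hy' hne
      exact ⟨k, by omega, hk'⟩
  choose y hy hy' using key
  refine ⟨y, hy, fun B hB => ?_, ?_⟩
  · obtain ⟨hc, k, hk, hh⟩ := hy' B hB
    exact ⟨hc, k, by omega, hh⟩
  · by_cases hd : d ≤ j
    · exact Or.inl hd
    · right
      funext B
      by_contra hB
      obtain ⟨_, k, hk, _⟩ := hy' B hB
      omega

variable {A Q : Ideal (MvPolynomial σ K)} {m : MvPolynomial σ K} {d i j : ℕ}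

/-- From the outer terms of `0 → (S / (A : m))(-d) → S / A → S / (A + (m)) → 0` to the middle. -/
theorem TorVanishes.middle (hA : IsHomog A) (hm : m.IsHomogeneous d)
    (hQA : ∀ p, p ∈ Q ↔ m * p ∈ A) (hQ : ∀ j', j' + d = j → TorVanishes Q i j')
    (hA' : TorVanishes (A ⊔ Ideal.span {m}) i j) : TorVanishes A i j := by
  intro z hz hdz
  obtain ⟨w, hw, hwz⟩ := hA' z hz fun B => Ideal.mem_sup_left (hdz B)
  obtain ⟨y, hy, hyc, hd⟩ := (hz.sub hw.polyD).exists_coeff hA hm hwz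
  rcases hd with hd | rfl
  · have hdy : ∀ B, polyD y B ∈ Q := by
      intro B
      rw [hQA, ← polyD_smul]
      have h1 := polyD_mem (z := z - polyD w - m • y) hy B
      rw [map_sub, map_sub, koszulD_comp_self, sub_zero] at h1
      simpa using A.sub_mem (hdz B) h1
    obtain ⟨w', hw', h'⟩ := hQ (j - d) (by omega) y hyc hdy
    refine ⟨w + m • w', ?_, fun B => ?_⟩
    · have := hw'.smul hm
      rw [Nat.sub_add_cancel hd] at this
      exact hw.add this
    · have h1 := A.add_mem (hy B) ((hQA _).1 (h' B))
      convert h1 using 1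
      rw [map_add, Pi.add_apply, polyD_smul, Pi.sub_apply]
      ring
  · exact ⟨w, hw, fun B => by simpa using hy B⟩

/-- If the connecting map vanishes, a cycle modulo `A + (m)` lifts to a cycle modulo `A`. -/
theorem IsKoszulChain.exists_lift_cycle (hA : IsHomog A) (hm : m.IsHomogeneous d)
    (hQA : ∀ p, p ∈ Q ↔ m * p ∈ A)
    (hQ : ∀ i' j', i' + 1 = i → j' + d = j → TorVanishes Q i' j')
    {z : Finset σ → MvPolynomial σ K} (hz : IsKoszulChain i j z)
    (hdz : ∀ B, BinomialEdge.polyD z B ∈ A ⊔ Ideal.span {m}) :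
    ∃ u, IsKoszulChain i j u ∧ (∀ B, BinomialEdge.polyD u B ∈ A) ∧ ∀ B, z B - u B ∈ Ideal.span {m} := by
  rcases i with _ | i
  · refine ⟨z, hz, fun B => ?_, fun B => by simp⟩
    rw [polyD_eq_zero_of_chain_zero hz]; exact A.zero_mem
  · obtain ⟨y, hy, hyc, hd⟩ := hz.polyD.exists_coeff hA hm hdz
    rcases hd with hd | rfl
    · have hdy : ∀ B, BinomialEdge.polyD y B ∈ Q := by
        intro B
        rw [hQA, ← polyD_smul]
        have h1 := polyD_mem (z := BinomialEdge.polyD z - m • y) hy B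
        rw [map_sub, koszulD_comp_self, zero_sub] at h1
        simpa using A.neg_mem h1
      obtain ⟨w, hw, h⟩ := hQ i (j - d) rfl (by omega) y hyc hdy
      have hmw := hw.smul hm
      rw [Nat.sub_add_cancel hd] at hmw
      refine ⟨z - m • w, hz.sub hmw, fun B => ?_, fun B => ?_⟩
      · have h1 := A.add_mem (hy B) ((hQA _).1 (h B))
        convert h1 using 1
        rw [map_sub, Pi.sub_apply, polyD_smul]
        ring
      · have h3 : m * w B ∈ Ideal.span {m} :=
          Ideal.mul_mem_right _ _ (Ideal.mem_span_singleton_self m)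
        simpa using h3
    · exact ⟨z, hz, fun B => by simpa using hy B, fun B => by simp⟩

theorem IsBoundaryMod.of_sub_mem {z u : Finset σ → MvPolynomial σ K} (hu : IsBoundaryMod A i j u)
    (h : ∀ B, z B - u B ∈ A) : IsBoundaryMod A i j z := by
  obtain ⟨w, hw, h2⟩ := hu
  exact ⟨w, hw, fun B => by convert A.add_mem (h B) (h2 B) using 1; ring⟩

theorem IsBoundaryMod.mono {A' : Ideal (MvPolynomial σ K)} {z : Finset σ → MvPolynomial σ K}
    (hz : IsBoundaryMod A i j z) (h : A ≤ A') : IsBoundaryMod A' i j z := by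
  obtain ⟨w, hw, h2⟩ := hz
  exact ⟨w, hw, fun B => h (h2 B)⟩

/-- From the first two terms of `0 → (S / (A : m))(-d) → S / A → S / (A + (m)) → 0` to the last. -/
theorem TorVanishes.right (hA : IsHomog A) (hm : m.IsHomogeneous d)
    (hQA : ∀ p, p ∈ Q ↔ m * p ∈ A)
    (hQ : ∀ i' j', i' + 1 = i → j' + d = j → TorVanishes Q i' j')
    (hA' : TorVanishes A i j) : TorVanishes (A ⊔ Ideal.span {m}) i j := by
  intro z hz hdz
  obtain ⟨u, hu, hdu, h⟩ := hz.exists_lift_cycle hA hm hQA hQ hdz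
  exact ((hA' u hu hdu).mono le_sup_left).of_sub_mem fun B => Ideal.mem_sup_right (h B)

/-- Injectivity of multiplication by m from Tor_i(S/Q)(-d) to Tor_i(S/A), whose kernel is the image
of Tor_{i+1}(S/(A + (m))). -/
theorem boundaryMod_colon_of_smul (hA : IsHomog A) (hm : m.IsHomogeneous d)
    (hQA : ∀ p, p ∈ Q ↔ m * p ∈ A)
    (hA' : TorVanishes (A ⊔ Ideal.span {m}) (i + 1) (j + d))
    {z : Finset σ → MvPolynomial σ K}
    (h : IsBoundaryMod A i (j + d) (m • z)) : IsBoundaryMod Q i j z := by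
  obtain ⟨w, hw, hwz⟩ := h
  obtain ⟨w2, hw2, h2⟩ := hA' w hw fun B => by
    have h1 := Ideal.mem_sup_left (T := Ideal.span {m}) (hwz B)
    have h3 : m * z B ∈ Ideal.span {m} := Ideal.mul_mem_right _ _ (Ideal.mem_span_singleton_self m)
    have := sub_mem (Ideal.mem_sup_right (S := A) h3) h1
    simpa using this
  obtain ⟨y, hy, hyc, -⟩ := (hw.sub hw2.polyD).exists_coeff hA hm h2
  rw [Nat.add_sub_cancel] at hyc
  refine ⟨y, hyc, fun B => ?_⟩
  rw [hQA]
  have h1 := polyD_mem (z := w - polyD w2 - m • y) hy B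
  rw [map_sub, map_sub, koszulD_comp_self, sub_zero, Pi.sub_apply, polyD_smul] at h1
  convert A.add_mem (hwz B) h1 using 1
  simp only [Pi.smul_apply, smul_eq_mul]
  ring

/-- From the last two terms of `0 → (S / (A : m))(-d) → S / A → S / (A + (m)) → 0` to the first. -/
theorem TorVanishes.left (hA : IsHomog A) (hm : m.IsHomogeneous d)
    (hQA : ∀ p, p ∈ Q ↔ m * p ∈ A)
    (hA' : TorVanishes (A ⊔ Ideal.span {m}) (i + 1) (j + d))
    (hAv : TorVanishes A i (j + d)) : TorVanishes Q i j := fun z hz hdz =>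
  boundaryMod_colon_of_smul hA hm hQA hA' <| hAv _ (hz.smul hm) fun B => by
    rw [polyD_smul]; exact (hQA _).1 (hdz B)

/-- `m` is a nonzerodivisor modulo `A`. -/
def RegularMod (A : Ideal (MvPolynomial σ K)) (m : MvPolynomial σ K) : Prop :=
  ∀ p, m * p ∈ A → p ∈ A

theorem RegularMod.iff (h : RegularMod A m) (p : MvPolynomial σ K) : p ∈ A ↔ m * p ∈ A :=
  ⟨fun hp => A.mul_mem_left _ hp, h p⟩

/-- For a nonzerodivisor of positive degree the colon ideal is A itself, and multiplication by m is
zero on Tor, so the connecting map from Tor_{i+1}(S/(A + (m))) onto the shifted Tor_i(S/A) is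
surjective. -/
theorem TorVanishes.of_regular_succ (hA : IsHomog A) (hm : m.IsHomogeneous (d + 1))
    (hreg : RegularMod A m)
    (hA' : TorVanishes (A ⊔ Ideal.span {m}) (i + 1) (j + (d + 1))) : TorVanishes A i j :=
  fun _ hz hdz => boundaryMod_colon_of_smul hA hm hreg.iff hA' (smul_boundaryMod hm hz hdz)

/-- Tor_i(S/A) injects into Tor_i(S/(A + (m))): the kernel is the image of multiplication by m,
which is null-homotopic. The statement for a single cycle, not only for vanishing groups, is what
the passage to induced subgraphs needs. -/
theorem boundaryMod_of_regular (hA : IsHomog A) (hm : m.IsHomogeneous (d + 1))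
    (hreg : RegularMod A m) {z : Finset σ → MvPolynomial σ K} (hz : IsKoszulChain i j z)
    (hdz : ∀ B, polyD z B ∈ A) (h : IsBoundaryMod (A ⊔ Ideal.span {m}) i j z) :
    IsBoundaryMod A i j z := by
  obtain ⟨w, hw, hwz⟩ := h
  obtain ⟨y, hy, hyc, hd⟩ := (hz.sub hw.polyD).exists_coeff hA hm hwz
  rcases hd with hd | rfl
  · have hdy : ∀ B, polyD y B ∈ A := by
      intro B
      apply hreg
      rw [← polyD_smul]
      have h1 := polyD_mem (z := z - polyD w - m • y) hy B
      rw [map_sub, map_sub, koszulD_comp_self, sub_zero] at h1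
      simpa using A.sub_mem (hdz B) h1
    obtain ⟨u, hu, hu'⟩ := smul_boundaryMod hm hyc hdy
    rw [Nat.sub_add_cancel hd] at hu
    refine ⟨w + u, hw.add hu, fun B => ?_⟩
    convert A.add_mem (hy B) (hu' B) using 1
    simp only [map_add, Pi.add_apply, Pi.sub_apply, Pi.smul_apply, smul_eq_mul]
    ring
  · exact ⟨w, hw, fun B => by simpa using hy B⟩

theorem TorVanishes.of_regular (hA : IsHomog A) (hm : m.IsHomogeneous (d + 1))
    (hreg : RegularMod A m) (hA' : TorVanishes (A ⊔ Ideal.span {m}) i j) : TorVanishes A i j :=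
  fun z hz hdz => boundaryMod_of_regular hA hm hreg hz hdz <|
    hA' z hz fun B => Ideal.mem_sup_left (hdz B)

theorem torVanishes_top (i j : ℕ) : TorVanishes (⊤ : Ideal (MvPolynomial σ K)) i j :=
  fun _ _ _ => ⟨0, isKoszulChain_zero _ _, fun _ => Submodule.mem_top⟩

/-! ### Bounds for the regularity and for the projective dimension -/

/-- `reg (S / A) ≤ r`. -/
def RegLE (A : Ideal (MvPolynomial σ K)) (r : ℕ) : Prop :=
  ∀ i j, i + r < j → TorVanishes A i j

/-- The projective dimension of `S / A` is at most `r`. -/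
def PdLE (A : Ideal (MvPolynomial σ K)) (r : ℕ) : Prop :=
  ∀ i j, r < i → TorVanishes A i j

theorem RegLE.mono {r r' : ℕ} (h : RegLE A r) (hr : r ≤ r') : RegLE A r' :=
  fun i j hij => h i j (by omega)

theorem RegLE.middle (hA : IsHomog A) (hm : m.IsHomogeneous d) (hQA : ∀ p, p ∈ Q ↔ m * p ∈ A)
    {q r : ℕ} (hQ : RegLE Q q) (hqr : q + d ≤ r) (hA' : RegLE (A ⊔ Ideal.span {m}) r) :
    RegLE A r := fun i j hij =>
  TorVanishes.middle hA hm hQA (fun j' hj' => hQ i j' (by omega)) (hA' i j hij)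

/-- The gain of 1 over `RegLE.middle` comes from the connecting map, which lowers the homological
degree and keeps the internal one. -/
theorem RegLE.right (hA : IsHomog A) (hm : m.IsHomogeneous d) (hQA : ∀ p, p ∈ Q ↔ m * p ∈ A)
    {q r : ℕ} (hQ : RegLE Q q) (hqr : q + d ≤ r + 1) (hA' : RegLE A r) :
    RegLE (A ⊔ Ideal.span {m}) r := fun i j hij =>
  TorVanishes.right hA hm hQA (fun i' j' hi' hj' => hQ i' j' (by omega)) (hA' i j hij)

theorem RegLE.of_regular {r : ℕ} (hA : IsHomog A) (hm : m.IsHomogeneous (d + 1))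
    (hreg : RegularMod A m) (hA' : RegLE (A ⊔ Ideal.span {m}) r) : RegLE A r := fun i j hij =>
  TorVanishes.of_regular hA hm hreg (hA' i j hij)

theorem RegLE.add_regular {r r' : ℕ} (hA : IsHomog A) (hm : m.IsHomogeneous d)
    (hreg : RegularMod A m) (hA' : RegLE A r) (hr : r ≤ r') (hr' : r + d ≤ r' + 1) :
    RegLE (A ⊔ Ideal.span {m}) r' :=
  RegLE.right hA hm hreg.iff hA' hr' (hA'.mono hr)

theorem PdLE.middle (hA : IsHomog A) (hm : m.IsHomogeneous d) (hQA : ∀ p, p ∈ Q ↔ m * p ∈ A)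
    {r : ℕ} (hQ : PdLE Q r) (hA' : PdLE (A ⊔ Ideal.span {m}) r) :
    PdLE A r := fun i j hij =>
  TorVanishes.middle hA hm hQA (fun j' _ => hQ i j' hij) (hA' i j hij)

theorem PdLE.add_regular (hA : IsHomog A) (hm : m.IsHomogeneous d)
    (hreg : RegularMod A m) {r : ℕ} (hA' : PdLE A r) : PdLE (A ⊔ Ideal.span {m}) (r + 1) :=
  fun i j hij => TorVanishes.right hA hm hreg.iff
    (fun i' j' hi' _ => hA' i' j' (by omega)) (hA' i j (by omega))

theorem PdLE.of_regular (hA : IsHomog A) (hm : m.IsHomogeneous (d + 1))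
    (hreg : RegularMod A m) {r : ℕ} (hA' : PdLE (A ⊔ Ideal.span {m}) (r + 1)) : PdLE A r :=
  fun i j hij => TorVanishes.of_regular_succ hA hm hreg (hA' (i + 1) _ (by omega))

end ShortExact

/-! ### Vanishing of cycles modulo A versus graded Betti numbers -/

section Comparison

variable {K : Type*} [Field K] {σ : Type*} [Fintype σ] [LinearOrder σ]
variable {A : Ideal (MvPolynomial σ K)} {i j : ℕ}

theorem koszulD_mk (z : Finset σ → MvPolynomial σ K) :
    koszulD K (MvPolynomial σ K ⧸ A) (fun B => Ideal.Quotient.mk A (z B)) =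
      fun B => Ideal.Quotient.mk A (polyD z B) := by
  funext B
  rw [koszulD_apply, polyD_eq, map_sum]
  exact Finset.sum_congr rfl fun v _ => by rw [map_mul]; rfl

theorem IsKoszulChain.mk_mem {z : Finset σ → MvPolynomial σ K} (hz : IsKoszulChain i j z) :
    (fun B => Ideal.Quotient.mk A (z B)) ∈ koszulChain K (quotientGrading A) i j := by
  rw [koszulChain, Submodule.mem_pi]
  intro B _
  by_cases h0 : z B = 0
  · simp [h0]
  · obtain ⟨hc, k, hk, hh⟩ := hz B h0
    rw [if_pos ⟨hc, by omega⟩, show j - i = k by omega]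
    exact ⟨z B, hh, rfl⟩

theorem exists_lift_of_mem_koszulChain {f : Finset σ → MvPolynomial σ K ⧸ A}
    (hf : f ∈ koszulChain K (quotientGrading A) i j) :
    ∃ z, IsKoszulChain i j z ∧ f = fun B => Ideal.Quotient.mk A (z B) := by
  rw [koszulChain, Submodule.mem_pi] at hf
  have key : ∀ B, ∃ p, (p ≠ 0 → B.card = i ∧ ∃ k, k + i = j ∧ p.IsHomogeneous k) ∧
      f B = Ideal.Quotient.mk A p := by
    intro B
    have h := hf B trivial
    split_ifs at h with hc
    · obtain ⟨p, hp, hpf⟩ := h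
      exact ⟨p, fun _ => ⟨hc.1, j - i, by omega, hp⟩, hpf.symm⟩
    · exact ⟨0, fun h => absurd rfl h, by simpa using h⟩
  choose z hz hz' using key
  exact ⟨z, hz, funext hz'⟩

/-- Koszul chains over S/A lift to chains over S of the same bidegree, so working modulo A with
polynomial chains loses nothing. -/
theorem gradedBetti_eq_zero_iff :
    gradedBetti K σ (quotientGrading A) i j = 0 ↔ TorVanishes A i j := by
  rw [gradedBetti, rank_zero_iff, Submodule.Quotient.subsingleton_iff,
    Submodule.submoduleOf_eq_top]
  constructor
  · intro h z hz hdz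
    have hmem : (fun B => Ideal.Quotient.mk A (z B)) ∈
        koszulCycle (σ := σ) K (quotientGrading A) i j := by
      refine ⟨hz.mk_mem, ?_⟩
      change koszulD K (MvPolynomial σ K ⧸ A) (fun B => Ideal.Quotient.mk A (z B)) = 0
      rw [koszulD_mk]
      funext B
      exact Ideal.Quotient.eq_zero_iff_mem.2 (hdz B)
    obtain ⟨f, hf, hfz⟩ := h hmem
    obtain ⟨w, hw, rfl⟩ := exists_lift_of_mem_koszulChain hf
    refine ⟨w, hw, fun B => ?_⟩
    have h1 := congrFun hfz B
    change koszulD K (MvPolynomial σ K ⧸ A) (fun B => Ideal.Quotient.mk A (w B)) B = _ at h1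
    rw [koszulD_mk] at h1
    exact (Ideal.Quotient.eq).1 h1.symm
  · rintro h f ⟨hf, hf'⟩
    obtain ⟨z, hz, rfl⟩ := exists_lift_of_mem_koszulChain hf
    change koszulD K (MvPolynomial σ K ⧸ A) (fun B => Ideal.Quotient.mk A (z B)) = 0 at hf'
    rw [koszulD_mk] at hf'
    obtain ⟨w, hw, h1⟩ := h z hz fun B => Ideal.Quotient.eq_zero_iff_mem.1 (congrFun hf' B)
    refine ⟨_, hw.mk_mem, ?_⟩
    change koszulD K (MvPolynomial σ K ⧸ A) (fun B => Ideal.Quotient.mk A (w B)) = _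
    rw [koszulD_mk]
    funext B
    exact ((Ideal.Quotient.eq).2 (h1 B)).symm

end Comparison

variable {K : Type*} [Field K] {σ : Type*} [Fintype σ] [LinearOrder σ]

theorem regQuotient_le {A : Ideal (MvPolynomial σ K)} {r : ℕ} (h : RegLE A r) :
    regQuotient A ≤ ((r : ℝ) : EReal) := by
  refine iSup_le fun i => iSup_le fun j => iSup_le fun hb => ?_
  rw [EReal.coe_le_coe_iff]
  by_contra hlt
  refine hb (gradedBetti_eq_zero_iff.2 (h i j ?_))
  push Not at hlt
  have : ((i + r : ℕ) : ℝ) < j := by push_cast; linarith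
  exact_mod_cast this

theorem le_regQuotient {A : Ideal (MvPolynomial σ K)} {i j : ℕ} (h : ¬ TorVanishes A i j) :
    (((j : ℝ) - i : ℝ) : EReal) ≤ regQuotient A :=
  le_iSup_of_le i <| le_iSup_of_le j <|
    le_iSup_of_le (f := fun _ => (((j : ℝ) - i : ℝ) : EReal))
      (fun hb => h (gradedBetti_eq_zero_iff.1 hb)) le_rfl

/-! ### Regular variables, ideals of variables, and adjoining families with constant colon -/

section Powers

variable {K : Type*} [Field K] {σ : Type*} [Fintype σ] [LinearOrder σ]

/-! ### Ideals whose generators do not involve a given variable -/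

/-- `A` is generated by polynomials in which the variable `v` does not occur. -/
def VarFree (v : σ) (A : Ideal (MvPolynomial σ K)) : Prop :=
  ∃ s : Set (MvPolynomial σ K), s ⊆ supported K {v}ᶜ ∧ A = Ideal.span s

/-- Division by X_v with remainder discarded is linear over the polynomials not involving v. This
makes X_v a nonzerodivisor modulo any ideal generated by such polynomials. -/
theorem divMonomial_mul_of_supported {v : σ} {f : MvPolynomial σ K} (hf : f ∈ supported K {v}ᶜ)
    (g : MvPolynomial σ K) :
    (g * f).divMonomial (Finsupp.single v 1) = g.divMonomial (Finsupp.single v 1) * f := by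
  rw [supported] at hf
  induction hf using Algebra.adjoin_induction generalizing g with
  | mem x hx =>
    obtain ⟨u, hu, rfl⟩ := hx
    have huv : u ≠ v := by simpa using hu
    ext e
    rw [coeff_divMonomial, coeff_mul_X', coeff_mul_X', coeff_divMonomial]
    have h1 : u ∈ (Finsupp.single v 1 + e).support ↔ u ∈ e.support := by
      simp [huv.symm]
    by_cases h : u ∈ e.support
    · rw [if_pos (h1.2 h), if_pos h]
      congr 1
      rw [add_tsub_assoc_of_le]
      rw [Finsupp.single_le_iff]
      exact Nat.one_le_iff_ne_zero.2 (Finsupp.mem_support_iff.1 h)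
    · rw [if_neg (fun h' => h (h1.1 h')), if_neg h]
  | algebraMap r =>
    rw [algebraMap_eq, mul_comm, mul_comm _ (C r)]
    ext e
    simp only [coeff_divMonomial, coeff_C_mul]
  | add x y _ _ hx hy => rw [mul_add, mul_add, add_divMonomial, hx, hy]
  | mul x y _ _ hx hy => rw [← mul_assoc, hy, hx, mul_assoc]

theorem VarFree.regularMod {v : σ} {A : Ideal (MvPolynomial σ K)} (h : VarFree v A) :
    RegularMod A (X v) := by
  obtain ⟨s, hs, rfl⟩ := h
  have key : ∀ q ∈ Ideal.span s, q.divMonomial (Finsupp.single v 1) ∈ Ideal.span s := by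
    intro q hq
    induction hq using Submodule.span_induction with
    | mem x hx =>
      have := divMonomial_mul_of_supported (hs hx) 1
      rw [one_mul] at this
      rw [this]
      exact Ideal.mul_mem_left _ _ (Ideal.subset_span hx)
    | zero => simp
    | add x y _ _ hx hy => rw [add_divMonomial]; exact add_mem hx hy
    | smul c x hx _ =>
      rw [smul_eq_mul]
      -- Division is not linear over all of S, so the induction hypothesis on x does not apply to c
      -- * x; instead x is expanded in the generators, which can be pulled out.
      obtain ⟨n, f, g, rfl⟩ := Submodule.mem_span_set'.1 hx
      rw [Finset.mul_sum]
      have hsum : ∀ t : Finset (Fin n), (∑ i ∈ t, c * f i • (g i : MvPolynomial σ K)).divMonomial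
          (Finsupp.single v 1) ∈ Ideal.span s := by
        intro t
        induction t using Finset.induction_on with
        | empty => simp
        | insert a t ha ih =>
          rw [Finset.sum_insert ha, add_divMonomial]
          refine add_mem ?_ ih
          rw [smul_eq_mul, ← mul_assoc, divMonomial_mul_of_supported (hs (g a).2)]
          exact Ideal.mul_mem_left _ _ (Ideal.subset_span (g a).2)
      exact hsum _
  intro p hp
  have := key _ hp
  rwa [X_mul_divMonomial] at this

theorem VarFree.sup {v : σ} {A B : Ideal (MvPolynomial σ K)} (hA : VarFree v A)
    (hB : VarFree v B) : VarFree v (A ⊔ B) := by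
  obtain ⟨s, hs, rfl⟩ := hA
  obtain ⟨t, ht, rfl⟩ := hB
  exact ⟨s ∪ t, Set.union_subset hs ht, (Ideal.span_union s t).symm⟩

open scoped Pointwise in
theorem VarFree.mul {v : σ} {A B : Ideal (MvPolynomial σ K)} (hA : VarFree v A)
    (hB : VarFree v B) : VarFree v (A * B) := by
  obtain ⟨s, hs, rfl⟩ := hA
  obtain ⟨t, ht, rfl⟩ := hB
  refine ⟨s * t, ?_, Ideal.span_mul_span' s t⟩
  rintro _ ⟨a, ha, b, hb, rfl⟩
  exact mul_mem (hs ha) (ht hb)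

theorem varFree_top (v : σ) : VarFree v (⊤ : Ideal (MvPolynomial σ K)) :=
  ⟨{1}, by simp, by simp⟩

theorem VarFree.pow {v : σ} {A : Ideal (MvPolynomial σ K)} (hA : VarFree v A) (n : ℕ) :
    VarFree v (A ^ n) := by
  induction n with
  | zero => simpa using varFree_top v
  | succ n ih => rw [pow_succ]; exact ih.mul hA

theorem varFree_span_X {u v : σ} (h : u ≠ v) :
    VarFree v (Ideal.span {(X u : MvPolynomial σ K)}) :=
  ⟨_, by simpa [X_mem_supported] using h, rfl⟩

theorem isHomog_span_singleton {d : ℕ} {m : MvPolynomial σ K} (hm : m.IsHomogeneous d) :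
    IsHomog (Ideal.span {m}) :=
  Ideal.homogeneous_span _ _ fun x hx => by
    rw [Set.mem_singleton_iff.1 hx]; exact ⟨d, hm⟩

theorem isHomog_pow {A : Ideal (MvPolynomial σ K)} (hA : IsHomog A) (n : ℕ) : IsHomog (A ^ n) := by
  induction n with
  | zero => simpa using Ideal.IsHomogeneous.top _
  | succ n ih => rw [pow_succ]; exact ih.mul hA

/-! ### Ideals generated by variables -/

/-- The ideal generated by a set of variables. -/
def varIdeal (K : Type*) [Field K] {σ : Type*} (T : Finset σ) : Ideal (MvPolynomial σ K) :=
  Ideal.span (X '' (T : Set σ))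

theorem varIdeal_insert {τ : Type*} [DecidableEq τ] (T : Finset τ) (v : τ) :
    varIdeal K (insert v T) = varIdeal K T ⊔ Ideal.span {X v} := by
  rw [varIdeal, Finset.coe_insert, Set.image_insert_eq, Ideal.span_insert, sup_comm, varIdeal]

theorem isHomog_varIdeal (T : Finset σ) : IsHomog (varIdeal K T) :=
  Ideal.homogeneous_span _ _ fun x hx => by
    obtain ⟨v, _, rfl⟩ := hx
    exact ⟨1, isHomogeneous_X K v⟩

theorem varFree_varIdeal {T : Finset σ} {v : σ} (hv : v ∉ T) : VarFree v (varIdeal K T) := by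
  refine ⟨_, ?_, rfl⟩
  rintro _ ⟨u, hu, rfl⟩
  simp only [SetLike.mem_coe, X_mem_supported, Set.mem_compl_iff, Set.mem_singleton_iff]
  rintro rfl
  exact hv hu

/-- Descending induction from the ideal of all variables, whose quotient is K: there a coefficient
of positive degree is already in the ideal, and exterior degree is bounded by the number of
variables. Removing a variable is undoing a regular element. The case of no variables gives the
bounds for S. -/
theorem regLE_pdLE_varIdeal (T : Finset σ) :
    RegLE (varIdeal K T) 0 ∧ PdLE (varIdeal K T) T.card := by
  induction hn : (Finset.univ \ T).card generalizing T with
  | zero =>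
    have hT : T = Finset.univ := by
      rw [Finset.card_eq_zero, Finset.sdiff_eq_empty_iff_subset] at hn
      exact Finset.univ_subset_iff.1 hn
    subst hT
    constructor
    · intro i j hij z hz _
      refine ⟨0, isKoszulChain_zero _ _, fun B => ?_⟩
      rw [map_zero, Pi.zero_apply, sub_zero]
      by_cases h0 : z B = 0
      · rw [h0]; exact Submodule.zero_mem _
      · obtain ⟨_, k, hk, hh⟩ := hz B h0
        obtain ⟨k, rfl⟩ : ∃ l, k = l + 1 := ⟨k - 1, by omega⟩
        obtain ⟨c, _, h⟩ := exists_eq_sum_X_mul hh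
        rw [h]
        exact Ideal.sum_mem _ fun v _ => Ideal.mul_mem_left _ _
          (Ideal.subset_span ⟨v, by simp, rfl⟩)
    · intro i j hij z hz _
      refine ⟨0, isKoszulChain_zero _ _, fun B => ?_⟩
      rw [map_zero, Pi.zero_apply, sub_zero]
      by_cases h0 : z B = 0
      · rw [h0]; exact Submodule.zero_mem _
      · have h1 := (hz B h0).1
        have h2 := Finset.card_le_univ B
        rw [Finset.card_univ] at hij
        omega
  | succ n ih =>
    obtain ⟨v, hv⟩ : (Finset.univ \ T).Nonempty := Finset.card_pos.1 (by omega)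
    have hvT : v ∉ T := by simpa using hv
    obtain ⟨h1, h2⟩ := ih (insert v T) (by
      rw [Finset.sdiff_insert, Finset.card_erase_of_mem hv, hn]; rfl)
    rw [varIdeal_insert] at h1 h2
    rw [Finset.card_insert_of_notMem hvT] at h2
    exact ⟨RegLE.of_regular (d := 0) (isHomog_varIdeal T) (isHomogeneous_X K v)
        (varFree_varIdeal hvT).regularMod h1,
      PdLE.of_regular (d := 0) (isHomog_varIdeal T) (isHomogeneous_X K v)
        (varFree_varIdeal hvT).regularMod h2⟩

theorem varIdeal_empty : varIdeal K (∅ : Finset σ) = ⊥ := by simp [varIdeal]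

/-! ### Adjoining a family of elements with constant colon ideal -/

section Family

variable {A Q : Ideal (MvPolynomial σ K)} {ι : Type*} [Fintype ι] {b : ι → MvPolynomial σ K}

/-- When the b_t are independent modulo A with coefficients in S/Q, adjoining them one at a time
always meets the same colon ideal Q. -/
theorem mem_colon_family_iff (h1 : ∀ t, ∀ p ∈ Q, b t * p ∈ A)
    (h2 : ∀ c : ι → MvPolynomial σ K, ∑ t, c t * b t ∈ A → ∀ t, c t ∈ Q)
    {s : Finset ι} {t : ι} (ht : t ∉ s) (p : MvPolynomial σ K) :
    p ∈ Q ↔ b t * p ∈ A ⊔ Ideal.span (b '' (s : Set ι)) := by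
  classical
  refine ⟨fun hp => Ideal.mem_sup_left (h1 t p hp), fun hp => ?_⟩
  obtain ⟨a, ha, x, hx, hax⟩ := Submodule.mem_sup.1 hp
  obtain ⟨c₀, hc₀⟩ := (Submodule.mem_span_image_finset_iff_exists_fun _).1 hx
  obtain ⟨c, hc⟩ : ∃ c : ι → MvPolynomial σ K, ∑ u ∈ s, c u * b u = x := by
    refine ⟨fun u => if h : u ∈ s then c₀ ⟨u, h⟩ else 0, ?_⟩
    rw [← hc₀, ← Finset.sum_coe_sort]
    exact Finset.sum_congr rfl fun u _ => by simp
  -- The relation p b_t - ∑ c_u b_u ∈ A, with coefficient 0 outside s ∪ {t}, to which independence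
  -- is applied.
  have := h2 (fun u => if u = t then p else if u ∈ s then - c u else 0) ?_ t
  · simpa using this
  · have hsum : ∑ u, (if u = t then p else if u ∈ s then - c u else 0) * b u =
        p * b t - ∑ u ∈ s, c u * b u := by
      have h3 : ∀ u, (if u = t then p else if u ∈ s then - c u else 0) * b u =
          (if u = t then p * b t else 0) - (if u ∈ s then c u * b u else 0) := by
        intro u
        by_cases h : u = t
        · subst h; simp [ht]
        · by_cases h' : u ∈ s <;> simp [h, h']
      rw [Finset.sum_congr rfl fun u _ => h3 u, Finset.sum_sub_distrib]
      simp
    rw [hsum]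
    have : p * b t - ∑ u ∈ s, c u * b u = a := by
      rw [hc, mul_comm, ← hax]; ring
    rw [this]; exact ha

theorem sup_span_image_insert [DecidableEq ι] (s : Finset ι) (t : ι) :
    A ⊔ Ideal.span (b '' ((insert t s : Finset ι) : Set ι)) =
      A ⊔ Ideal.span (b '' (s : Set ι)) ⊔ Ideal.span {b t} := by
  rw [Finset.coe_insert, Set.image_insert_eq, Ideal.span_insert, sup_assoc,
    sup_comm (Ideal.span {b t})]

theorem isHomog_sup_span_image {d : ℕ} (hA : IsHomog A) (hb : ∀ t, (b t).IsHomogeneous d)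
    (s : Finset ι) : IsHomog (A ⊔ Ideal.span (b '' (s : Set ι))) :=
  hA.sup (Ideal.homogeneous_span _ _ fun x hx => by
    obtain ⟨t, _, rfl⟩ := hx
    exact ⟨d, hb t⟩)

/-- Each step adjoins one b_t, giving a short exact sequence whose kernel is a shift of S/Q;
properties propagate from A to A + (b). -/
theorem family_induction_up {d : ℕ} (hA : IsHomog A) (hb : ∀ t, (b t).IsHomogeneous d)
    (h1 : ∀ t, ∀ p ∈ Q, b t * p ∈ A)
    (h2 : ∀ c : ι → MvPolynomial σ K, ∑ t, c t * b t ∈ A → ∀ t, c t ∈ Q)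
    {P : Ideal (MvPolynomial σ K) → Prop}
    (step : ∀ A' t, IsHomog A' → (∀ p, p ∈ Q ↔ b t * p ∈ A') → P A' →
      P (A' ⊔ Ideal.span {b t})) (h0 : P A) : P (A ⊔ Ideal.span (Set.range b)) := by
  classical
  suffices h : ∀ s : Finset ι, P (A ⊔ Ideal.span (b '' (s : Set ι))) by
    simpa using h Finset.univ
  intro s
  induction s using Finset.induction_on with
  | empty => simpa using h0
  | insert t s ht ih =>
    rw [sup_span_image_insert]
    exact step _ t (isHomog_sup_span_image hA hb s) (mem_colon_family_iff h1 h2 ht) ih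

/-- The same sequences read backwards, from A + (b) down to any partial sum; the bare ideal A is the
case of the empty index set. -/
theorem family_induction_down {d : ℕ} (hA : IsHomog A) (hb : ∀ t, (b t).IsHomogeneous d)
    (h1 : ∀ t, ∀ p ∈ Q, b t * p ∈ A)
    (h2 : ∀ c : ι → MvPolynomial σ K, ∑ t, c t * b t ∈ A → ∀ t, c t ∈ Q)
    {P : Ideal (MvPolynomial σ K) → Prop}
    (step : ∀ A' t, IsHomog A' → (∀ p, p ∈ Q ↔ b t * p ∈ A') → P (A' ⊔ Ideal.span {b t}) →
      P A') (h0 : P (A ⊔ Ideal.span (Set.range b))) (s : Finset ι) :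
    P (A ⊔ Ideal.span (b '' (s : Set ι))) := by
  classical
  induction hn : (Finset.univ \ s).card generalizing s with
  | zero =>
    have hs : s = Finset.univ := by
      rw [Finset.card_eq_zero, Finset.sdiff_eq_empty_iff_subset] at hn
      exact Finset.univ_subset_iff.1 hn
    subst hs
    simpa using h0
  | succ n ih =>
    obtain ⟨t, ht⟩ : (Finset.univ \ s).Nonempty := Finset.card_pos.1 (by omega)
    have := ih (insert t s) (by rw [Finset.sdiff_insert, Finset.card_erase_of_mem ht, hn]; rfl)
    rw [sup_span_image_insert] at this
    exact step _ t (isHomog_sup_span_image hA hb s)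
      (mem_colon_family_iff h1 h2 (by simpa using ht)) this

end Family

end Powers

/-! ### Regular sequences of quadrics, their powers, and one additional generator -/

section CompleteIntersection

variable {K : Type*} [Field K] {σ : Type*} [Fintype σ] [LinearOrder σ]

/-- `I` is generated by a regular sequence of `r` quadratic forms. -/
inductive QuadricCI : Ideal (MvPolynomial σ K) → ℕ → Prop
  | bot : QuadricCI ⊥ 0
  | add {I : Ideal (MvPolynomial σ K)} {r : ℕ} {f : MvPolynomial σ K} (hI : QuadricCI I r)
      (hf : f.IsHomogeneous 2) (hreg : RegularMod I f) : QuadricCI (I ⊔ Ideal.span {f}) (r + 1)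

theorem QuadricCI.isHomog {I : Ideal (MvPolynomial σ K)} {r : ℕ} (hI : QuadricCI I r) :
    IsHomog I := by
  induction hI with
  | bot => exact Ideal.IsHomogeneous.bot _
  | add _ hf _ ih => exact ih.sup (isHomog_span_singleton hf)

theorem QuadricCI.regLE {I : Ideal (MvPolynomial σ K)} {r : ℕ} (hI : QuadricCI I r) :
    RegLE I r := by
  induction hI with
  | bot => rw [← varIdeal_empty]; exact (regLE_pdLE_varIdeal ∅).1
  | add hI hf hreg ih => exact ih.add_regular hI.isHomog hf hreg (by omega) (by omega)

theorem QuadricCI.pdLE {I : Ideal (MvPolynomial σ K)} {r : ℕ} (hI : QuadricCI I r) :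
    PdLE I r := by
  induction hI with
  | bot => rw [← varIdeal_empty]; exact (regLE_pdLE_varIdeal ∅).2
  | add hI hf hreg ih => exact ih.add_regular hI.isHomog hf hreg

/-- The top Koszul class of the r quadrics. For the zero ideal it is 1, not a boundary since there
are no 1-chains of internal degree 0; each further quadric raises the bidegree by (1, 2). -/
theorem QuadricCI.not_torVanishes {I : Ideal (MvPolynomial σ K)} {r : ℕ} (hI : QuadricCI I r) :
    ¬ TorVanishes I r (2 * r) := by
  induction hI with
  | bot =>
    intro h
    have hz : IsKoszulChain 0 0 (Pi.single ∅ 1 : Finset σ → MvPolynomial σ K) := by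
      intro B hB
      by_cases h0 : B = ∅
      · subst h0
        refine ⟨rfl, 0, rfl, ?_⟩
        rw [Pi.single_eq_same]
        exact isHomogeneous_one σ K
      · exact absurd (Pi.single_eq_of_ne h0 _) hB
    obtain ⟨w, hw, hwz⟩ := h _ hz fun B => by
      rw [polyD_eq_zero_of_chain_zero hz]; exact Submodule.zero_mem _
    have hw0 : w = 0 := by
      funext B
      by_contra hB
      obtain ⟨_, k, hk, _⟩ := hw B hB
      omega
    have := hwz ∅
    rw [hw0, map_zero, Pi.zero_apply, sub_zero, Pi.single_eq_same, Submodule.mem_bot] at this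
    exact one_ne_zero this
  | add hI hf hreg ih =>
    exact fun h => ih (TorVanishes.of_regular_succ hI.isHomog (d := 1) hf hreg h)

/-! ### The associated graded ring of a complete intersection is free -/

/-- The powers of `I` have generating families which are bases of `I ^ k / I ^ (k + 1)`
over `S / I`. -/
def HasPowerBasis (I : Ideal (MvPolynomial σ K)) : Prop :=
  ∀ k, ∃ (N : ℕ) (b : Fin N → MvPolynomial σ K), (∀ t, (b t).IsHomogeneous (2 * k)) ∧
    Ideal.span (Set.range b) = I ^ k ∧
    ∀ c : Fin N → MvPolynomial σ K, ∑ t, c t * b t ∈ I ^ (k + 1) → ∀ t, c t ∈ I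

theorem mem_span_range_iff {ι : Type*} [Fintype ι] {b : ι → MvPolynomial σ K}
    {p : MvPolynomial σ K} :
    p ∈ Ideal.span (Set.range b) ↔ ∃ c : ι → MvPolynomial σ K, ∑ t, c t * b t = p :=
  Submodule.mem_span_range_iff_exists_fun _

theorem span_singleton_mul_span_range {ι : Type*} (f : MvPolynomial σ K)
    (b : ι → MvPolynomial σ K) :
    Ideal.span {f} * Ideal.span (Set.range b) = Ideal.span (Set.range fun t => f * b t) := by
  rw [Ideal.span_mul_span']
  congr 1
  ext x
  simp

/-- If f p ∈ I^(k+1), then inductively p = ∑ c_t b_t with b a basis of I^k modulo I^(k+1);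
independence puts every f c_t in I, hence every c_t. -/
theorem HasPowerBasis.regularMod_pow {I : Ideal (MvPolynomial σ K)} (hI : HasPowerBasis I)
    {f : MvPolynomial σ K} (hf : RegularMod I f) (k : ℕ) : RegularMod (I ^ k) f := by
  induction k with
  | zero => intro p _; simp
  | succ k ih =>
    intro p hp
    obtain ⟨N, b, -, hspan, hind⟩ := hI k
    have hpk := ih p (Ideal.pow_le_pow_right (Nat.le_succ k) hp)
    rw [← hspan, mem_span_range_iff] at hpk
    obtain ⟨c, rfl⟩ := hpk
    have hc : ∀ t, c t ∈ I := by
      intro t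
      refine hf _ (hind (fun t => f * c t) ?_ t)
      simpa only [mul_assoc, Finset.mul_sum] using hp
    rw [pow_succ']
    refine Ideal.sum_mem _ fun t _ => Ideal.mul_mem_mul (hc t) ?_
    rw [← hspan]
    exact Ideal.subset_span ⟨t, rfl⟩

/-- Splits products of k + 1 factors according to whether f occurs at all. Its companion
`sup_span_pow_succ'` splits according to whether a factor from I occurs. -/
theorem sup_span_pow_succ (I : Ideal (MvPolynomial σ K)) (f : MvPolynomial σ K) (k : ℕ) :
    (I ⊔ Ideal.span {f}) ^ (k + 1) = I ^ (k + 1) ⊔ Ideal.span {f} * (I ⊔ Ideal.span {f}) ^ k := by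
  apply le_antisymm
  · induction k with
    | zero => simp
    | succ k ih =>
      rw [pow_succ' (I ⊔ Ideal.span {f}) (k + 1), Ideal.sup_mul]
      refine sup_le ?_ le_sup_right
      calc I * (I ⊔ Ideal.span {f}) ^ (k + 1)
          ≤ I * (I ^ (k + 1) ⊔ Ideal.span {f} * (I ⊔ Ideal.span {f}) ^ k) :=
            Ideal.mul_mono le_rfl ih
        _ = I ^ (k + 2) ⊔ Ideal.span {f} * (I * (I ⊔ Ideal.span {f}) ^ k) := by
            rw [Ideal.mul_sup, ← pow_succ', mul_left_comm]
        _ ≤ _ := by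
            refine sup_le_sup le_rfl (Ideal.mul_mono le_rfl ?_)
            rw [pow_succ']
            exact Ideal.mul_mono le_sup_left le_rfl
  · refine sup_le (Ideal.pow_right_mono le_sup_left _) ?_
    rw [pow_succ']
    exact Ideal.mul_mono le_sup_right le_rfl

/-- A basis in degree k + 1 for I + (f) consists of one for I in degree k + 1 and of f times one for
I + (f) in degree k, as for the monomials of a polynomial ring in one more variable. -/
theorem HasPowerBasis.add {I : Ideal (MvPolynomial σ K)} (hI : HasPowerBasis I)
    {f : MvPolynomial σ K} (hf2 : f.IsHomogeneous 2) (hf : RegularMod I f) :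
    HasPowerBasis (I ⊔ Ideal.span {f}) := by
  intro k
  induction k with
  | zero =>
    refine ⟨1, fun _ => 1, fun _ => isHomogeneous_one σ K, by simp, fun c hc t => ?_⟩
    rw [Subsingleton.elim t 0]
    simpa using hc
  | succ k ih =>
    obtain ⟨N, b, hb, hspan, hind⟩ := ih
    obtain ⟨M, a, ha, hspan', hind'⟩ := hI (k + 1)
    refine ⟨M + N, Fin.append a (fun t => f * b t), ?_, ?_, ?_⟩
    · intro t
      refine Fin.addCases (fun t => ?_) (fun t => ?_) t
      · rw [Fin.append_left]; exact ha t
      · rw [Fin.append_right]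
        have := hf2.mul (hb t)
        rwa [show 2 + 2 * k = 2 * (k + 1) by ring] at this
    · rw [sup_span_pow_succ, ← hspan, ← hspan', span_singleton_mul_span_range,
        ← Ideal.span_union]
      congr 1
      ext x
      simp only [Set.mem_range, Set.mem_union]
      constructor
      · rintro ⟨t, rfl⟩
        refine Fin.addCases (fun t => ?_) (fun t => ?_) t
        · rw [Fin.append_left]; exact Or.inl ⟨t, rfl⟩
        · rw [Fin.append_right]; exact Or.inr ⟨t, rfl⟩
      · rintro (⟨t, rfl⟩ | ⟨t, rfl⟩)
        · exact ⟨Fin.castAdd N t, Fin.append_left _ _ _⟩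
        · exact ⟨Fin.natAdd M t, Fin.append_right _ _ _⟩
    · intro c hc
      rw [Fin.sum_univ_add] at hc
      simp only [Fin.append_left, Fin.append_right] at hc
      rw [sup_span_pow_succ] at hc
      obtain ⟨x, hx, y, hy, hxy⟩ := Submodule.mem_sup.1 hc
      obtain ⟨q, hq, rfl⟩ := Ideal.mem_span_singleton_mul.1 hy
      -- The relation reads ∑ c a + f ∑ c' b = x + f q with x ∈ I^(k+2). So f e ∈ I^(k+1), and e ∈
      -- I^(k+1) by regularity of f on I^(k+1). This controls c' through e + q, and c through the
      -- expansion e = ∑ u a.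
      set e := ∑ t, c (Fin.natAdd M t) * b t - q with he
      have hfe : f * e = x - ∑ t, c (Fin.castAdd N t) * a t := by
        have h1 : ∑ t, c (Fin.natAdd M t) * (f * b t) = f * ∑ t, c (Fin.natAdd M t) * b t := by
          rw [Finset.mul_sum]; exact Finset.sum_congr rfl fun t _ => by ring
        rw [h1] at hxy
        rw [he]
        linear_combination -hxy
      have hak : ∀ t, a t ∈ I ^ (k + 1) := fun t => by
        rw [← hspan']; exact Ideal.subset_span ⟨t, rfl⟩
      have heI : e ∈ I ^ (k + 1) := by
        refine hI.regularMod_pow hf (k + 1) e ?_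
        rw [hfe]
        exact sub_mem (Ideal.pow_le_pow_right (Nat.le_succ _) hx)
          (Ideal.sum_mem _ fun t _ => Ideal.mul_mem_left _ _ (hak t))
      have hright : ∀ t, c (Fin.natAdd M t) ∈ I ⊔ Ideal.span {f} := by
        refine hind _ ?_
        have : ∑ t, c (Fin.natAdd M t) * b t = e + q := by rw [he]; ring
        rw [this]
        exact add_mem (Ideal.pow_right_mono le_sup_left _ heI) hq
      rw [← hspan', mem_span_range_iff] at heI
      obtain ⟨u, hu⟩ := heI
      have hleft : ∀ t, c (Fin.castAdd N t) + f * u t ∈ I := by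
        refine hind' (fun t => c (Fin.castAdd N t) + f * u t) ?_
        have : ∑ t, (c (Fin.castAdd N t) + f * u t) * a t = x := by
          simp only [add_mul, Finset.sum_add_distrib, mul_assoc]
          rw [← Finset.mul_sum, hu, hfe]
          ring
        rw [this]
        exact hx
      intro t
      refine Fin.addCases (fun t => ?_) (fun t => hright t) t
      have h1 := sub_mem (Ideal.mem_sup_left (T := Ideal.span {f}) (hleft t))
        (Ideal.mem_sup_right (S := I)
          (Ideal.mul_mem_right (u t) _ (Ideal.mem_span_singleton_self f)))
      simpa using h1

theorem QuadricCI.hasPowerBasis {I : Ideal (MvPolynomial σ K)} {r : ℕ} (hI : QuadricCI I r) :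
    HasPowerBasis I := by
  induction hI with
  | bot =>
    rintro (_ | k)
    · refine ⟨1, fun _ => 1, fun _ => isHomogeneous_one σ K, by simp, fun c hc t => ?_⟩
      rw [Subsingleton.elim t 0]
      simpa using hc
    · refine ⟨0, Fin.elim0, fun t => t.elim0, ?_, fun c _ t => t.elim0⟩
      rw [pow_succ, Ideal.mul_bot, Set.range_eq_empty, Ideal.span_empty]
  | add _ hf hreg ih => exact ih.add hf hreg

/-! ### Powers of complete intersections -/

theorem powerBasis_colon {I : Ideal (MvPolynomial σ K)} {k N : ℕ} {b : Fin N → MvPolynomial σ K}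
    (hspan : Ideal.span (Set.range b) = I ^ k) (t : Fin N) (p : MvPolynomial σ K) (hp : p ∈ I) :
    b t * p ∈ I ^ (k + 1) := by
  rw [pow_succ, ← hspan]
  exact Ideal.mul_mem_mul (Ideal.subset_span ⟨t, rfl⟩) hp

theorem pow_succ_sup_span {I : Ideal (MvPolynomial σ K)} {k N : ℕ} {b : Fin N → MvPolynomial σ K}
    (hspan : Ideal.span (Set.range b) = I ^ k) :
    I ^ (k + 1) ⊔ Ideal.span (Set.range b) = I ^ k := by
  rw [hspan, sup_eq_right]
  exact Ideal.pow_le_pow_right (Nat.le_succ k)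

/-- I^k/I^(k+1) is a direct sum of copies of (S/I)(-2k), of regularity at most 2k + r, and this
bound dominates the one already known for S/I^k. -/
theorem QuadricCI.regLE_pow {I : Ideal (MvPolynomial σ K)} {r : ℕ} (hI : QuadricCI I r) (k : ℕ) :
    RegLE (I ^ (k + 1)) (2 * k + r) := by
  have key : ∀ k ρ, 2 * k + r ≤ ρ → RegLE (I ^ k) ρ → RegLE (I ^ (k + 1)) ρ := by
    intro k ρ hρ h
    obtain ⟨N, b, hb, hspan, hind⟩ := hI.hasPowerBasis k
    rw [← pow_succ_sup_span hspan] at h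
    have := family_induction_down (P := fun A => RegLE A ρ) (isHomog_pow hI.isHomog (k + 1)) hb
      (powerBasis_colon hspan) hind
      (fun A' t hA' hQ h' => RegLE.middle hA' (hb t) hQ hI.regLE (by omega) h') h ∅
    simpa using this
  induction k with
  | zero => exact key 0 _ le_rfl (by rw [pow_zero, Ideal.one_eq_top]; exact fun i j _ => torVanishes_top i j)
  | succ k ih => exact key (k + 1) _ le_rfl (ih.mono (by omega))

/-- The intermediate ideals between I^(k+1) and I^k are included because the nonvanishing argument
uses I^(k+1) + (b_t). -/
theorem QuadricCI.pdLE_pow_sup {I : Ideal (MvPolynomial σ K)} {r : ℕ} (hI : QuadricCI I r)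
    {k N : ℕ} {b : Fin N → MvPolynomial σ K} (hb : ∀ t, (b t).IsHomogeneous (2 * k))
    (hspan : Ideal.span (Set.range b) = I ^ k)
    (hind : ∀ c : Fin N → MvPolynomial σ K, ∑ t, c t * b t ∈ I ^ (k + 1) → ∀ t, c t ∈ I)
    (h : PdLE (I ^ k) r) (s : Finset (Fin N)) :
    PdLE (I ^ (k + 1) ⊔ Ideal.span (b '' (s : Set (Fin N)))) r := by
  rw [← pow_succ_sup_span hspan] at h
  exact family_induction_down (P := fun A => PdLE A r) (isHomog_pow hI.isHomog (k + 1)) hb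
    (powerBasis_colon hspan) hind
    (fun A' t hA' hQ h' => PdLE.middle hA' (hb t) hQ hI.pdLE h') h s

theorem QuadricCI.pdLE_pow {I : Ideal (MvPolynomial σ K)} {r : ℕ} (hI : QuadricCI I r) (k : ℕ) :
    PdLE (I ^ k) r := by
  induction k with
  | zero => rw [pow_zero, Ideal.one_eq_top]; exact fun i j _ => torVanishes_top i j
  | succ k ih =>
    obtain ⟨N, b, hb, hspan, hind⟩ := hI.hasPowerBasis k
    simpa using hI.pdLE_pow_sup hb hspan hind ih ∅

/-- Tor_{r+1}(S/(I^(k+1) + (b_t))) vanishes by projective dimension, so multiplication by b_t embeds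
Tor_r(S/I)(-2k) into Tor_r(S/I^(k+1)) and carries the top Koszul class along. Nonzero I ensures that
some b_t exists. -/
theorem QuadricCI.not_torVanishes_pow {I : Ideal (MvPolynomial σ K)} {r : ℕ} (hI : QuadricCI I r)
    (hne : I ≠ ⊥) (k : ℕ) : ¬ TorVanishes (I ^ (k + 1)) r (2 * r + 2 * k) := by
  intro h
  obtain ⟨N, b, hb, hspan, hind⟩ := hI.hasPowerBasis k
  have hN : N ≠ 0 := by
    rintro rfl
    rw [Set.range_eq_empty, Ideal.span_empty] at hspan
    exact pow_ne_zero k hne hspan.symm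
  let t : Fin N := ⟨0, Nat.pos_of_ne_zero hN⟩
  have hQ := mem_colon_family_iff (powerBasis_colon hspan) hind (s := ∅) (t := t) (by simp)
  have hpd := hI.pdLE_pow_sup hb hspan hind (hI.pdLE_pow k) {t}
  simp only [Finset.coe_singleton, Set.image_singleton] at hpd
  simp only [Finset.coe_empty, Set.image_empty, Ideal.span_empty, sup_bot_eq] at hQ
  exact hI.not_torVanishes (TorVanishes.left (isHomog_pow hI.isHomog _) (hb t) hQ
    (hpd _ _ (Nat.lt_succ_self r)) h)

/-! ### Powers of almost complete intersections -/

theorem exists_homogeneous_family_coeff {ι : Type*} [Fintype ι] {b : ι → MvPolynomial σ K}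
    {d e : ℕ} (hb : ∀ t, (b t).IsHomogeneous d) {p : MvPolynomial σ K} (hp : p.IsHomogeneous e)
    (h : p ∈ Ideal.span (Set.range b)) :
    ∃ y : ι → MvPolynomial σ K, ∑ t, b t * y t = p ∧
      ∀ t, y t ≠ 0 → ∃ k, k + d = e ∧ (y t).IsHomogeneous k := by
  obtain ⟨c, hc⟩ := mem_span_range_iff.1 h
  have h1 : p = ∑ t, homogeneousComponent e (b t * c t) :=
    calc p = homogeneousComponent e p := (homogeneousComponent_eq_self hp).symm
      _ = homogeneousComponent e (∑ t, b t * c t) := by rw [← hc]; simp only [mul_comm]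
      _ = _ := map_sum _ _ _
  by_cases hde : d ≤ e
  · obtain ⟨k, rfl⟩ := Nat.exists_eq_add_of_le' hde
    refine ⟨fun t => homogeneousComponent k (c t), ?_,
      fun t _ => ⟨k, rfl, homogeneousComponent_isHomogeneous k (c t)⟩⟩
    rw [h1]
    exact Finset.sum_congr rfl fun t _ =>
      (homogeneousComponent_mul_of_isHomogeneous (hb t) rfl _).symm
  · refine ⟨0, ?_, fun t h => absurd rfl h⟩
    rw [h1]
    exact Finset.sum_congr rfl fun t _ => by
      rw [homogeneousComponent_mul_of_lt (hb t) (by omega)]; simp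

theorem IsKoszulChain.exists_family_coeff {ι : Type*} [Fintype ι] {b : ι → MvPolynomial σ K}
    {d i j : ℕ} (hb : ∀ t, (b t).IsHomogeneous d) {z : Finset σ → MvPolynomial σ K}
    (hz : IsKoszulChain i j z) (h : ∀ B, z B ∈ Ideal.span (Set.range b)) :
    ∃ y : ι → Finset σ → MvPolynomial σ K, z = ∑ t, b t • y t ∧
      (∀ t, IsKoszulChain i (j - d) (y t)) ∧ (d ≤ j ∨ y = 0) := by
  have key : ∀ B, ∃ y : ι → MvPolynomial σ K, ∑ t, b t * y t = z B ∧
      ∀ t, y t ≠ 0 → B.card = i ∧ ∃ k, k + d + i = j ∧ (y t).IsHomogeneous k := by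
    intro B
    by_cases h0 : z B = 0
    · exact ⟨0, by simp [h0], fun _ h => absurd rfl h⟩
    · obtain ⟨hc, e, he, hh⟩ := hz B h0
      obtain ⟨y, hy, hy'⟩ := exists_homogeneous_family_coeff hb hh (h B)
      refine ⟨y, hy, fun t hne => ⟨hc, ?_⟩⟩
      obtain ⟨k, hk, hk'⟩ := hy' t hne
      exact ⟨k, by omega, hk'⟩
  choose y hy hy' using key
  refine ⟨fun t B => y B t, ?_, fun t B hB => ?_, ?_⟩
  · funext B
    rw [← hy, Finset.sum_apply]
    rfl
  · obtain ⟨hc, k, hk, hh⟩ := hy' B t hB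
    exact ⟨hc, k, by omega, hh⟩
  · by_cases hd : d ≤ j
    · exact Or.inl hd
    · right
      funext t B
      by_contra hB
      obtain ⟨_, k, hk, _⟩ := hy' B t hB
      omega

theorem sup_span_pow_succ' (I : Ideal (MvPolynomial σ K)) (f : MvPolynomial σ K) (k : ℕ) :
    (I ⊔ Ideal.span {f}) ^ (k + 1) = I * (I ⊔ Ideal.span {f}) ^ k ⊔ Ideal.span {f ^ (k + 1)} := by
  induction k with
  | zero => simp
  | succ k ih =>
    apply le_antisymm
    · rw [pow_succ (I ⊔ Ideal.span {f}) (k + 1), Ideal.mul_sup]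
      refine sup_le ?_ ?_
      · rw [mul_comm]; exact le_sup_left
      · conv_lhs => rw [ih]
        rw [Ideal.sup_mul]
        refine sup_le_sup ?_ ?_
        · rw [mul_assoc, pow_succ]
          exact Ideal.mul_mono le_rfl (Ideal.mul_mono le_rfl le_sup_right)
        · rw [Ideal.span_singleton_mul_span_singleton, ← pow_succ]
    · refine sup_le ?_ ?_
      · rw [pow_succ' (I ⊔ Ideal.span {f}) (k + 1)]
        exact Ideal.mul_mono le_sup_left le_rfl
      · rw [← Ideal.span_singleton_pow]
        exact Ideal.pow_right_mono le_sup_right _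

/-- Regularity of the powers of `I + (e)`, where `I` is generated by a regular sequence of
quadrics and `I : e = I : e ^ m`. -/
theorem QuadricCI.regLE_pow_sup {I Q : Ideal (MvPolynomial σ K)} {r ρ q : ℕ}
    {e : MvPolynomial σ K} (hI : QuadricCI I r) (he : e.IsHomogeneous 2)
    (hQ : ∀ p, p ∈ Q ↔ e * p ∈ I) (hQ' : ∀ m p, e ^ (m + 1) * p ∈ I → e * p ∈ I)
    (hregQ : RegLE Q q) (hregJ : RegLE (I ⊔ Ideal.span {e}) ρ) (hqρ : q + 1 ≤ ρ)
    (hrρ : r ≤ ρ + 2) (s : ℕ) : RegLE ((I ⊔ Ideal.span {e}) ^ (s + 1)) (2 * s + ρ) := by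
  intro i j hij
  set J := I ⊔ Ideal.span {e} with hJ
  have hIJ : I ≤ J := le_sup_left
  have hIhom := hI.isHomog
  have hJhom : IsHomog J := hIhom.sup (isHomog_span_singleton he)
  have hTorPow : TorVanishes (I ^ s) i j := by
    rcases s with _ | s
    · rw [pow_zero, Ideal.one_eq_top]; exact torVanishes_top i j
    · exact hI.regLE_pow s i j (by omega)
  -- For the ideals A ⊆ J^(s+1) used below, P A says that the natural map Tor_i(S/A)_j →
  -- Tor_i(S/J^(s+1))_j is zero.
  let P : Ideal (MvPolynomial σ K) → Prop := fun A => ∀ z, IsKoszulChain i j z →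
    (∀ B, polyD z B ∈ A) → IsBoundaryMod (J ^ (s + 1)) i j z
  -- A cycle modulo I^(s+1) is a boundary modulo I^s, so up to a boundary it is ∑ b_t y_t with b a
  -- basis of I^s modulo I^(s+1). Independence makes each y_t a cycle modulo I, hence a boundary
  -- modulo J by the bound on reg(S/J), and b_t J ⊆ J^(s+1).
  have hbase : P (I ^ (s + 1)) := by
    intro z hz hdz
    obtain ⟨w, hw, hwz⟩ := hTorPow z hz fun B =>
      Ideal.pow_le_pow_right (Nat.le_succ s) (hdz B)
    obtain ⟨N, b, hb, hspan, hind⟩ := hI.hasPowerBasis s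
    obtain ⟨y, hy, hyc, hd⟩ := (hz.sub hw.polyD).exists_family_coeff hb
      fun B => by rw [hspan]; exact hwz B
    rcases hd with hd | rfl
    · have hdy : ∀ t B, polyD (y t) B ∈ I := by
        intro t B
        refine hind (fun t => polyD (y t) B) ?_ t
        have h1 : polyD (z - polyD w) B = polyD z B := by
          rw [map_sub, koszulD_comp_self, sub_zero]
        have h2 := hdz B
        rw [← h1, hy, map_sum, Finset.sum_apply] at h2
        convert h2 using 1
        exact Finset.sum_congr rfl fun t _ => by rw [polyD_smul, mul_comm]
      have hyJ : ∀ t, IsBoundaryMod J i (j - 2 * s) (y t) := fun t =>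
        hregJ i (j - 2 * s) (by omega) (y t) (hyc t) fun B => hIJ (hdy t B)
      choose w' hw' hwy using hyJ
      refine ⟨w + ∑ t, b t • w' t, hw.add (IsKoszulChain.sum _ _ fun t _ => ?_), fun B => ?_⟩
      · have := (hw' t).smul (hb t)
        rwa [Nat.sub_add_cancel hd] at this
      · have h1 : z B - polyD (w + ∑ t, b t • w' t) B =
            ∑ t, b t * (y t B - polyD (w' t) B) := by
          have h2 := congrFun hy B
          rw [Pi.sub_apply, Finset.sum_apply] at h2
          rw [map_add, Pi.add_apply, ← sub_sub, h2, map_sum, Finset.sum_apply,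
            ← Finset.sum_sub_distrib]
          exact Finset.sum_congr rfl fun t _ => by
            rw [polyD_smul, Pi.smul_apply, smul_eq_mul, mul_sub]
        rw [h1, pow_succ]
        refine Ideal.sum_mem _ fun t _ => Ideal.mul_mem_mul
          (Ideal.pow_right_mono hIJ s ?_) (hwy t B)
        rw [← hspan]
        exact Ideal.subset_span ⟨t, rfl⟩
    · refine ⟨w, hw, fun B => ?_⟩
      have := congrFun hy B
      simp only [Pi.zero_apply, smul_zero, Finset.sum_const_zero] at this
      rw [Pi.sub_apply] at this
      rw [this]
      exact Submodule.zero_mem _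
  -- Factors from I are traded for factors from J; one trade adjoins the elements b_t e^(m+1), with
  -- b a basis of I^k modulo I^(k+1).
  have hchain : ∀ m k, k + m = s + 1 → P (I ^ k * J ^ m) := by
    intro m
    induction m with
    | zero =>
      intro k hk
      rw [pow_zero, mul_one, show k = s + 1 by omega]
      exact hbase
    | succ m ih =>
      intro k hk
      obtain ⟨N, b, hb, hspan, hind⟩ := hI.hasPowerBasis k
      have hAhom : IsHomog (I ^ (k + 1) * J ^ m) :=
        (isHomog_pow hIhom _).mul (isHomog_pow hJhom _)
      have hbm : ∀ t, (b t * e ^ (m + 1)).IsHomogeneous (2 * (s + 1)) := by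
        intro t
        have := (hb t).mul (he.pow (m + 1))
        rwa [show 2 * k + 2 * (m + 1) = 2 * (s + 1) by omega] at this
      have hsup : I ^ k * J ^ (m + 1) =
          I ^ (k + 1) * J ^ m ⊔ Ideal.span (Set.range fun t => b t * e ^ (m + 1)) := by
        rw [hJ, sup_span_pow_succ', Ideal.mul_sup, ← mul_assoc, ← pow_succ, ← hspan,
          mul_comm (Ideal.span (Set.range b)) (Ideal.span _), span_singleton_mul_span_range]
        congr 2
        ext x
        simp [mul_comm]
      have hbk : ∀ t, b t ∈ I ^ k := fun t => by
        rw [← hspan]; exact Ideal.subset_span ⟨t, rfl⟩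
      rw [hsup]
      -- The colon ideal of every step is Q = I : e. It kills b_t e^(m+1) modulo I^(k+1) J^m, and
      -- conversely independence gives c e^(m+1) ∈ I, so that c ∈ I : e since I : e^(m+1) = I : e.
      refine family_induction_up (Q := Q) hAhom hbm ?_ ?_ (fun A' t hA' hQA' hP => ?_)
        (ih (k + 1) (by omega))
      · intro t p hp
        rw [pow_succ, show b t * e ^ (m + 1) * p = (b t * (e * p)) * e ^ m by ring]
        exact Ideal.mul_mem_mul (Ideal.mul_mem_mul (hbk t) ((hQ p).1 hp))
          (Ideal.pow_mem_pow (Ideal.mem_sup_right (Ideal.mem_span_singleton_self e)) m)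
      · intro c hc t
        rw [hQ]
        refine hQ' m _ ?_
        have := hind (fun t => c t * e ^ (m + 1)) ?_ t
        · rwa [mul_comm]
        · have h1 := Ideal.mul_le_left hc
          convert h1 using 1
          exact Finset.sum_congr rfl fun t _ => by ring
      · intro z hz hdz
        -- The obstruction to lifting the cycle lies in Tor_{i-1}(S/Q) in degree j - 2(s+1), and q +
        -- 1 ≤ ρ makes it vanish. The lift changes the cycle only by multiples of b_t e^(m+1) ∈
        -- J^(s+1).
        obtain ⟨u, hu, hdu, hzu⟩ := hz.exists_lift_cycle hA' (hbm t) hQA'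
          (fun i' j' hi' hj' => hregQ i' j' (by omega)) hdz
        refine (hP u hu hdu).of_sub_mem fun B => ?_
        refine (Ideal.span_singleton_le_iff_mem _).2 ?_ (hzu B)
        have h1 : b t * e ^ (m + 1) ∈ J ^ k * J ^ (m + 1) :=
          Ideal.mul_mem_mul (Ideal.pow_right_mono hIJ k (hbk t))
            (Ideal.pow_mem_pow (Ideal.mem_sup_right (Ideal.mem_span_singleton_self e)) _)
        rwa [← pow_add, hk] at h1
  -- At k = 0 the map in P is the identity of Tor_i(S/J^(s+1))_j.
  have := hchain (s + 1) 0 (by omega)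
  rw [pow_zero, one_mul] at this
  exact this

end CompleteIntersection

/-! ### Binomial edge ideals: completing and deleting vertices, toric kernels, nonzerodivisors -/

section EdgeIdeals

variable {K : Type*} [Field K] {n : ℕ}

variable (K) in
/-- The variable `x_i`. -/
def xVar (i : Fin n) : MvPolynomial (Vars n) K := X (Sum.inlₗ i)

variable (K) in
/-- The variable `y_i`. -/
def yVar (i : Fin n) : MvPolynomial (Vars n) K := X (Sum.inrₗ i)

variable (K) in
/-- The binomial `x_i y_j - x_j y_i`. -/
def edgeBinom (i j : Fin n) : MvPolynomial (Vars n) K :=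
  xVar K i * yVar K j - xVar K j * yVar K i

theorem edgeBinom_comm (i j : Fin n) : edgeBinom K i j = - edgeBinom K j i := by
  unfold edgeBinom; ring

theorem edgeBinom_mem {G : SimpleGraph (Fin n)} {i j : Fin n} (h : G.Adj i j) :
    edgeBinom K i j ∈ binomialEdgeIdeal K G := by
  rcases lt_or_gt_of_ne h.ne with hlt | hlt
  · exact Ideal.subset_span ⟨i, j, hlt, h, rfl⟩
  · rw [edgeBinom_comm]
    exact neg_mem (Ideal.subset_span ⟨j, i, hlt, h.symm, rfl⟩)

theorem binomialEdgeIdeal_le_iff {G : SimpleGraph (Fin n)} {A : Ideal (MvPolynomial (Vars n) K)} :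
    binomialEdgeIdeal K G ≤ A ↔ ∀ i j, G.Adj i j → edgeBinom K i j ∈ A := by
  refine ⟨fun h i j hij => h (edgeBinom_mem hij), fun h => Ideal.span_le.2 ?_⟩
  rintro _ ⟨i, j, _, hij, rfl⟩
  exact h i j hij

theorem binomialEdgeIdeal_mono {G H : SimpleGraph (Fin n)} (h : G ≤ H) :
    binomialEdgeIdeal K G ≤ binomialEdgeIdeal K H :=
  binomialEdgeIdeal_le_iff.2 fun _ _ hij => edgeBinom_mem (h hij)

theorem isHomogeneous_edgeBinom (i j : Fin n) : (edgeBinom K i j).IsHomogeneous 2 :=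
  ((isHomogeneous_X K _).mul (isHomogeneous_X K _)).sub
    ((isHomogeneous_X K _).mul (isHomogeneous_X K _))

theorem isHomog_binomialEdgeIdeal (G : SimpleGraph (Fin n)) :
    IsHomog (binomialEdgeIdeal K G) :=
  Ideal.homogeneous_span _ _ fun x hx => by
    obtain ⟨i, j, _, _, rfl⟩ := hx
    exact ⟨2, isHomogeneous_edgeBinom i j⟩

/-- The neighbourhood of `v` is a clique. -/
def IsFree (G : SimpleGraph (Fin n)) (v : Fin n) : Prop :=
  ∀ a b, G.Adj v a → G.Adj v b → a ≠ b → G.Adj a b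

/-- The graph obtained by completing the neighbourhood of `v`. -/
def completeAt (G : SimpleGraph (Fin n)) (v : Fin n) : SimpleGraph (Fin n) where
  Adj a b := a ≠ b ∧ (G.Adj a b ∨ ((a = v ∨ G.Adj v a) ∧ (b = v ∨ G.Adj v b)))
  symm := ⟨fun _ _ h => ⟨h.1.symm, h.2.imp (fun h => h.symm) fun h => ⟨h.2, h.1⟩⟩⟩
  loopless := ⟨fun _ h => h.1 rfl⟩

/-- The graph obtained by isolating `v`. -/
def isolate (G : SimpleGraph (Fin n)) (v : Fin n) : SimpleGraph (Fin n) where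
  Adj a b := G.Adj a b ∧ a ≠ v ∧ b ≠ v
  symm := ⟨fun _ _ h => ⟨h.1.symm, h.2.2, h.2.1⟩⟩
  loopless := ⟨fun a h => G.loopless.irrefl a h.1⟩

theorem le_completeAt (G : SimpleGraph (Fin n)) (v : Fin n) : G ≤ completeAt G v :=
  fun _ _ h => ⟨h.ne, Or.inl h⟩

theorem isolate_le (G : SimpleGraph (Fin n)) (v : Fin n) : isolate G v ≤ G :=
  fun _ _ h => h.1

theorem completeAt_adj_self {G : SimpleGraph (Fin n)} {v a : Fin n} :
    (completeAt G v).Adj v a ↔ G.Adj v a := by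
  constructor
  · rintro ⟨h, h' | ⟨-, h' | h'⟩⟩
    · exact h'
    · exact absurd h'.symm h
    · exact h'
  · intro h; exact le_completeAt G v h

theorem isFree_completeAt_self (G : SimpleGraph (Fin n)) (v : Fin n) :
    IsFree (completeAt G v) v := by
  intro a b ha hb hab
  rw [completeAt_adj_self] at ha hb
  exact ⟨hab, Or.inr ⟨Or.inr ha, Or.inr hb⟩⟩

theorem IsFree.completeAt {G : SimpleGraph (Fin n)} {u : Fin n} (hu : IsFree G u) (v : Fin n) :
    IsFree (completeAt G v) u := by
  by_cases huv : u = v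
  · subst huv; exact isFree_completeAt_self G u
  by_cases hvu : G.Adj v u
  · have key : ∀ a, (BinomialEdge.completeAt G v).Adj u a → a = v ∨ G.Adj v a := by
      rintro a ⟨hne, h | ⟨-, h⟩⟩
      · by_cases hav : a = v
        · exact Or.inl hav
        · exact Or.inr (hu v a hvu.symm h (Ne.symm hav))
      · exact h
    exact fun a b ha hb hab => ⟨hab, Or.inr ⟨key a ha, key b hb⟩⟩
  · have key : ∀ a, (BinomialEdge.completeAt G v).Adj u a → G.Adj u a := by
      rintro a ⟨hne, h | ⟨h | h, -⟩⟩
      · exact h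
      · exact absurd h huv
      · exact absurd h hvu
    exact fun a b ha hb hab => ⟨hab, Or.inl (hu a b (key a ha) (key b hb) hab)⟩

theorem isFree_isolate_self (G : SimpleGraph (Fin n)) (v : Fin n) : IsFree (isolate G v) v :=
  fun _ _ ha => absurd rfl ha.2.1

theorem IsFree.isolate {G : SimpleGraph (Fin n)} {u : Fin n} (hu : IsFree G u) (v : Fin n) :
    IsFree (isolate G v) u :=
  fun a b ha hb hab => ⟨hu a b ha.1 hb.1 hab, ha.2.2, hb.2.2⟩

theorem reachable_of_forall_adj {V : Type*} {G H : SimpleGraph V}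
    (h : ∀ a b, H.Adj a b → G.Reachable a b) {v w : V} (hvw : H.Reachable v w) :
    G.Reachable v w := by
  obtain ⟨p⟩ := hvw
  induction p with
  | nil => exact .rfl
  | cons hadj _ ih => exact (h _ _ hadj).trans ih

theorem reachable_of_completeAt {G : SimpleGraph (Fin n)} {c v w : Fin n}
    (h : (completeAt G c).Reachable v w) : G.Reachable v w := by
  have key : ∀ a, (a = c ∨ G.Adj c a) → G.Reachable c a := by
    rintro a (rfl | h)
    · exact .rfl
    · exact h.reachable
  refine reachable_of_forall_adj ?_ h
  rintro a b ⟨-, h | ⟨ha, hb⟩⟩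
  · exact h.reachable
  · exact (key a ha).symm.trans (key b hb)

theorem le_comap_mulLeft_iff {R : Type*} [CommRing R] {A B : Ideal R} {f : R} :
    A ≤ Submodule.comap (LinearMap.mulLeft R f) B ↔ ∀ p ∈ A, f * p ∈ B := Iff.rfl

/-- The syzygy x_v f_ab = x_a f_vb - x_b f_va, and its analogue for y_v, for neighbours a, b of v.
-/
theorem var_mul_mem_of_mem_completeAt {G : SimpleGraph (Fin n)} {v : Fin n}
    {p : MvPolynomial (Vars n) K} (hp : p ∈ binomialEdgeIdeal K (completeAt G v)) :
    xVar K v * p ∈ binomialEdgeIdeal K G ∧ yVar K v * p ∈ binomialEdgeIdeal K G := by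
  have key : ∀ f : MvPolynomial (Vars n) K, (∀ a b, G.Adj v a → G.Adj v b →
      f * edgeBinom K a b ∈ binomialEdgeIdeal K G) → f * p ∈ binomialEdgeIdeal K G := by
    intro f hf
    refine le_comap_mulLeft_iff.1 (binomialEdgeIdeal_le_iff.2 ?_) p hp
    rintro a b ⟨hab, h | ⟨rfl | ha, rfl | hb⟩⟩
    · exact Ideal.mul_mem_left _ _ (edgeBinom_mem h)
    · exact absurd rfl hab
    · exact Ideal.mul_mem_left _ _ (edgeBinom_mem hb)
    · exact Ideal.mul_mem_left _ _ (edgeBinom_mem ha.symm)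
    · exact hf a b ha hb
  constructor
  · refine key _ fun a b ha hb => ?_
    have : xVar K v * edgeBinom K a b =
        xVar K a * edgeBinom K v b - xVar K b * edgeBinom K v a := by
      unfold edgeBinom; ring
    rw [this]
    exact sub_mem (Ideal.mul_mem_left _ _ (edgeBinom_mem hb))
      (Ideal.mul_mem_left _ _ (edgeBinom_mem ha))
  · refine key _ fun a b ha hb => ?_
    have : yVar K v * edgeBinom K a b =
        yVar K a * edgeBinom K v b - yVar K b * edgeBinom K v a := by
      unfold edgeBinom; ring
    rw [this]
    exact sub_mem (Ideal.mul_mem_left _ _ (edgeBinom_mem hb))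
      (Ideal.mul_mem_left _ _ (edgeBinom_mem ha))

theorem edgeBinom_mul_mem_of_mem_completeAt {G : SimpleGraph (Fin n)} {v : Fin n} (w : Fin n)
    {p : MvPolynomial (Vars n) K} (hp : p ∈ binomialEdgeIdeal K (completeAt G v)) :
    edgeBinom K v w * p ∈ binomialEdgeIdeal K G := by
  obtain ⟨h1, h2⟩ := var_mul_mem_of_mem_completeAt hp
  have : edgeBinom K v w * p = yVar K w * (xVar K v * p) - xVar K w * (yVar K v * p) := by
    unfold edgeBinom; ring
  rw [this]
  exact sub_mem (Ideal.mul_mem_left _ _ h1) (Ideal.mul_mem_left _ _ h2)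

variable (K) in
/-- The substitution `x_c = y_c = 0`. -/
def killVertex (c : Fin n) : MvPolynomial (Vars n) K →ₐ[K] MvPolynomial (Vars n) K :=
  aeval fun u => if u = Sum.inlₗ c ∨ u = Sum.inrₗ c then 0 else X u

theorem inl_ne_inr (i j : Fin n) : (Sum.inlₗ i : Vars n) ≠ Sum.inrₗ j :=
  fun h => Sum.inl_ne_inr (toLex.injective h)

theorem inl_inj {i j : Fin n} : (Sum.inlₗ i : Vars n) = Sum.inlₗ j ↔ i = j :=
  ⟨fun h => Sum.inl_injective (toLex.injective h), fun h => h ▸ rfl⟩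

theorem inr_inj {i j : Fin n} : (Sum.inrₗ i : Vars n) = Sum.inrₗ j ↔ i = j :=
  ⟨fun h => Sum.inr_injective (toLex.injective h), fun h => h ▸ rfl⟩

theorem killVertex_xVar (c i : Fin n) :
    killVertex K c (xVar K i) = if i = c then 0 else xVar K i := by
  have h : (Sum.inlₗ i : Vars n) = Sum.inlₗ c ∨ (Sum.inlₗ i : Vars n) = Sum.inrₗ c ↔ i = c := by
    rw [inl_inj, or_iff_left (inl_ne_inr i c)]
  simp only [killVertex, xVar, aeval_X, h]

theorem killVertex_yVar (c i : Fin n) :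
    killVertex K c (yVar K i) = if i = c then 0 else yVar K i := by
  have h : (Sum.inrₗ i : Vars n) = Sum.inlₗ c ∨ (Sum.inrₗ i : Vars n) = Sum.inrₗ c ↔ i = c := by
    rw [inr_inj, or_iff_right (inl_ne_inr c i).symm]
  simp only [killVertex, yVar, aeval_X, h]

theorem killVertex_edgeBinom (c i j : Fin n) :
    killVertex K c (edgeBinom K i j) = if i = c ∨ j = c then 0 else edgeBinom K i j := by
  simp only [edgeBinom, map_sub, map_mul, killVertex_xVar, killVertex_yVar]
  by_cases hi : i = c <;> by_cases hj : j = c <;> simp [hi, hj]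

theorem sub_killVertex_mem (c : Fin n) (p : MvPolynomial (Vars n) K) :
    p - killVertex K c p ∈ Ideal.span {xVar K c, yVar K c} := by
  rw [← Ideal.Quotient.mk_eq_mk_iff_sub_mem]
  have : (Ideal.Quotient.mkₐ K (Ideal.span {xVar K c, yVar K c})) =
      (Ideal.Quotient.mkₐ K (Ideal.span {xVar K c, yVar K c})).comp (killVertex K c) := by
    refine MvPolynomial.algHom_ext fun u => ?_
    simp only [AlgHom.comp_apply, killVertex, aeval_X]
    split_ifs with h
    · rw [map_zero]
      refine Ideal.Quotient.eq_zero_iff_mem.2 (Ideal.subset_span ?_)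
      rcases h with rfl | rfl
      · exact Or.inl rfl
      · exact Or.inr rfl
    · rfl
  exact DFunLike.congr_fun this p

theorem killVertex_mem_isolate {G : SimpleGraph (Fin n)} {c : Fin n}
    {p : MvPolynomial (Vars n) K} (hp : p ∈ binomialEdgeIdeal K G) :
    killVertex K c p ∈ binomialEdgeIdeal K (isolate G c) := by
  refine (binomialEdgeIdeal_le_iff
    (A := Ideal.comap (killVertex K c) (binomialEdgeIdeal K (isolate G c)))).2 ?_ hp
  intro i j hij
  rw [Ideal.mem_comap, killVertex_edgeBinom]
  split_ifs with h
  · exact Submodule.zero_mem _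
  · push Not at h
    exact edgeBinom_mem ⟨hij, h.1, h.2⟩

/-- On generators: edges of the completion at c are edges of G and map to 0, all other edges are
fixed. On products the defect is (a - κ(a)) x + κ(a) (x - κ(x)), where κ is the substitution, a -
κ(a) ∈ (x_c, y_c), and these variables multiply the completed ideal into J_G. -/
theorem sub_killVertex_mem_of_mem_completeAt {G : SimpleGraph (Fin n)} {c : Fin n}
    {p : MvPolynomial (Vars n) K} (hp : p ∈ binomialEdgeIdeal K (completeAt G c)) :
    p - killVertex K c p ∈ binomialEdgeIdeal K G := by
  unfold binomialEdgeIdeal at hp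
  induction hp using Submodule.span_induction with
  | mem x hx =>
    obtain ⟨i, j, _, ⟨hne, hij⟩, rfl⟩ := hx
    change edgeBinom K i j - killVertex K c (edgeBinom K i j) ∈ _
    rw [killVertex_edgeBinom]
    split_ifs with h
    · rw [sub_zero]
      refine edgeBinom_mem ?_
      rcases hij with hij | ⟨rfl | hi, rfl | hj⟩
      · exact hij
      · exact absurd rfl hne
      · exact hj
      · exact hi.symm
      · rcases h with rfl | rfl
        · exact hj
        · exact hi.symm
    · rw [sub_self]; exact Submodule.zero_mem _
  | zero => simp
  | add x y _ _ hx hy =>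
    rw [map_add, add_sub_add_comm]
    exact add_mem hx hy
  | smul a x hx ih =>
    rw [smul_eq_mul, map_mul]
    have h1 : a * x - killVertex K c a * killVertex K c x =
        (a - killVertex K c a) * x + killVertex K c a * (x - killVertex K c x) := by ring
    rw [h1]
    refine add_mem ?_ (Ideal.mul_mem_left _ _ ih)
    obtain ⟨s, t, hst⟩ := Ideal.mem_span_pair.1 (sub_killVertex_mem c a)
    obtain ⟨h2, h3⟩ := var_mul_mem_of_mem_completeAt hx
    rw [← hst, add_mul, mul_assoc, mul_assoc]
    exact add_mem (Ideal.mul_mem_left _ _ h2) (Ideal.mul_mem_left _ _ h3)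

/-- `J_G` is the intersection of `J_{G_c}` with `(x_c, y_c) + J_{G \ c}`. -/
theorem mem_of_completeAt_of_isolate {G : SimpleGraph (Fin n)} {c : Fin n}
    {p : MvPolynomial (Vars n) K} (h1 : p ∈ binomialEdgeIdeal K (completeAt G c))
    (h2 : killVertex K c p ∈ binomialEdgeIdeal K (isolate G c)) :
    p ∈ binomialEdgeIdeal K G := by
  have := add_mem (sub_killVertex_mem_of_mem_completeAt h1)
    (binomialEdgeIdeal_mono (isolate_le G c) h2)
  rwa [sub_add_cancel] at this

/-! ### Disjoint unions of complete graphs -/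

section Toric

variable (G : SimpleGraph (Fin n))

/-- The exponents of the toric parametrization `x_i ↦ a_i`, `y_i ↦ a_i t_C`, with `C` the
connected component of `i`. -/
def toricExp (u : Vars n) : (Fin n ⊕ G.ConnectedComponent) →₀ ℕ :=
  Sum.elim (fun i => Finsupp.single (Sum.inl i) 1)
    (fun i => Finsupp.single (Sum.inl i) 1 +
      Finsupp.single (Sum.inr (G.connectedComponentMk i)) 1) (ofLex u)

variable (K) in
/-- The toric parametrization of a disjoint union of complete graphs. -/
def toricMap : MvPolynomial (Vars n) K →ₐ[K]
    MvPolynomial (Fin n ⊕ G.ConnectedComponent) K :=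
  aeval fun u => monomial (toricExp G u) 1

/-- The exponent of the image of a monomial. -/
def toricSum (a : Vars n →₀ ℕ) : (Fin n ⊕ G.ConnectedComponent) →₀ ℕ :=
  ∑ u, a u • toricExp G u

theorem toricMap_monomial (a : Vars n →₀ ℕ) :
    toricMap K G (monomial a 1) = monomial (toricSum G a) 1 := by
  rw [toricMap, aeval_monomial, map_one, one_mul, Finsupp.prod_fintype _ _ (by simp), toricSum]
  simp only [monomial_pow, one_pow]
  rw [← monomial_sum_one]

theorem sum_vars {M : Type*} [AddCommMonoid M] (f : Vars n → M) :
    ∑ u, f u = ∑ i, f (Sum.inlₗ i) + ∑ i, f (Sum.inrₗ i) := by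
  rw [← Equiv.sum_comp toLex f, Fintype.sum_sum_type]

theorem toricSum_inl (a : Vars n →₀ ℕ) (i : Fin n) :
    toricSum G a (Sum.inl i) = a (Sum.inlₗ i) + a (Sum.inrₗ i) := by
  classical
  rw [toricSum, Finsupp.finsetSum_apply, sum_vars]
  simp [toricExp, Finsupp.single_apply]

open Classical in
theorem toricSum_inr (a : Vars n →₀ ℕ) (c : G.ConnectedComponent) :
    toricSum G a (Sum.inr c) =
      ∑ i with G.connectedComponentMk i = c, a (Sum.inrₗ i) := by
  rw [toricSum, Finsupp.finsetSum_apply, sum_vars, Finset.sum_filter]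
  simp [toricExp, Finsupp.single_apply]

theorem toricSum_add (a b : Vars n →₀ ℕ) :
    toricSum G (a + b) = toricSum G a + toricSum G b := by
  simp [toricSum, add_smul, Finset.sum_add_distrib]

variable {G}

theorem adj_of_reachable (hG : ∀ v, IsFree G v) {i j : Fin n} (h : G.Reachable i j)
    (hij : i ≠ j) : G.Adj i j := by
  obtain ⟨p⟩ := h
  induction p with
  | nil => exact absurd rfl hij
  | @cons u v w hadj p ih =>
    by_cases hvw : v = w
    · subst hvw; exact hadj
    · exact hG v u w hadj.symm (ih hvw) hij

/-- The toric exponent records the total y-degree on each connected component, so an excess at i is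
compensated at some j in the same component. -/
theorem exists_exchange {a b : Vars n →₀ ℕ} (hab : toricSum G a = toricSum G b) {i : Fin n}
    (hi : b (Sum.inrₗ i) < a (Sum.inrₗ i)) :
    ∃ j, G.Reachable i j ∧ a (Sum.inrₗ j) < b (Sum.inrₗ j) := by
  classical
  by_contra hcon
  push Not at hcon
  have h := DFunLike.congr_fun hab (Sum.inr (G.connectedComponentMk i))
  rw [toricSum_inr, toricSum_inr] at h
  refine absurd h (ne_of_gt (Finset.sum_lt_sum (fun j hj => hcon j ?_) ⟨i, by simp, hi⟩))
  simp only [Finset.mem_filter, Finset.mem_univ, true_and] at hj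
  exact (SimpleGraph.ConnectedComponent.exact hj).symm

/-- N is the total excess of the y-exponents of a over those of b. Replacing x_j y_i by x_i y_j
across an edge changes the monomial by a multiple of an edge binomial and lowers N by one. -/
theorem monomial_sub_mem (hG : ∀ v, IsFree G v) {b : Vars n →₀ ℕ} (N : ℕ) :
    ∀ a : Vars n →₀ ℕ, toricSum G a = toricSum G b →
      ∑ k, (a (Sum.inrₗ k) - b (Sum.inrₗ k)) = N →
      (monomial a 1 - monomial b 1 : MvPolynomial (Vars n) K) ∈ binomialEdgeIdeal K G := by
  classical
  induction N with
  | zero =>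
    intro a hab hN
    have hle : ∀ k, a (Sum.inrₗ k) ≤ b (Sum.inrₗ k) := by
      intro k
      have := (Finset.sum_eq_zero_iff.1 hN) k (Finset.mem_univ k)
      omega
    have hy : ∀ k, a (Sum.inrₗ k) = b (Sum.inrₗ k) := by
      intro k
      have h := DFunLike.congr_fun hab (Sum.inr (G.connectedComponentMk k))
      rw [toricSum_inr, toricSum_inr, Finset.sum_eq_sum_iff_of_le fun j _ => hle j] at h
      exact h k (by simp)
    have hx : ∀ k, a (Sum.inlₗ k) = b (Sum.inlₗ k) := by
      intro k
      have h := DFunLike.congr_fun hab (Sum.inl k)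
      rw [toricSum_inl, toricSum_inl, hy k] at h
      omega
    have : a = b := by
      ext u
      rcases u with i | i
      · exact hx i
      · exact hy i
    rw [this, sub_self]
    exact Submodule.zero_mem _
  | succ N ih =>
    intro a hab hN
    obtain ⟨i, hi⟩ : ∃ i, b (Sum.inrₗ i) < a (Sum.inrₗ i) := by
      by_contra hcon
      push Not at hcon
      rw [Finset.sum_eq_zero fun k _ => Nat.sub_eq_zero_of_le (hcon k)] at hN
      omega
    obtain ⟨j, hij, hj⟩ := exists_exchange hab hi
    have hne : i ≠ j := by rintro rfl; omega
    have hadj := adj_of_reachable hG hij hne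
    -- The combined exponent of x_j and y_j is the same in a and b, while y_j is deficient in a.
    have hxj : 0 < a (Sum.inlₗ j) := by
      have h := DFunLike.congr_fun hab (Sum.inl j)
      rw [toricSum_inl, toricSum_inl] at h
      omega
    obtain ⟨a₀, rfl⟩ : ∃ a₀, a = a₀ + (Finsupp.single (Sum.inrₗ i) 1 +
        Finsupp.single (Sum.inlₗ j) 1) := by
      refine ⟨a - (Finsupp.single (Sum.inrₗ i) 1 + Finsupp.single (Sum.inlₗ j) 1),
        (tsub_add_cancel_of_le ?_).symm⟩
      intro u
      rw [Finsupp.add_apply, Finsupp.single_apply, Finsupp.single_apply]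
      split_ifs with h1 h2 h2
      · exact absurd (h2.trans h1.symm) (inl_ne_inr _ _)
      · subst h1; omega
      · subst h2; omega
      · omega
    set a' : Vars n →₀ ℕ := a₀ + (Finsupp.single (Sum.inlₗ i) 1 + Finsupp.single (Sum.inrₗ j) 1)
      with ha'
    have hcomp : G.connectedComponentMk i = G.connectedComponentMk j :=
      SimpleGraph.ConnectedComponent.sound hij
    have hsingle : ∀ u : Vars n, toricSum G (Finsupp.single u 1) = toricExp G u := by
      intro u
      rw [toricSum, Finset.sum_eq_single u]
      · simp
      · intro w _ hw; simp [hw.symm]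
      · simp
    have hsum : toricSum G a' = toricSum G b := by
      rw [← hab, ha']
      simp only [toricSum_add, hsingle]
      simp only [toricExp]
      change _ + (Finsupp.single (Sum.inl i) 1 + (Finsupp.single (Sum.inl j) 1 +
        Finsupp.single (Sum.inr (G.connectedComponentMk j)) 1)) =
        _ + ((Finsupp.single (Sum.inl i) 1 +
        Finsupp.single (Sum.inr (G.connectedComponentMk i)) 1) + Finsupp.single (Sum.inl j) 1)
      rw [hcomp]
      abel
    have hval : ∀ k, a' (Sum.inrₗ k) = a₀ (Sum.inrₗ k) + if k = j then 1 else 0 := by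
      intro k
      simp only [ha', Finsupp.add_apply, Finsupp.single_apply, inr_inj, inl_ne_inr, if_false,
        zero_add, eq_comm]
    have hval' : ∀ k, (a₀ + (Finsupp.single (Sum.inrₗ i) 1 + Finsupp.single (Sum.inlₗ j) 1) :
        Vars n →₀ ℕ) (Sum.inrₗ k) = a₀ (Sum.inrₗ k) + if k = i then 1 else 0 := by
      intro k
      simp only [Finsupp.add_apply, Finsupp.single_apply, inr_inj, inl_ne_inr, if_false,
        add_zero, eq_comm]
    have hmeas : ∑ k, (a' (Sum.inrₗ k) - b (Sum.inrₗ k)) = N := by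
      have h1 : ∑ k, ((a' (Sum.inrₗ k) - b (Sum.inrₗ k)) + if k = i then 1 else 0) = N + 1 := by
        rw [← hN]
        refine Finset.sum_congr rfl fun k _ => ?_
        have h2 := hval k
        have h3 := hval' k
        rw [h3, h2]
        rw [hval'] at hi hj
        by_cases hki : k = i
        · subst hki; simp only [if_true, if_neg hne] at hi ⊢; omega
        · by_cases hkj : k = j
          · subst hkj; simp only [if_true, if_neg hki] at hj ⊢; omega
          · simp [hki, hkj]
      rw [Finset.sum_add_distrib] at h1
      simpa using h1
    have hmem := ih a' hsum hmeas
    have hdiff : (monomial (a₀ + (Finsupp.single (Sum.inrₗ i) 1 +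
        Finsupp.single (Sum.inlₗ j) 1)) 1 - monomial a' 1 : MvPolynomial (Vars n) K) =
        monomial a₀ 1 * edgeBinom K j i := by
      have hX : ∀ u v : Vars n, (monomial (a₀ + (Finsupp.single u 1 + Finsupp.single v 1)) 1 :
          MvPolynomial (Vars n) K) = monomial a₀ 1 * (X u * X v) := by
        intro u v
        rw [X, X, monomial_mul, monomial_mul, mul_one, mul_one]
      rw [ha', hX, hX]
      unfold edgeBinom xVar yVar
      ring
    have := add_mem (Ideal.mul_mem_left _ (monomial a₀ 1) (edgeBinom_mem (K := K) hadj.symm)) hmem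
    rw [← hdiff] at this
    simpa using this

/-- A linear partial inverse ψ sends the image of a monomial to the class of a chosen preimage. By
`monomial_sub_mem` the choice is irrelevant modulo J_G, so ψ after the toric map is the quotient
map. -/
theorem mem_of_toricMap_eq_zero (hG : ∀ v, IsFree G v) {p : MvPolynomial (Vars n) K}
    (hp : toricMap K G p = 0) : p ∈ binomialEdgeIdeal K G := by
  classical
  let ψ : MvPolynomial (Fin n ⊕ G.ConnectedComponent) K →ₗ[K]
      MvPolynomial (Vars n) K ⧸ binomialEdgeIdeal K G :=
    (basisMonomials _ K).constr K fun m =>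
      if h : ∃ a, toricSum G a = m then Ideal.Quotient.mk _ (monomial h.choose 1) else 0
  have hψ : ψ ∘ₗ (toricMap K G).toLinearMap =
      (Ideal.Quotient.mkₐ K (binomialEdgeIdeal K G)).toLinearMap := by
    refine (basisMonomials (Vars n) K).ext fun a => ?_
    rw [coe_basisMonomials]
    simp only [LinearMap.comp_apply, AlgHom.toLinearMap_apply, toricMap_monomial]
    have h : ∃ a', toricSum G a' = toricSum G a := ⟨a, rfl⟩
    have h1 : ψ (monomial (toricSum G a) 1) = Ideal.Quotient.mk _ (monomial h.choose 1) := by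
      have := (basisMonomials (Fin n ⊕ G.ConnectedComponent) K).constr_basis K (fun m =>
        if h : ∃ a, toricSum G a = m then
          Ideal.Quotient.mk (binomialEdgeIdeal K G) (monomial h.choose 1) else 0) (toricSum G a)
      rw [coe_basisMonomials, dif_pos h] at this
      exact this
    rw [h1]
    exact (Ideal.Quotient.eq).2 (monomial_sub_mem hG _ _ h.choose_spec rfl)
  have := LinearMap.congr_fun hψ p
  simp only [LinearMap.comp_apply, AlgHom.toLinearMap_apply, hp, map_zero] at this
  exact Ideal.Quotient.eq_zero_iff_mem.1 this.symm

theorem toricMap_xVar (i : Fin n) : toricMap K G (xVar K i) = X (Sum.inl i) := by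
  rw [toricMap, xVar, aeval_X]; rfl

theorem toricMap_yVar (i : Fin n) : toricMap K G (yVar K i) =
    X (Sum.inl i) * X (Sum.inr (G.connectedComponentMk i)) := by
  rw [toricMap, yVar, aeval_X, X, X, monomial_mul, mul_one]; rfl

theorem toricMap_edgeBinom (i j : Fin n) : toricMap K G (edgeBinom K i j) =
    X (Sum.inl i) * X (Sum.inl j) * (X (Sum.inr (G.connectedComponentMk j)) -
      X (Sum.inr (G.connectedComponentMk i))) := by
  rw [edgeBinom, map_sub, map_mul, map_mul, toricMap_xVar, toricMap_xVar, toricMap_yVar,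
    toricMap_yVar]
  ring

theorem toricMap_eq_zero_of_mem {p : MvPolynomial (Vars n) K}
    (hp : p ∈ binomialEdgeIdeal K G) : toricMap K G p = 0 := by
  refine (binomialEdgeIdeal_le_iff (A := RingHom.ker (toricMap K G))).2 (fun i j hij => ?_) hp
  rw [RingHom.mem_ker, toricMap_edgeBinom,
    SimpleGraph.ConnectedComponent.sound hij.reachable, sub_self, mul_zero]

theorem regularMod_of_toricMap_ne_zero (hG : ∀ v, IsFree G v) {f : MvPolynomial (Vars n) K}
    (hf : toricMap K G f ≠ 0) : RegularMod (binomialEdgeIdeal K G) f := by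
  intro p hp
  have h := toricMap_eq_zero_of_mem hp
  rw [map_mul] at h
  exact mem_of_toricMap_eq_zero hG ((mul_eq_zero.1 h).resolve_left hf)

end Toric

/-! ### Nonzerodivisors modulo binomial edge ideals -/

/-- The elements that are shown to be nonzerodivisors modulo `J_G`. -/
def IsFreeElement (G : SimpleGraph (Fin n)) (f : MvPolynomial (Vars n) K) : Prop :=
  (∃ u, IsFree G u ∧ f = xVar K u) ∨
    ∃ v w, IsFree G v ∧ IsFree G w ∧ ¬ G.Reachable v w ∧ f = edgeBinom K v w

/-- Induction on the number of non-free vertices. For a non-free c, the element does not involve c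
and keeps its form in both graphs of the decomposition J_G = J_{G_c} ∩ ((x_c, y_c) + J_{G∖c}). If
all vertices are free, J_G is the kernel of a map to a domain that does not kill the element. -/
theorem IsFreeElement.regularMod {G : SimpleGraph (Fin n)} {f : MvPolynomial (Vars n) K}
    (hf : IsFreeElement G f) : RegularMod (binomialEdgeIdeal K G) f := by
  classical
  induction hN : (Finset.univ.filter fun v => ¬ IsFree G v).card using Nat.strong_induction_on
    generalizing G with
  | _ N ih =>
    by_cases hG : ∀ v, IsFree G v
    · apply regularMod_of_toricMap_ne_zero hG
      rcases hf with ⟨u, -, rfl⟩ | ⟨v, w, -, -, hvw, rfl⟩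
      · rw [toricMap_xVar]; exact X_ne_zero _
      · rw [toricMap_edgeBinom]
        refine mul_ne_zero (mul_ne_zero (X_ne_zero _) (X_ne_zero _)) ?_
        rw [sub_ne_zero]
        intro h
        have h1 := Sum.inr_injective (X_injective h)
        exact hvw (SimpleGraph.ConnectedComponent.exact h1.symm)
    · push Not at hG
      obtain ⟨c, hc⟩ := hG
      have hlt : ∀ H : SimpleGraph (Fin n), IsFree H c → (∀ u, IsFree G u → IsFree H u) →
          (Finset.univ.filter fun v => ¬ IsFree H v).card < N := by
        intro H hHc hH
        rw [← hN]
        refine Finset.card_lt_card ⟨fun v hv => ?_, fun h => ?_⟩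
        · simp only [Finset.mem_filter, Finset.mem_univ, true_and] at hv ⊢
          exact fun h => hv (hH v h)
        · have := h (show c ∈ _ by simpa using hc)
          simp [hHc] at this
      have hf1 : IsFreeElement (completeAt G c) f := by
        rcases hf with ⟨u, hu, rfl⟩ | ⟨v, w, hv, hw, hvw, rfl⟩
        · exact Or.inl ⟨u, hu.completeAt c, rfl⟩
        · exact Or.inr ⟨v, w, hv.completeAt c, hw.completeAt c,
            fun h => hvw (reachable_of_completeAt h), rfl⟩
      have hf2 : IsFreeElement (isolate G c) f := by
        rcases hf with ⟨u, hu, rfl⟩ | ⟨v, w, hv, hw, hvw, rfl⟩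
        · exact Or.inl ⟨u, hu.isolate c, rfl⟩
        · exact Or.inr ⟨v, w, hv.isolate c, hw.isolate c,
            fun h => hvw (h.mono (isolate_le G c)), rfl⟩
      have hkill : killVertex K c f = f := by
        rcases hf with ⟨u, hu, rfl⟩ | ⟨v, w, hv, hw, hvw, rfl⟩
        · rw [killVertex_xVar, if_neg]
          rintro rfl; exact hc hu
        · rw [killVertex_edgeBinom, if_neg]
          rintro (rfl | rfl)
          · exact hc hv
          · exact hc hw
      have h1 := ih _ (hlt _ (isFree_completeAt_self G c) fun u hu => hu.completeAt c) hf1 rfl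
      have h2 := ih _ (hlt _ (isFree_isolate_self G c) fun u hu => hu.isolate c) hf2 rfl
      intro p hp
      refine mem_of_completeAt_of_isolate (c := c)
        (h1 p (binomialEdgeIdeal_mono (le_completeAt G c) hp)) (h2 _ ?_)
      have := killVertex_mem_isolate (c := c) hp
      rwa [map_mul, hkill] at this

theorem regularMod_xVar {G : SimpleGraph (Fin n)} {u : Fin n} (hu : IsFree G u) :
    RegularMod (binomialEdgeIdeal K G) (xVar K u) :=
  IsFreeElement.regularMod (Or.inl ⟨u, hu, rfl⟩)

theorem regularMod_edgeBinom {G : SimpleGraph (Fin n)} {v w : Fin n} (hv : IsFree G v)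
    (hw : IsFree G w) (hvw : ¬ G.Reachable v w) :
    RegularMod (binomialEdgeIdeal K G) (edgeBinom K v w) :=
  IsFreeElement.regularMod (Or.inr ⟨v, w, hv, hw, hvw, rfl⟩)

end EdgeIdeals

/-! ### Regularity under adjoining edges and cliques -/

section GraphRegularity

variable {K : Type*} [Field K] {n : ℕ}

theorem binomialEdgeIdeal_sup (G H : SimpleGraph (Fin n)) :
    binomialEdgeIdeal K (G ⊔ H) = binomialEdgeIdeal K G ⊔ binomialEdgeIdeal K H := by
  apply le_antisymm
  · rw [binomialEdgeIdeal_le_iff]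
    rintro i j (h | h)
    · exact Ideal.mem_sup_left (edgeBinom_mem h)
    · exact Ideal.mem_sup_right (edgeBinom_mem h)
  · exact sup_le (binomialEdgeIdeal_mono le_sup_left) (binomialEdgeIdeal_mono le_sup_right)

theorem binomialEdgeIdeal_edge {v w : Fin n} (h : v ≠ w) :
    binomialEdgeIdeal K (SimpleGraph.edge v w) = Ideal.span {edgeBinom K v w} := by
  apply le_antisymm
  · rw [binomialEdgeIdeal_le_iff]
    intro i j hij
    rw [SimpleGraph.edge_adj] at hij
    rcases hij with ⟨⟨rfl, rfl⟩ | ⟨rfl, rfl⟩, -⟩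
    · exact Ideal.mem_span_singleton_self _
    · have := neg_mem (Ideal.mem_span_singleton_self (edgeBinom K j i))
      rwa [← edgeBinom_comm] at this
  · rw [Ideal.span_singleton_le_iff_mem]
    exact edgeBinom_mem (by rw [SimpleGraph.edge_adj]; exact ⟨Or.inl ⟨rfl, rfl⟩, h⟩)

theorem binomialEdgeIdeal_sup_edge (G : SimpleGraph (Fin n)) {v w : Fin n} (h : v ≠ w) :
    binomialEdgeIdeal K (G ⊔ SimpleGraph.edge v w) =
      binomialEdgeIdeal K G ⊔ Ideal.span {edgeBinom K v w} := by
  rw [binomialEdgeIdeal_sup, binomialEdgeIdeal_edge h]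

theorem binomialEdgeIdeal_bot : binomialEdgeIdeal K (⊥ : SimpleGraph (Fin n)) = ⊥ :=
  le_bot_iff.1 (binomialEdgeIdeal_le_iff.2 fun _ _ h => h.elim)

/-! ### Colon ideals -/

/-- J_G : f_vw = J_{G'} as soon as f_vw multiplies J_{G'} into J_G and is regular modulo J_{G'}. The
same data show in `edgeBinom_mul_mem_of_pow` that the colon by powers of f_vw stabilizes at once. -/
theorem mem_iff_edgeBinom_mul_mem {G G' : SimpleGraph (Fin n)} {v w : Fin n} (hle : G ≤ G')
    (hv : IsFree G' v) (hw : IsFree G' w) (hvw : ¬ G'.Reachable v w)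
    (hmul : ∀ p ∈ binomialEdgeIdeal K G', edgeBinom K v w * p ∈ binomialEdgeIdeal K G)
    (p : MvPolynomial (Vars n) K) :
    p ∈ binomialEdgeIdeal K G' ↔ edgeBinom K v w * p ∈ binomialEdgeIdeal K G :=
  ⟨hmul p, fun h => regularMod_edgeBinom hv hw hvw p (binomialEdgeIdeal_mono hle h)⟩

theorem edgeBinom_mul_mem_of_pow {G G' : SimpleGraph (Fin n)} {v w : Fin n} (hle : G ≤ G')
    (hv : IsFree G' v) (hw : IsFree G' w) (hvw : ¬ G'.Reachable v w)
    (hmul : ∀ p ∈ binomialEdgeIdeal K G', edgeBinom K v w * p ∈ binomialEdgeIdeal K G)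
    (m : ℕ) (p : MvPolynomial (Vars n) K)
    (h : edgeBinom K v w ^ (m + 1) * p ∈ binomialEdgeIdeal K G) :
    edgeBinom K v w * p ∈ binomialEdgeIdeal K G := by
  refine hmul p ?_
  have h1 := binomialEdgeIdeal_mono hle h
  clear h
  induction m with
  | zero => exact regularMod_edgeBinom hv hw hvw p (by simpa using h1)
  | succ m ih =>
    refine ih (regularMod_edgeBinom hv hw hvw _ ?_)
    rwa [← mul_assoc, ← pow_succ']

/-- If `w` is free in `G` and not connected to `v`, then `J_G : f_{vw} = J_{G_v}`. -/
theorem mem_completeAt_iff {G : SimpleGraph (Fin n)} {v w : Fin n} (hw : IsFree G w)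
    (hvw : ¬ G.Reachable v w) (p : MvPolynomial (Vars n) K) :
    p ∈ binomialEdgeIdeal K (completeAt G v) ↔ edgeBinom K v w * p ∈ binomialEdgeIdeal K G :=
  mem_iff_edgeBinom_mul_mem (le_completeAt G v) (isFree_completeAt_self G v) (hw.completeAt v)
    (fun h => hvw (reachable_of_completeAt h))
    (fun _ hp => edgeBinom_mul_mem_of_mem_completeAt w hp) p

/-- The regularity of `J_{G ∪ {vw}}` in terms of those of `J_G` and of `J_G : f_{vw}`. -/
theorem regLE_sup_edge {G : SimpleGraph (Fin n)} {v w : Fin n} (hw : IsFree G w)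
    (hvw : ¬ G.Reachable v w) {ρ q : ℕ} (h : RegLE (binomialEdgeIdeal K G) ρ)
    (hq : RegLE (binomialEdgeIdeal K (completeAt G v)) q) (hqρ : q + 1 ≤ ρ) :
    RegLE (binomialEdgeIdeal K (G ⊔ SimpleGraph.edge v w)) ρ := by
  have hne : v ≠ w := by rintro rfl; exact hvw .rfl
  rw [binomialEdgeIdeal_sup_edge G hne]
  exact RegLE.right (isHomog_binomialEdgeIdeal G) (isHomogeneous_edgeBinom v w)
    (mem_completeAt_iff hw hvw) hq (by omega) h

/-! ### Adjoining a complete graph -/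

/-- The complete graph on `C`. -/
def cliqueOn (C : Finset (Fin n)) : SimpleGraph (Fin n) where
  Adj a b := a ≠ b ∧ a ∈ C ∧ b ∈ C
  symm := ⟨fun _ _ h => ⟨h.1.symm, h.2.2, h.2.1⟩⟩
  loopless := ⟨fun _ h => h.1 rfl⟩

theorem supported_edgeBinom {c : Vars n} {i j : Fin n} (h1 : Sum.inlₗ i ≠ c)
    (h2 : Sum.inlₗ j ≠ c) (h3 : Sum.inrₗ i ≠ c) (h4 : Sum.inrₗ j ≠ c) :
    edgeBinom K i j ∈ supported K {c}ᶜ :=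
  sub_mem (mul_mem (X_mem_supported.2 h1) (X_mem_supported.2 h4))
    (mul_mem (X_mem_supported.2 h2) (X_mem_supported.2 h3))

theorem varFree_binomialEdgeIdeal {G : SimpleGraph (Fin n)} {c : Fin n} (hc : ∀ a, ¬ G.Adj c a) :
    VarFree (Sum.inlₗ c) (binomialEdgeIdeal K G) ∧ VarFree (Sum.inrₗ c) (binomialEdgeIdeal K G) := by
  refine ⟨⟨_, ?_, rfl⟩, ⟨_, ?_, rfl⟩⟩
  all_goals
    rintro _ ⟨i, j, -, hij, rfl⟩
    have hi : i ≠ c := by rintro rfl; exact hc j hij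
    have hj : j ≠ c := by rintro rfl; exact hc i hij.symm
  · exact supported_edgeBinom (fun h => hi (inl_inj.1 h)) (fun h => hj (inl_inj.1 h))
      (inl_ne_inr _ _).symm (inl_ne_inr _ _).symm
  · exact supported_edgeBinom (inl_ne_inr _ _) (inl_ne_inr _ _)
      (fun h => hi (inr_inj.1 h)) (fun h => hj (inr_inj.1 h))

theorem edgeBinom_mem_of_xVar {A : Ideal (MvPolynomial (Vars n) K)} {i j : Fin n}
    (hi : xVar K i ∈ A) (hj : xVar K j ∈ A) : edgeBinom K i j ∈ A :=
  sub_mem (Ideal.mul_mem_right _ _ hi) (Ideal.mul_mem_right _ _ hj)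

theorem regLE_sup_xVars {H : SimpleGraph (Fin n)} {ρ : ℕ} (h : RegLE (binomialEdgeIdeal K H) ρ)
    (C : Finset (Fin n)) (hC : ∀ c ∈ C, ∀ a, ¬ H.Adj c a) :
    RegLE (binomialEdgeIdeal K H ⊔ varIdeal K (C.image Sum.inlₗ)) ρ := by
  induction C using Finset.induction_on with
  | empty => rwa [Finset.image_empty, varIdeal_empty, sup_bot_eq]
  | insert u C hu ih =>
    rw [Finset.image_insert, varIdeal_insert, ← sup_assoc]
    have huC : Sum.inlₗ u ∉ C.image (Sum.inlₗ : Fin n → Vars n) := by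
      simpa [inl_inj] using hu
    exact RegLE.add_regular ((isHomog_binomialEdgeIdeal H).sup (isHomog_varIdeal _))
      (isHomogeneous_X K _)
      ((varFree_binomialEdgeIdeal (hC u (Finset.mem_insert_self u C))).1.sup
        (varFree_varIdeal huC)).regularMod
      (ih fun c hc => hC c (Finset.mem_insert_of_mem hc)) le_rfl le_rfl

/-- Adding a disjoint complete graph increases the regularity by at most one. -/
theorem regLE_sup_cliqueOn {H : SimpleGraph (Fin n)} {ρ : ℕ}
    (h : RegLE (binomialEdgeIdeal K H) ρ) (C : Finset (Fin n))
    (hC : ∀ c ∈ C, ∀ a, ¬ H.Adj c a) :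
    RegLE (binomialEdgeIdeal K (H ⊔ cliqueOn C)) (ρ + 1) := by
  induction C using Finset.induction_on with
  | empty =>
    have : H ⊔ cliqueOn ∅ = H := by
      ext a b; simp [cliqueOn]
    rw [this]
    exact h.mono (Nat.le_succ ρ)
  | insert u C hu ih =>
    have ih := ih fun c hc => hC c (Finset.mem_insert_of_mem hc)
    have hHu := hC u (Finset.mem_insert_self u C)
    set X := H ⊔ cliqueOn (insert u C) with hX
    have hfree : IsFree X u := by
      have key : ∀ a, X.Adj u a → a ∈ C := by
        rintro a (ha | ⟨hne, -, ha⟩)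
        · exact absurd ha (hHu a)
        · exact Finset.mem_of_mem_insert_of_ne ha (Ne.symm hne)
      exact fun a b ha hb hab => Or.inr ⟨hab, Finset.mem_insert_of_mem (key a ha),
        Finset.mem_insert_of_mem (key b hb)⟩
    have hXhom := isHomog_binomialEdgeIdeal (K := K) X
    have hxhom : (xVar K u).IsHomogeneous 1 := isHomogeneous_X K _
    have hyhom : (yVar K u).IsHomogeneous 1 := isHomogeneous_X K _
    -- First cut by x_u, which is regular because u is free; then split along y_u, whose colon ideal
    -- modulo x_u is Q.
    refine RegLE.of_regular (d := 0) hXhom hxhom (regularMod_xVar hfree) ?_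
    set A₁ := binomialEdgeIdeal K X ⊔ Ideal.span {xVar K u} with hA₁
    have hA₁hom : IsHomog A₁ := hXhom.sup (isHomog_span_singleton hxhom)
    set Q := binomialEdgeIdeal K H ⊔ varIdeal K ((insert u C).image Sum.inlₗ) with hQ
    have hxQ : ∀ c ∈ insert u C, xVar K c ∈ Q := fun c hc =>
      Ideal.mem_sup_right (Ideal.subset_span ⟨_, by simpa [inl_inj] using hc, rfl⟩)
    have hA₁Q : A₁ ≤ Q := by
      refine sup_le (binomialEdgeIdeal_le_iff.2 ?_)
        ((Ideal.span_singleton_le_iff_mem _).2 (hxQ u (Finset.mem_insert_self u C)))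
      rintro i j (hij | ⟨-, hi, hj⟩)
      · exact Ideal.mem_sup_left (edgeBinom_mem hij)
      · exact edgeBinom_mem_of_xVar (hxQ i hi) (hxQ j hj)
    have hyQ : RegularMod Q (yVar K u) := by
      refine ((varFree_binomialEdgeIdeal hHu).2.sup (varFree_varIdeal ?_)).regularMod
      simp only [Finset.mem_image, not_exists, not_and]
      exact fun c _ h => inl_ne_inr c u h
    have hxu : xVar K u ∈ A₁ := Ideal.mem_sup_right (Ideal.mem_span_singleton_self _)
    have hcolon : ∀ p, p ∈ Q ↔ yVar K u * p ∈ A₁ := by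
      refine fun p => ⟨?_, fun hp => hyQ p (hA₁Q hp)⟩
      refine fun hp => le_comap_mulLeft_iff.1 (sup_le ?_ (Ideal.span_le.2 ?_)) p hp
      · exact fun q hq => Ideal.mul_mem_left _ _
          (Ideal.mem_sup_left (binomialEdgeIdeal_mono le_sup_left hq))
      · rintro _ ⟨_, hcv, rfl⟩
        obtain ⟨c, hc, rfl⟩ := Finset.mem_image.1 hcv
        change yVar K u * xVar K c ∈ A₁
        by_cases hcu : c = u
        · subst hcu; exact Ideal.mul_mem_left _ _ hxu
        -- Once x_u is zero, the binomial of the edge uc becomes a monomial in y_u x_c, up to sign.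
        · have h1 : edgeBinom K u c ∈ A₁ := Ideal.mem_sup_left
            (edgeBinom_mem (Or.inr ⟨Ne.symm hcu, Finset.mem_insert_self u C, hc⟩))
          have h2 : yVar K u * xVar K c = yVar K c * xVar K u - edgeBinom K u c := by
            unfold edgeBinom; ring
          rw [h2]
          exact sub_mem (Ideal.mul_mem_left _ _ hxu) h1
    refine RegLE.middle hA₁hom hyhom hcolon (regLE_sup_xVars h _ hC) le_rfl ?_
    have hYu : ∀ a, ¬ (H ⊔ cliqueOn C).Adj u a := by
      rintro a (ha | ⟨-, ha, -⟩)
      · exact hHu a ha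
      · exact hu ha
    -- With both variables at u zero, the clique loses the vertex u, which is the induction
    -- hypothesis.
    have hA₂ : A₁ ⊔ Ideal.span {yVar K u} =
        binomialEdgeIdeal K (H ⊔ cliqueOn C) ⊔ Ideal.span {xVar K u} ⊔ Ideal.span {yVar K u} := by
      apply le_antisymm
      · refine sup_le (sup_le (binomialEdgeIdeal_le_iff.2 ?_) ?_) le_sup_right
        · have hx : xVar K u ∈ binomialEdgeIdeal K (H ⊔ cliqueOn C) ⊔
              Ideal.span {xVar K u} ⊔ Ideal.span {yVar K u} :=
            Ideal.mem_sup_left (Ideal.mem_sup_right (Ideal.mem_span_singleton_self _))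
          have hy : yVar K u ∈ binomialEdgeIdeal K (H ⊔ cliqueOn C) ⊔
              Ideal.span {xVar K u} ⊔ Ideal.span {yVar K u} :=
            Ideal.mem_sup_right (Ideal.mem_span_singleton_self _)
          rintro i j hij
          by_cases hiu : i = u
          · subst hiu
            exact sub_mem (Ideal.mul_mem_right _ _ hx) (Ideal.mul_mem_left _ _ hy)
          · by_cases hju : j = u
            · subst hju
              exact sub_mem (Ideal.mul_mem_left _ _ hy) (Ideal.mul_mem_right _ _ hx)
            · refine Ideal.mem_sup_left (Ideal.mem_sup_left (edgeBinom_mem ?_))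
              rcases hij with hij | ⟨hne, hi, hj⟩
              · exact Or.inl hij
              · exact Or.inr ⟨hne, Finset.mem_of_mem_insert_of_ne hi hiu,
                  Finset.mem_of_mem_insert_of_ne hj hju⟩
        · exact le_sup_of_le_left le_sup_right
      · refine sup_le_sup_right (sup_le_sup_right (binomialEdgeIdeal_mono
          (sup_le_sup_left ?_ H)) _) _
        exact fun a b hab => ⟨hab.1, Finset.mem_insert_of_mem hab.2.1,
          Finset.mem_insert_of_mem hab.2.2⟩
    rw [hA₂]
    obtain ⟨hfx, hfy⟩ := varFree_binomialEdgeIdeal (K := K) hYu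
    have hYhom := isHomog_binomialEdgeIdeal (K := K) (H ⊔ cliqueOn C)
    exact RegLE.add_regular (hYhom.sup (isHomog_span_singleton hxhom)) hyhom
      (hfy.sup (varFree_span_X (inl_ne_inr u u))).regularMod
      (RegLE.add_regular hYhom hxhom hfx.regularMod ih le_rfl le_rfl) le_rfl le_rfl

/-! ### Adjoining the edges of a forest -/

open Classical in
/-- Induction over the edges of `X` outside `H`, where every step adjoins a nonzerodivisor. -/
theorem edge_induction {G H X : SimpleGraph (Fin n)} (hG : G.IsAcyclic) (hHX : H ≤ X)
    (hXG : X ≤ H ⊔ G) (hreach : ∀ c d, H.Adj c d → (G ⊓ H).Reachable c d)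
    (hdeg : ∀ a b c d, X.Adj a b → ¬ H.Adj a b → X.Adj a c → X.Adj a d → c ≠ b → d ≠ b →
      c ≠ d → H.Adj c d)
    {P : Ideal (MvPolynomial (Vars n) K) → ℕ → Prop} {ρ : ℕ}
    (h0 : P (binomialEdgeIdeal K H) ρ)
    (step : ∀ A f k, IsHomog A → f.IsHomogeneous 2 → RegularMod A f → P A k →
      P (A ⊔ Ideal.span {f}) (k + 1)) :
    P (binomialEdgeIdeal K X) (ρ + (X.edgeFinset \ H.edgeFinset).card) := by
  have key : ∀ E : Finset (Sym2 (Fin n)), E ⊆ X.edgeFinset \ H.edgeFinset →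
      P (binomialEdgeIdeal K (H ⊔ SimpleGraph.fromEdgeSet (E : Set (Sym2 (Fin n)))))
        (ρ + E.card) := by
    intro E
    induction E using Finset.induction_on with
    | empty => intro _; simpa using h0
    | insert e E he ih =>
      intro hE
      have ih := ih fun x hx => hE (Finset.mem_insert_of_mem hx)
      have heD := hE (Finset.mem_insert_self e E)
      induction e using Sym2.ind with
      | _ a b =>
      simp only [Finset.mem_sdiff, SimpleGraph.mem_edgeFinset, SimpleGraph.mem_edgeSet] at heD
      obtain ⟨habX, habH⟩ := heD
      set Y := H ⊔ SimpleGraph.fromEdgeSet (E : Set (Sym2 (Fin n))) with hY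
      have hEX : ∀ c d, s(c, d) ∈ E → X.Adj c d ∧ ¬ H.Adj c d := by
        intro c d hcd
        have := hE (Finset.mem_insert_of_mem hcd)
        simpa using this
      have hYX : Y ≤ X := by
        refine sup_le hHX fun c d hcd => ?_
        rw [SimpleGraph.fromEdgeSet_adj] at hcd
        exact (hEX c d hcd.1).1
      have hnotY : ¬ Y.Adj a b := by
        rintro (h | h)
        · exact habH h
        · rw [SimpleGraph.fromEdgeSet_adj] at h; exact he h.1
      -- Before ab is adjoined, the remaining neighbours of a are pairwise adjacent in H, hence in
      -- Y.
      have hfa : IsFree Y a := fun c d hc hd hcd => Or.inl <|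
        hdeg a b c d habX habH (hYX hc) (hYX hd) (by rintro rfl; exact hnotY hc)
          (by rintro rfl; exact hnotY hd) hcd
      have hfb : IsFree Y b := fun c d hc hd hcd => Or.inl <|
        hdeg b a c d habX.symm (fun h => habH h.symm) (hYX hc) (hYX hd)
          (by rintro rfl; exact hnotY hc.symm) (by rintro rfl; exact hnotY hd.symm) hcd
      have habG : G.Adj a b := (hXG habX).resolve_left habH
      have hnr : ¬ Y.Reachable a b := by
        intro hr
        have hbr := SimpleGraph.isAcyclic_iff_forall_adj_isBridge.1 hG habG
        rw [SimpleGraph.isBridge_iff] at hbr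
        -- A path from a to b in Y becomes a path of the forest avoiding ab: each edge of H is
        -- replaced by a path of G inside H, and ab is not in H. This contradicts that ab is a
        -- bridge.
        refine hbr (reachable_of_forall_adj ?_ hr)
        rintro c d (hcd | hcd)
        · refine (hreach c d hcd).mono fun x y hxy => ?_
          rw [SimpleGraph.deleteEdges_adj]
          refine ⟨hxy.1, fun h => habH ?_⟩
          have h1 : s(x, y) ∈ H.edgeSet := hxy.2
          rw [Set.mem_singleton_iff.1 h] at h1
          exact h1
        · rw [SimpleGraph.fromEdgeSet_adj] at hcd
          obtain ⟨h1, h2⟩ := hEX c d hcd.1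
          refine SimpleGraph.Adj.reachable ?_
          rw [SimpleGraph.deleteEdges_adj]
          refine ⟨(hXG h1).resolve_left h2, fun h => he ?_⟩
          rw [← Set.mem_singleton_iff.1 h]
          exact hcd.1
      have hins : H ⊔ SimpleGraph.fromEdgeSet ((insert s(a, b) E : Finset _) : Set _) =
          Y ⊔ SimpleGraph.edge a b := by
        rw [Finset.coe_insert, Set.insert_eq, Set.union_comm, SimpleGraph.fromEdgeSet_union,
          hY, sup_assoc]
        rfl
      rw [hins, binomialEdgeIdeal_sup_edge Y habX.ne, Finset.card_insert_of_notMem he, ← add_assoc]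
      exact step _ _ _ (isHomog_binomialEdgeIdeal Y) (isHomogeneous_edgeBinom a b)
        (regularMod_edgeBinom hfa hfb hnr) ih
  have hX : H ⊔ SimpleGraph.fromEdgeSet ((X.edgeFinset \ H.edgeFinset : Finset _) : Set _) = X := by
    ext a b
    simp only [SimpleGraph.sup_adj, SimpleGraph.fromEdgeSet_adj, Finset.coe_sdiff,
      SimpleGraph.coe_edgeFinset, Set.mem_sdiff, SimpleGraph.mem_edgeSet]
    constructor
    · rintro (h | h)
      · exact hHX h
      · exact h.1.1
    · intro h
      by_cases h' : H.Adj a b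
      · exact Or.inl h'
      · exact Or.inr ⟨⟨h, h'⟩, h.ne⟩
  have := key _ (Finset.Subset.refl _)
  rwa [hX] at this

open Classical in
theorem regLE_of_edges {G H X : SimpleGraph (Fin n)} (hG : G.IsAcyclic) (hHX : H ≤ X)
    (hXG : X ≤ H ⊔ G) (hreach : ∀ c d, H.Adj c d → (G ⊓ H).Reachable c d)
    (hdeg : ∀ a b c d, X.Adj a b → ¬ H.Adj a b → X.Adj a c → X.Adj a d → c ≠ b → d ≠ b →
      c ≠ d → H.Adj c d)
    {ρ : ℕ} (h0 : RegLE (binomialEdgeIdeal K H) ρ) :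
    RegLE (binomialEdgeIdeal K X) (ρ + (X.edgeFinset \ H.edgeFinset).card) :=
  edge_induction (P := fun A k => RegLE A k) hG hHX hXG hreach hdeg h0
    fun _ _ _ hA hf hreg h => h.add_regular hA hf hreg (Nat.le_succ _) le_rfl

open Classical in
/-- The binomial edge ideal of a disjoint union of paths is a complete intersection. -/
theorem quadricCI_of_linearForest {X : SimpleGraph (Fin n)} (hX : X.IsAcyclic)
    (hdeg : ∀ a b c d, X.Adj a b → X.Adj a c → X.Adj a d → c ≠ b → d ≠ b → c = d) :
    QuadricCI (binomialEdgeIdeal K X) X.edgeFinset.card := by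
  have := edge_induction (K := K) (P := QuadricCI) (H := ⊥) (ρ := 0) hX bot_le le_sup_right
    (fun _ _ h => h.elim)
    (fun a b c d hab _ hac had hcb hdb hcd => absurd (hdeg a b c d hab hac had hcb hdb) hcd)
    (by rw [binomialEdgeIdeal_bot]; exact QuadricCI.bot)
    (fun _ _ _ _ hf hreg h => h.add hf hreg)
  convert this using 1
  rw [zero_add]
  congr 1
  ext e
  simp

theorem regLE_bot : RegLE (binomialEdgeIdeal K (⊥ : SimpleGraph (Fin n))) 0 := by
  rw [binomialEdgeIdeal_bot]; exact QuadricCI.bot.regLE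

end GraphRegularity

/-! ### Restriction to induced subgraphs -/

section InducedSubgraph

variable {K : Type*} [Field K] {n : ℕ}

theorem sup_pow_le {R : Type*} [CommRing R] (A B : Ideal R) (s : ℕ) : (A ⊔ B) ^ s ≤ A ^ s ⊔ B := by
  induction s with
  | zero => simp
  | succ s ih =>
    rw [pow_succ, pow_succ]
    calc (A ⊔ B) ^ s * (A ⊔ B) ≤ (A ^ s ⊔ B) * (A ⊔ B) := Ideal.mul_mono ih le_rfl
      _ ≤ A ^ s * A ⊔ B := by
        rw [Ideal.sup_mul, Ideal.mul_sup]
        exact sup_le (sup_le le_sup_left (le_sup_of_le_right Ideal.mul_le_right))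
          (le_sup_of_le_right Ideal.mul_le_left)

theorem binomialEdgeIdeal_le_isolate_sup (G : SimpleGraph (Fin n)) (t : Fin n) :
    binomialEdgeIdeal K G ≤
      binomialEdgeIdeal K (isolate G t) ⊔ (Ideal.span {xVar K t} ⊔ Ideal.span {yVar K t}) := by
  rw [binomialEdgeIdeal_le_iff]
  intro i j hij
  have hx : xVar K t ∈ Ideal.span {xVar K t} ⊔ Ideal.span {yVar K t} :=
    Ideal.mem_sup_left (Ideal.mem_span_singleton_self _)
  have hy : yVar K t ∈ Ideal.span {xVar K t} ⊔ Ideal.span {yVar K t} :=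
    Ideal.mem_sup_right (Ideal.mem_span_singleton_self _)
  by_cases hi : i = t
  · subst hi
    exact Ideal.mem_sup_right (sub_mem (Ideal.mul_mem_right _ _ hx) (Ideal.mul_mem_left _ _ hy))
  · by_cases hj : j = t
    · subst hj
      exact Ideal.mem_sup_right (sub_mem (Ideal.mul_mem_left _ _ hy) (Ideal.mul_mem_right _ _ hx))
    · exact Ideal.mem_sup_left (edgeBinom_mem ⟨hij, hi, hj⟩)

/-- Nonvanishing of `Tor` passes from an induced subgraph to the graph. -/
theorem not_torVanishes_of_isolate {G : SimpleGraph (Fin n)} {t : Fin n} {s i j : ℕ}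
    (h : ¬ TorVanishes (binomialEdgeIdeal K (isolate G t) ^ s) i j) :
    ¬ TorVanishes (binomialEdgeIdeal K G ^ s) i j := by
  refine fun hG => h fun z hz hdz => ?_
  set A := binomialEdgeIdeal K (isolate G t) ^ s
  have hle : A ≤ binomialEdgeIdeal K G ^ s :=
    Ideal.pow_right_mono (binomialEdgeIdeal_mono (isolate_le G t)) s
  have hle' : binomialEdgeIdeal K G ^ s ≤ A ⊔ Ideal.span {xVar K t} ⊔ Ideal.span {yVar K t} := by
    rw [sup_assoc]
    exact (Ideal.pow_right_mono (binomialEdgeIdeal_le_isolate_sup G t) s).trans (sup_pow_le _ _ s)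
  have hiso : ∀ a, ¬ (isolate G t).Adj t a := fun a ha => ha.2.1 rfl
  obtain ⟨hfx, hfy⟩ := varFree_binomialEdgeIdeal (K := K) hiso
  have hA : IsHomog A := isHomog_pow (isHomog_binomialEdgeIdeal _) s
  have hx : (xVar K t).IsHomogeneous (0 + 1) := isHomogeneous_X K _
  have hy : (yVar K t).IsHomogeneous (0 + 1) := isHomogeneous_X K _
  -- Tor(S/A) injects into Tor(S/(A + (x_t, y_t))), since A does not involve these variables, and
  -- this map factors through Tor(S/J_G^s).
  refine boundaryMod_of_regular hA hx (hfx.pow s).regularMod hz hdz ?_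
  refine boundaryMod_of_regular (hA.sup (isHomog_span_singleton hx)) hy
    ((hfy.pow s).sup (varFree_span_X (inl_ne_inr t t))).regularMod hz
    (fun B => Ideal.mem_sup_left (hdz B)) ?_
  exact (hG z hz fun B => hle (hdz B)).mono hle'

end InducedSubgraph

/-! ### Minimal number of generators and height -/

section Generators

variable {K : Type*} [Field K] {n : ℕ}

variable (K) in
/-- The generator of the binomial edge ideal attached to an unordered pair. -/
def edgeGen (e : Sym2 (Fin n)) : MvPolynomial (Vars n) K := edgeBinom K e.inf e.sup

theorem edgeGen_of_lt {i j : Fin n} (h : i < j) : edgeGen K s(i, j) = edgeBinom K i j := by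
  rw [edgeGen, Sym2.inf_mk, Sym2.sup_mk, inf_eq_left.2 h.le, sup_eq_right.2 h.le]

open Classical in
theorem binomialEdgeIdeal_eq_span_image (G : SimpleGraph (Fin n)) :
    binomialEdgeIdeal K G = Ideal.span ((G.edgeFinset.image (edgeGen K) : Finset _) : Set _) := by
  apply le_antisymm
  · refine Ideal.span_le.2 ?_
    rintro _ ⟨i, j, hlt, hij, rfl⟩
    refine Ideal.subset_span (Finset.mem_coe.2 (Finset.mem_image.2 ⟨s(i, j), by simpa, ?_⟩))
    exact edgeGen_of_lt hlt
  · refine Ideal.span_le.2 ?_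
    intro f hf
    obtain ⟨e, he, rfl⟩ := Finset.mem_image.1 (Finset.mem_coe.1 hf)
    induction e using Sym2.ind with
    | _ i j =>
    have hij : G.Adj i j := by simpa using he
    rcases lt_or_gt_of_ne hij.ne with h | h
    · rw [edgeGen_of_lt h]; exact edgeBinom_mem hij
    · rw [Sym2.eq_swap, edgeGen_of_lt h]; exact edgeBinom_mem hij.symm

theorem xVar_mul_yVar (i j : Fin n) : xVar K i * yVar K j =
    monomial (Finsupp.single (Sum.inlₗ i : Vars n) 1 + Finsupp.single (Sum.inrₗ j) 1) 1 := by
  rw [xVar, yVar, X, X, monomial_mul, mul_one]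

theorem single_inl_add_single_inr_inj {i j a b : Fin n} :
    (Finsupp.single (Sum.inlₗ a : Vars n) 1 + Finsupp.single (Sum.inrₗ b) 1 : Vars n →₀ ℕ) =
      Finsupp.single (Sum.inlₗ i) 1 + Finsupp.single (Sum.inrₗ j) 1 ↔ a = i ∧ b = j := by
  classical
  constructor
  · intro h
    have h1 := DFunLike.congr_fun h (Sum.inlₗ i)
    have h2 := DFunLike.congr_fun h (Sum.inrₗ j)
    simp only [Finsupp.add_apply, Finsupp.single_apply, inl_inj, inr_inj, inl_ne_inr,
      (inl_ne_inr _ _).symm, if_false, if_true, add_zero, zero_add] at h1 h2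
    constructor
    · by_contra hne; simp [hne] at h1
    · by_contra hne; simp [hne] at h2
  · rintro ⟨rfl, rfl⟩; rfl

open Classical in
-- The monomial x_i y_j with i < j occurs only in the generator of the edge ij; the second monomial
-- of every generator has its indices in the opposite order.
theorem linearIndependent_edgeGen (G : SimpleGraph (Fin n)) :
    LinearIndependent K fun e : G.edgeFinset => edgeGen K (e : Sym2 (Fin n)) := by
  rw [Fintype.linearIndependent_iff]
  intro c hc e
  obtain ⟨e, he⟩ := e
  have hlt : ∀ e : G.edgeFinset, (e : Sym2 (Fin n)).inf < (e : Sym2 (Fin n)).sup := by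
    rintro ⟨e, he⟩
    induction e using Sym2.ind with
    | _ i j =>
    have hij : G.Adj i j := by simpa using he
    simpa using hij.ne'
  have h := congrArg (coeff (Finsupp.single (Sum.inlₗ e.inf : Vars n) 1 +
    Finsupp.single (Sum.inrₗ e.sup) 1)) hc
  rw [coeff_sum, coeff_zero, Finset.sum_eq_single ⟨e, he⟩] at h
  · have h1 := hlt ⟨e, he⟩
    simp only at h1
    rw [coeff_smul, edgeGen, edgeBinom, xVar_mul_yVar, xVar_mul_yVar, coeff_sub, coeff_monomial,
      coeff_monomial, if_pos rfl, if_neg, sub_zero, smul_eq_mul, mul_one] at h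
    · exact h
    · rw [single_inl_add_single_inr_inj]
      exact fun h2 => h1.ne h2.2
  · rintro ⟨e', he'⟩ - hne
    have h1 := hlt ⟨e, he⟩
    have h2 := hlt ⟨e', he'⟩
    simp only at h1 h2
    rw [coeff_smul, edgeGen, edgeBinom, xVar_mul_yVar, xVar_mul_yVar, coeff_sub, coeff_monomial,
      coeff_monomial, if_neg, if_neg, sub_zero, smul_zero]
    · rw [single_inl_add_single_inr_inj]
      rintro ⟨h3, h4⟩
      rw [h3, h4] at h2
      exact absurd h1 h2.asymm
    · rw [single_inl_add_single_inr_inj]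
      rintro h3
      exact hne (Subtype.ext (Sym2.inf_eq_inf_and_sup_eq_sup.1 h3))
  · intro h'; exact absurd (Finset.mem_univ _) h'

/-- J_G has nothing below degree 2, so only the constant term of a multiplier is seen in degree 2.
Thus the quadratic parts of any generating set span the quadrics of J_G over K. -/
theorem homogeneousComponent_two_mul {G : SimpleGraph (Fin n)} {x : MvPolynomial (Vars n) K}
    (hx : x ∈ binomialEdgeIdeal K G) (a : MvPolynomial (Vars n) K) :
    homogeneousComponent 2 (a * x) = constantCoeff a • homogeneousComponent 2 x := by
  unfold binomialEdgeIdeal at hx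
  induction hx using Submodule.span_induction generalizing a with
  | mem x hx =>
    obtain ⟨i, j, _, _, rfl⟩ := hx
    have h2 : (edgeBinom K i j).IsHomogeneous 2 := isHomogeneous_edgeBinom i j
    change homogeneousComponent 2 (a * edgeBinom K i j) =
      constantCoeff a • homogeneousComponent 2 (edgeBinom K i j)
    rw [mul_comm, homogeneousComponent_mul_of_isHomogeneous h2 (zero_add 2),
      homogeneousComponent_eq_self h2, homogeneousComponent_zero, mul_comm, smul_eq_C_mul]
    rfl
  | zero => simp
  | add x y _ _ hx hy => rw [mul_add, map_add, map_add, hx, hy, smul_add]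
  | smul b x _ ih => rw [smul_eq_mul, ← mul_assoc, ih, ih, map_mul, mul_smul]

open Classical in
/-- The generators attached to the edges form a minimal system of generators. -/
theorem card_edgeFinset_le_spanFinrank (G : SimpleGraph (Fin n)) :
    G.edgeFinset.card ≤ Submodule.spanFinrank (binomialEdgeIdeal K G) := by
  obtain ⟨s, hs, hspan⟩ := Submodule.FG.exists_span_finset_card_eq_spanFinrank
    (IsNoetherian.noetherian (binomialEdgeIdeal K G))
  have key : ∀ f ∈ binomialEdgeIdeal K G, homogeneousComponent 2 f ∈
      Submodule.span K ((s.image (homogeneousComponent 2) : Finset _) :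
        Set (MvPolynomial (Vars n) K)) := by
    intro f hf
    rw [← hspan] at hf
    obtain ⟨c, -, rfl⟩ := Submodule.mem_span_finset.1 hf
    rw [map_sum]
    refine Submodule.sum_mem _ fun g hg => ?_
    rw [smul_eq_mul, homogeneousComponent_two_mul (G := G)]
    · exact Submodule.smul_mem _ _ (Submodule.subset_span
        (Finset.mem_coe.2 (Finset.mem_image_of_mem _ hg)))
    · rw [← hspan]; exact Submodule.subset_span hg
  have hle : Submodule.span K (Set.range fun e : G.edgeFinset => edgeGen K (e : Sym2 (Fin n))) ≤
      Submodule.span K ((s.image (homogeneousComponent 2) : Finset _) :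
        Set (MvPolynomial (Vars n) K)) := by
    rw [Submodule.span_le]
    rintro _ ⟨⟨e, he⟩, rfl⟩
    have h2 : (edgeGen K e).IsHomogeneous 2 := isHomogeneous_edgeBinom _ _
    have := key (edgeGen K e) (by
      rw [binomialEdgeIdeal_eq_span_image]
      exact Ideal.subset_span (Finset.mem_coe.2 (Finset.mem_image_of_mem _ he)))
    rwa [homogeneousComponent_eq_self h2] at this
  have h1 := Submodule.finrank_mono hle
  rw [finrank_span_eq_card (linearIndependent_edgeGen G), Fintype.card_coe] at h1
  calc G.edgeFinset.card ≤ _ := h1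
    _ ≤ (s.image (homogeneousComponent 2)).card := finrank_span_finset_le_card _
    _ ≤ s.card := Finset.card_image_le
    _ = _ := hs

open Classical in
theorem spanFinrank_le_card_edgeFinset (G : SimpleGraph (Fin n)) :
    Submodule.spanFinrank (binomialEdgeIdeal K G) ≤ G.edgeFinset.card := by
  rw [binomialEdgeIdeal_eq_span_image]
  refine (Submodule.spanFinrank_span_le_ncard_of_finite (Finset.finite_toSet _)).trans ?_
  rw [Set.ncard_coe_finset]
  exact Finset.card_image_le

open Classical in
/-- Deleting the vertices of `T` bounds the height of `J_G`. -/
theorem height_binomialEdgeIdeal_le {G H : SimpleGraph (Fin n)} (T : Finset (Fin n))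
    (h : ∀ i j, G.Adj i j → H.Adj i j ∨ i ∈ T ∨ j ∈ T) :
    (binomialEdgeIdeal K G).height ≤ ((2 * T.card + H.edgeFinset.card : ℕ) : ℕ∞) := by
  set s : Finset (MvPolynomial (Vars n) K) :=
    T.image (xVar K) ∪ T.image (yVar K) ∪ H.edgeFinset.image (edgeGen K) with hs
  have hx : ∀ t ∈ T, xVar K t ∈ Ideal.span (s : Set (MvPolynomial (Vars n) K)) := fun t ht =>
    Ideal.subset_span (by
      rw [hs, Finset.mem_coe, Finset.mem_union, Finset.mem_union]
      exact Or.inl (Or.inl (Finset.mem_image_of_mem _ ht)))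
  have hy : ∀ t ∈ T, yVar K t ∈ Ideal.span (s : Set (MvPolynomial (Vars n) K)) := fun t ht =>
    Ideal.subset_span (by
      rw [hs, Finset.mem_coe, Finset.mem_union, Finset.mem_union]
      exact Or.inl (Or.inr (Finset.mem_image_of_mem _ ht)))
  have hle : binomialEdgeIdeal K G ≤ Ideal.span (s : Set (MvPolynomial (Vars n) K)) := by
    rw [binomialEdgeIdeal_le_iff]
    intro i j hij
    rcases h i j hij with hH | hi | hj
    · have h1 : binomialEdgeIdeal K H ≤ Ideal.span (s : Set (MvPolynomial (Vars n) K)) := by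
        rw [binomialEdgeIdeal_eq_span_image]
        exact Ideal.span_mono (Finset.coe_subset.2 Finset.subset_union_right)
      exact h1 (edgeBinom_mem hH)
    · exact sub_mem (Ideal.mul_mem_right _ _ (hx i hi)) (Ideal.mul_mem_left _ _ (hy i hi))
    · exact sub_mem (Ideal.mul_mem_left _ _ (hy j hj)) (Ideal.mul_mem_right _ _ (hx j hj))
  have hne : Ideal.span (s : Set (MvPolynomial (Vars n) K)) ≠ ⊤ := by
    have hker : Ideal.span (s : Set (MvPolynomial (Vars n) K)) ≤
        RingHom.ker (constantCoeff : MvPolynomial (Vars n) K →+* K) := by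
      rw [Ideal.span_le]
      intro f hf
      simp only [hs, Finset.coe_union, Finset.coe_image, Set.mem_union, Set.mem_image] at hf
      rw [SetLike.mem_coe, RingHom.mem_ker]
      rcases hf with (⟨t, -, rfl⟩ | ⟨t, -, rfl⟩) | ⟨e, -, rfl⟩
      · simp [xVar]
      · simp [yVar]
      · rw [edgeGen, edgeBinom, map_sub, map_mul, map_mul]
        simp [xVar, yVar]
    intro htop
    rw [htop, top_le_iff] at hker
    exact RingHom.ker_ne_top _ hker
  -- Krull's height theorem for the proper ideal generated by the variables at T and the binomials
  -- of H.
  refine (Ideal.height_mono hle).trans ((Ideal.height_le_spanFinrank _ hne).trans ?_)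
  rw [Nat.cast_le]
  refine (Submodule.spanFinrank_span_le_ncard_of_finite (Finset.finite_toSet s)).trans ?_
  rw [Set.ncard_coe_finset, hs]
  have h1 := Finset.card_union_le (T.image (xVar K) ∪ T.image (yVar K))
    (H.edgeFinset.image (edgeGen K))
  have h2 := Finset.card_union_le (T.image (xVar K)) (T.image (yVar K))
  have h3 : (T.image (xVar K)).card ≤ T.card := Finset.card_image_le
  have h4 : (T.image (yVar K)).card ≤ T.card := Finset.card_image_le
  have h5 : (H.edgeFinset.image (edgeGen K)).card ≤ H.edgeFinset.card := Finset.card_image_le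
  omega

end Generators

/-! ### Linear forests with neighbourhoods replaced by cliques -/

section Cluster

variable {K : Type*} [Field K] {n : ℕ}

/-- `a` has at most two neighbours. -/
def DegLETwo (G : SimpleGraph (Fin n)) (a : Fin n) : Prop :=
  ∀ b c d, G.Adj a b → G.Adj a c → G.Adj a d → c ≠ b → d ≠ b → c = d

/-- `a` has at least two neighbours. -/
def TwoLEDeg (G : SimpleGraph (Fin n)) (a : Fin n) : Prop :=
  ∃ b c, b ≠ c ∧ G.Adj a b ∧ G.Adj a c

open Classical in
/-- Replacing some connected parts of a linear forest by cliques: the regularity is at most that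
of the cliques plus the number of the remaining edges. -/
theorem regLE_sup_linearForest {F H : SimpleGraph (Fin n)} (hF : F.IsAcyclic)
    (hdeg : ∀ a, DegLETwo F a)
    (hH : ∀ a c d, H.Adj a c → H.Adj a d → c ≠ d → H.Adj c d)
    (hreach : ∀ c d, H.Adj c d → (F ⊓ H).Reachable c d) {h q : ℕ}
    (hreg : RegLE (binomialEdgeIdeal K H) h) (E : Finset (Sym2 (Fin n)))
    (hE : ∀ a b, s(a, b) ∈ E → F.Adj a b ∧ H.Adj a b)
    (hq : h + F.edgeFinset.card ≤ q + E.card) :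
    RegLE (binomialEdgeIdeal K (H ⊔ F)) q := by
  have hnbr : ∀ a d, H.Adj a d → ∃ x, F.Adj a x ∧ H.Adj a x := by
    intro a d had
    obtain ⟨p⟩ := hreach a d had
    cases p with
    | nil => exact absurd rfl had.ne
    | cons hadj _ => exact ⟨_, hadj⟩
  refine (regLE_of_edges (X := H ⊔ F) hF le_sup_left le_rfl hreach ?_ hreg).mono ?_
  · intro a b c d hab hnab hac had hcb hdb hcd
    have hab : F.Adj a b := hab.resolve_left hnab
    -- A vertex of a clique has a forest neighbour inside the clique, so two further forest edges
    -- outside H would give it three neighbours in F.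
    have aux : ∀ c d, F.Adj a c → ¬ H.Adj a c → H.Adj a d → c ≠ b → False := by
      intro c d hac hnac had hcb
      obtain ⟨x, hFx, hHx⟩ := hnbr a d had
      refine hnac ?_
      rw [hdeg a b c x hab hac hFx hcb (by rintro rfl; exact hnab hHx)]
      exact hHx
    by_cases hc : H.Adj a c
    · by_cases hd : H.Adj a d
      · exact hH a c d hc hd hcd
      · exact (aux d c (had.resolve_left hd) hd hc hdb).elim
    · by_cases hd : H.Adj a d
      · exact (aux c d (hac.resolve_left hc) hc hd hcb).elim
      · exact absurd (hdeg a b c d hab (hac.resolve_left hc) (had.resolve_left hd) hcb hdb) hcd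
  -- Only forest edges not absorbed by the cliques have to be adjoined, and those listed in E are
  -- absorbed.
  · have hsub : (H ⊔ F).edgeFinset \ H.edgeFinset ⊆ F.edgeFinset \ E := by
      intro e
      induction e using Sym2.ind with
      | _ a b =>
      simp only [Finset.mem_sdiff, SimpleGraph.mem_edgeFinset, SimpleGraph.mem_edgeSet,
        SimpleGraph.sup_adj]
      rintro ⟨h1, h2⟩
      exact ⟨h1.resolve_left h2, fun h3 => h2 (hE a b h3).2⟩
    have hEF : E ⊆ F.edgeFinset := by
      intro e
      induction e using Sym2.ind with
      | _ a b =>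
      intro he
      simpa using (hE a b he).1
    have h1 := Finset.card_le_card hsub
    have h2 := Finset.card_sdiff_add_card_eq_card hEF
    refine (Nat.add_le_add_left (le_trans (le_of_eq ?_) h1) h).trans (by omega)
    congr!

open Classical in
/-- The closed neighbourhood of `v`. -/
def closedNbhd (F : SimpleGraph (Fin n)) (v : Fin n) : Finset (Fin n) :=
  Finset.univ.filter fun a => a = v ∨ F.Adj v a

theorem mem_closedNbhd {F : SimpleGraph (Fin n)} {v a : Fin n} :
    a ∈ closedNbhd F v ↔ a = v ∨ F.Adj v a := by
  simp [closedNbhd]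

theorem completeAt_eq (F : SimpleGraph (Fin n)) (v : Fin n) :
    completeAt F v = cliqueOn (closedNbhd F v) ⊔ F := by
  ext a b
  simp only [completeAt, cliqueOn, SimpleGraph.sup_adj, mem_closedNbhd]
  constructor
  · rintro ⟨h, h1 | h1⟩
    · exact Or.inr h1
    · exact Or.inl ⟨h, h1⟩
  · rintro (⟨h, h1⟩ | h1)
    · exact ⟨h, Or.inr h1⟩
    · exact ⟨h1.ne, Or.inl h1⟩

theorem regLE_cliqueOn (C : Finset (Fin n)) : RegLE (binomialEdgeIdeal K (cliqueOn C)) 1 := by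
  have := regLE_sup_cliqueOn (regLE_bot (K := K) (n := n)) C (fun _ _ _ h => h)
  rwa [bot_sup_eq] at this

theorem cliqueOn_trans {C : Finset (Fin n)} (a c d : Fin n) (hc : (cliqueOn C).Adj a c)
    (hd : (cliqueOn C).Adj a d) (hcd : c ≠ d) : (cliqueOn C).Adj c d :=
  ⟨hcd, hc.2.2, hd.2.2⟩

theorem adj_cliqueOn_closedNbhd {F : SimpleGraph (Fin n)} {v a : Fin n} (h : F.Adj v a) :
    (cliqueOn (closedNbhd F v)).Adj v a :=
  ⟨h.ne, mem_closedNbhd.2 (Or.inl rfl), mem_closedNbhd.2 (Or.inr h)⟩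

theorem reachable_of_mem_closedNbhd {F H : SimpleGraph (Fin n)} {v a : Fin n}
    (hH : cliqueOn (closedNbhd F v) ≤ H) (ha : a ∈ closedNbhd F v) : (F ⊓ H).Reachable v a := by
  rcases mem_closedNbhd.1 ha with rfl | h
  · rfl
  · exact SimpleGraph.Adj.reachable ⟨h, hH (adj_cliqueOn_closedNbhd h)⟩

open Classical in
-- The clique costs 1 and absorbs two forest edges at v, a net saving of one.
theorem regLE_completeAt {F : SimpleGraph (Fin n)} (hF : F.IsAcyclic)
    (hdeg : ∀ a, DegLETwo F a) {v : Fin n} (hv : TwoLEDeg F v) {q : ℕ}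
    (hq : F.edgeFinset.card ≤ q + 1) :
    RegLE (binomialEdgeIdeal K (completeAt F v)) q := by
  obtain ⟨a, b, hab, ha, hb⟩ := hv
  rw [completeAt_eq]
  refine regLE_sup_linearForest hF hdeg cliqueOn_trans ?_ (regLE_cliqueOn _)
    {s(v, a), s(v, b)} ?_ ?_
  · intro c d hcd
    exact (reachable_of_mem_closedNbhd le_rfl hcd.2.1).symm.trans
      (reachable_of_mem_closedNbhd le_rfl hcd.2.2)
  · intro c d hcd
    simp only [Finset.mem_insert, Finset.mem_singleton, Sym2.eq_iff] at hcd
    rcases hcd with (⟨rfl, rfl⟩ | ⟨rfl, rfl⟩) | (⟨rfl, rfl⟩ | ⟨rfl, rfl⟩)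
    · exact ⟨ha, adj_cliqueOn_closedNbhd ha⟩
    · exact ⟨ha.symm, (adj_cliqueOn_closedNbhd ha).symm⟩
    · exact ⟨hb, adj_cliqueOn_closedNbhd hb⟩
    · exact ⟨hb.symm, (adj_cliqueOn_closedNbhd hb).symm⟩
  · rw [Finset.card_pair (by simp only [ne_eq, Sym2.eq_iff]; grind)]
    omega

theorem completeAt_completeAt_of_not_reachable {F : SimpleGraph (Fin n)} {u v : Fin n}
    (huv : ¬ F.Reachable v u) :
    completeAt (completeAt F v) u = completeAt F v ⊔ completeAt F u := by
  have key : ∀ a, (completeAt F v).Adj u a ↔ F.Adj u a := by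
    intro a
    refine ⟨?_, fun h => le_completeAt F v h⟩
    rintro ⟨-, h | ⟨rfl | h, -⟩⟩
    · exact h
    · exact absurd .rfl huv
    · exact absurd h.reachable huv
  ext a b
  simp only [SimpleGraph.sup_adj]
  constructor
  · rintro ⟨h, h1 | h1⟩
    · exact Or.inl h1
    · rw [key, key] at h1
      exact Or.inr ⟨h, Or.inr h1⟩
  · rintro (h | ⟨h, h1 | h1⟩)
    · exact le_completeAt _ _ h
    · exact le_completeAt _ _ (le_completeAt _ _ h1)
    · rw [← key, ← key] at h1
      exact ⟨h, Or.inr h1⟩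

open Classical in
-- Two disjoint cliques cost 2 and absorb four edges.
theorem regLE_completeAt_completeAt_of_not_reachable {F : SimpleGraph (Fin n)} (hF : F.IsAcyclic)
    (hdeg : ∀ a, DegLETwo F a) {u v : Fin n} (hu : TwoLEDeg F u) (hv : TwoLEDeg F v)
    (huv : ¬ F.Reachable v u) {q : ℕ} (hq : F.edgeFinset.card ≤ q + 2) :
    RegLE (binomialEdgeIdeal K (completeAt (completeAt F v) u)) q := by
  obtain ⟨a, b, hab, ha, hb⟩ := hu
  obtain ⟨c, d, hcd, hc, hd⟩ := hv
  rw [completeAt_completeAt_of_not_reachable huv, completeAt_eq, completeAt_eq,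
    sup_sup_sup_comm, sup_idem]
  have hdisj : ∀ x, x ∈ closedNbhd F v → x ∈ closedNbhd F u → False := by
    intro x hxv hxu
    have h1 := reachable_of_mem_closedNbhd le_rfl hxv
    have h2 := reachable_of_mem_closedNbhd le_rfl hxu
    exact huv ((h1.mono inf_le_left).trans (h2.mono inf_le_left).symm)
  refine regLE_sup_linearForest (h := 2) hF hdeg ?_ ?_
    (regLE_sup_cliqueOn (regLE_cliqueOn _) _ fun x hx y hxy => hdisj x hxy.2.1 hx)
    {s(u, a), s(u, b), s(v, c), s(v, d)} ?_ ?_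
  · rintro x y z (hy | hy) (hz | hz) hyz
    · exact Or.inl (cliqueOn_trans x y z hy hz hyz)
    · exact (hdisj x hy.2.1 hz.2.1).elim
    · exact (hdisj x hz.2.1 hy.2.1).elim
    · exact Or.inr (cliqueOn_trans x y z hy hz hyz)
  · rintro x y (h | h)
    · exact (reachable_of_mem_closedNbhd le_sup_left h.2.1).symm.trans
        (reachable_of_mem_closedNbhd le_sup_left h.2.2)
    · exact (reachable_of_mem_closedNbhd le_sup_right h.2.1).symm.trans
        (reachable_of_mem_closedNbhd le_sup_right h.2.2)
  · intro x y hxy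
    simp only [Finset.mem_insert, Finset.mem_singleton, Sym2.eq_iff] at hxy
    have := adj_cliqueOn_closedNbhd ha
    have := adj_cliqueOn_closedNbhd hb
    have := adj_cliqueOn_closedNbhd hc
    have := adj_cliqueOn_closedNbhd hd
    simp only [SimpleGraph.sup_adj]
    rcases hxy with (⟨rfl, rfl⟩ | ⟨rfl, rfl⟩) | (⟨rfl, rfl⟩ | ⟨rfl, rfl⟩) |
        (⟨rfl, rfl⟩ | ⟨rfl, rfl⟩) | (⟨rfl, rfl⟩ | ⟨rfl, rfl⟩) <;>
      simp_all [SimpleGraph.adj_comm]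
  · have huv' : u ≠ v := by rintro rfl; exact huv .rfl
    have hud : u ≠ d := by rintro rfl; exact huv hd.reachable
    have huc : u ≠ c := by rintro rfl; exact huv hc.reachable
    rw [Finset.card_insert_of_notMem, Finset.card_insert_of_notMem, Finset.card_pair]
    · omega
    all_goals
      simp only [ne_eq, Sym2.eq_iff, Finset.mem_insert, Finset.mem_singleton]
      grind

theorem completeAt_completeAt_of_adj {F : SimpleGraph (Fin n)} {u v : Fin n} (huv : F.Adj u v) :
    completeAt (completeAt F v) u = cliqueOn (closedNbhd F v ∪ closedNbhd F u) ⊔ F := by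
  have key : ∀ a, a ∈ closedNbhd F v ∪ closedNbhd F u ↔ a = u ∨ (completeAt F v).Adj u a := by
    intro a
    simp only [Finset.mem_union, mem_closedNbhd, completeAt]
    have := huv.symm
    grind
  ext a b
  simp only [SimpleGraph.sup_adj]
  constructor
  · rintro ⟨h, h1 | h1⟩
    · rcases h1 with ⟨-, h1 | h1⟩
      · exact Or.inr h1
      · exact Or.inl ⟨h, Finset.mem_union_left _ (mem_closedNbhd.2 h1.1),
          Finset.mem_union_left _ (mem_closedNbhd.2 h1.2)⟩
    · rw [← key, ← key] at h1
      exact Or.inl ⟨h, h1⟩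
  · rintro (⟨h, h1, h2⟩ | h)
    · rw [key] at h1 h2
      exact ⟨h, Or.inr ⟨h1, h2⟩⟩
    · exact le_completeAt _ _ (le_completeAt _ _ h)

open Classical in
-- Completing at v and then at u merges both neighbourhoods into one clique, which costs 1 and
-- absorbs the three edges of the path u' u v v'.
theorem regLE_completeAt_completeAt_of_adj {F : SimpleGraph (Fin n)} (hF : F.IsAcyclic)
    (hdeg : ∀ a, DegLETwo F a) {u v u' v' : Fin n} (huv : F.Adj u v) (hu : F.Adj u u')
    (hv : F.Adj v v') (hu' : u' ≠ v) (hv' : v' ≠ u) {q : ℕ} (hq : F.edgeFinset.card ≤ q + 2) :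
    RegLE (binomialEdgeIdeal K (completeAt (completeAt F v) u)) q := by
  rw [completeAt_completeAt_of_adj huv]
  set C := closedNbhd F v ∪ closedNbhd F u with hC
  have hle : ∀ {A}, A ⊆ C → cliqueOn A ≤ cliqueOn C :=
    fun hA _ _ h => ⟨h.1, hA h.2.1, hA h.2.2⟩
  have hvC : cliqueOn (closedNbhd F v) ≤ cliqueOn C := hle Finset.subset_union_left
  have huC : cliqueOn (closedNbhd F u) ≤ cliqueOn C := hle Finset.subset_union_right
  have hr : ∀ a ∈ C, (F ⊓ cliqueOn C).Reachable u a := by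
    intro a ha
    rcases Finset.mem_union.1 ha with ha | ha
    · exact (reachable_of_mem_closedNbhd huC (mem_closedNbhd.2 (Or.inr huv))).trans
        (reachable_of_mem_closedNbhd hvC ha)
    · exact reachable_of_mem_closedNbhd huC ha
  refine regLE_sup_linearForest hF hdeg cliqueOn_trans
    (fun c d hcd => (hr c hcd.2.1).symm.trans (hr d hcd.2.2)) (regLE_cliqueOn _)
    {s(u, v), s(u, u'), s(v, v')} ?_ ?_
  · intro x y hxy
    simp only [Finset.mem_insert, Finset.mem_singleton, Sym2.eq_iff] at hxy
    have := huC (adj_cliqueOn_closedNbhd huv)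
    have := huC (adj_cliqueOn_closedNbhd hu)
    have := hvC (adj_cliqueOn_closedNbhd hv)
    rcases hxy with (⟨rfl, rfl⟩ | ⟨rfl, rfl⟩) | (⟨rfl, rfl⟩ | ⟨rfl, rfl⟩) |
        (⟨rfl, rfl⟩ | ⟨rfl, rfl⟩) <;>
      simp_all [SimpleGraph.adj_comm]
  · have := huv.ne
    rw [Finset.card_insert_of_notMem, Finset.card_pair]
    · omega
    all_goals
      simp only [ne_eq, Sym2.eq_iff, Finset.mem_insert, Finset.mem_singleton]
      grind

end Cluster

/-! ### Regularity of powers for a linear forest plus an edge -/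

section PowerBounds

variable {K : Type*} [Field K] {n : ℕ}

open Classical in
theorem TwoLEDeg.two_le_card {F : SimpleGraph (Fin n)} {v : Fin n} (h : TwoLEDeg F v) :
    2 ≤ F.edgeFinset.card := by
  obtain ⟨a, b, hab, ha, hb⟩ := h
  have hsub : ({s(v, a), s(v, b)} : Finset (Sym2 (Fin n))) ⊆ F.edgeFinset := by
    intro e he
    simp only [Finset.mem_insert, Finset.mem_singleton] at he
    rcases he with rfl | rfl <;> simpa
  refine le_trans (le_of_eq ?_) (Finset.card_le_card hsub)
  rw [Finset.card_pair (by simp only [ne_eq, Sym2.eq_iff]; grind)]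

open Classical in
/-- Powers of `J_G` for `G` a linear forest with one edge added at an inner vertex of a path. -/
theorem regLE_pow_sup_edge {F : SimpleGraph (Fin n)} (hF : F.IsAcyclic)
    (hdeg : ∀ a, DegLETwo F a) {v w : Fin n} (hv : TwoLEDeg F v) (hw : IsFree F w)
    (hvw : ¬ F.Reachable v w) (s : ℕ) :
    RegLE (binomialEdgeIdeal K (F ⊔ SimpleGraph.edge v w) ^ (s + 1))
      (2 * s + F.edgeFinset.card) := by
  have hne : v ≠ w := by rintro rfl; exact hvw .rfl
  have hcard := hv.two_le_card
  have hCI := quadricCI_of_linearForest (K := K) hF hdeg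
  have hQ := regLE_completeAt (K := K) hF hdeg hv (q := F.edgeFinset.card - 1) (by omega)
  have hJ := regLE_sup_edge hw hvw hCI.regLE hQ (by omega)
  rw [binomialEdgeIdeal_sup_edge F hne] at hJ ⊢
  exact hCI.regLE_pow_sup (isHomogeneous_edgeBinom v w) (mem_completeAt_iff hw hvw)
    (edgeBinom_mul_mem_of_pow (le_completeAt F v) (isFree_completeAt_self F v)
      (hw.completeAt v) (fun h => hvw (reachable_of_completeAt h))
      fun _ hp => edgeBinom_mul_mem_of_mem_completeAt w hp)
    hQ hJ (by omega) (by omega) s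

/-- In different components the two completions do not interact, so the ideal is J_{F_v} + J_{F_u},
and f_vu multiplies each summand into J_F. -/
theorem edgeBinom_mul_mem_of_mem_completeAt_completeAt {F : SimpleGraph (Fin n)} {u v : Fin n}
    (huv : ¬ F.Reachable v u) {p : MvPolynomial (Vars n) K}
    (hp : p ∈ binomialEdgeIdeal K (completeAt (completeAt F v) u)) :
    edgeBinom K v u * p ∈ binomialEdgeIdeal K F := by
  rw [completeAt_completeAt_of_not_reachable huv, binomialEdgeIdeal_sup] at hp
  obtain ⟨a, ha, b, hb, rfl⟩ := Submodule.mem_sup.1 hp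
  rw [mul_add]
  refine add_mem (edgeBinom_mul_mem_of_mem_completeAt u ha) ?_
  rw [edgeBinom_comm, neg_mul]
  exact neg_mem (edgeBinom_mul_mem_of_mem_completeAt v hb)

open Classical in
/-- Powers of `J_G` for `G` obtained from a linear forest by connecting two inner vertices of
different paths. -/
theorem regLE_pow_sup_edge_of_two_le {F : SimpleGraph (Fin n)} (hF : F.IsAcyclic)
    (hdeg : ∀ a, DegLETwo F a) {u v : Fin n} (hu : TwoLEDeg F u) (hv : TwoLEDeg F v)
    (huv : ¬ F.Reachable v u) {ρ : ℕ} (hρ : F.edgeFinset.card = ρ + 1)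
    (hJ : RegLE (binomialEdgeIdeal K (F ⊔ SimpleGraph.edge v u)) ρ) (s : ℕ) :
    RegLE (binomialEdgeIdeal K (F ⊔ SimpleGraph.edge v u) ^ (s + 1)) (2 * s + ρ) := by
  have hne : v ≠ u := by rintro rfl; exact huv .rfl
  have hcard := hv.two_le_card
  have hCI := quadricCI_of_linearForest (K := K) hF hdeg
  have hQ := regLE_completeAt_completeAt_of_not_reachable (K := K) hF hdeg hu hv huv
    (q := ρ - 1) (by omega)
  have hle : F ≤ completeAt (completeAt F v) u := (le_completeAt F v).trans (le_completeAt _ u)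
  have hfv : IsFree (completeAt (completeAt F v) u) v := (isFree_completeAt_self F v).completeAt u
  have hfu : IsFree (completeAt (completeAt F v) u) u := isFree_completeAt_self _ u
  have hr : ¬ (completeAt (completeAt F v) u).Reachable v u :=
    -- Completion never joins components, so f_vu stays a nonzerodivisor after both completions.
    fun h => huv (reachable_of_completeAt (reachable_of_completeAt h))
  rw [binomialEdgeIdeal_sup_edge F hne] at hJ ⊢
  exact hCI.regLE_pow_sup (isHomogeneous_edgeBinom v u)
    (mem_iff_edgeBinom_mul_mem hle hfv hfu hr
      fun _ hp => edgeBinom_mul_mem_of_mem_completeAt_completeAt huv hp)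
    (edgeBinom_mul_mem_of_pow hle hfv hfu hr
      fun _ hp => edgeBinom_mul_mem_of_mem_completeAt_completeAt huv hp)
    hQ hJ (by omega) (by omega) s

theorem completeAt_sup_edge {F : SimpleGraph (Fin n)} {u v z : Fin n} (hu : v ≠ u) (hz : v ≠ z) :
    completeAt (F ⊔ SimpleGraph.edge u z) v = completeAt F v ⊔ SimpleGraph.edge u z := by
  have key : ∀ a, (F ⊔ SimpleGraph.edge u z).Adj v a ↔ F.Adj v a := by
    intro a
    simp only [SimpleGraph.sup_adj, SimpleGraph.edge_adj]
    grind
  ext a b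
  simp only [completeAt, key]
  simp only [SimpleGraph.sup_adj, SimpleGraph.edge_adj]
  tauto

theorem IsFree.sup_edge {F : SimpleGraph (Fin n)} {u w z : Fin n} (hw : IsFree F w) (hu : w ≠ u)
    (hz : w ≠ z) : IsFree (F ⊔ SimpleGraph.edge u z) w := by
  have key : ∀ a, (F ⊔ SimpleGraph.edge u z).Adj w a ↔ F.Adj w a := by
    intro a
    simp only [SimpleGraph.sup_adj, SimpleGraph.edge_adj]
    grind
  intro a b ha hb hab
  rw [key] at ha hb
  exact Or.inl (hw a b ha hb hab)

open Classical in
/-- The regularity of `J_G` for `G` obtained from a linear forest by adding one edge at each of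
two adjacent inner vertices. -/
theorem regLE_sup_edge_sup_edge {F : SimpleGraph (Fin n)} (hF : F.IsAcyclic)
    (hdeg : ∀ a, DegLETwo F a) {u v u' v' w z : Fin n} (huv : F.Adj u v) (hu : F.Adj u u')
    (hv : F.Adj v v') (hu' : u' ≠ v) (hv' : v' ≠ u) (hw : IsFree F w) (hz : IsFree F z)
    (huz : ¬ F.Reachable u z) (hvw : ¬ (F ⊔ SimpleGraph.edge u z).Reachable v w) :
    RegLE (binomialEdgeIdeal K (F ⊔ SimpleGraph.edge u z ⊔ SimpleGraph.edge v w))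
      F.edgeFinset.card := by
  have hcard : 2 ≤ F.edgeFinset.card := TwoLEDeg.two_le_card ⟨v, u', hu'.symm, huv, hu⟩
  have h1 := (quadricCI_of_linearForest (K := K) hF hdeg).regLE
  have hcu := regLE_completeAt (K := K) hF hdeg (v := u) ⟨v, u', hu'.symm, huv, hu⟩
    (q := F.edgeFinset.card - 1) (by omega)
  have hcv := regLE_completeAt (K := K) hF hdeg (v := v) ⟨u, v', hv'.symm, huv.symm, hv⟩
    (q := F.edgeFinset.card - 1) (by omega)
  have hcuv := regLE_completeAt_completeAt_of_adj (K := K) hF hdeg huv hu hv hu' hv'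
    (q := F.edgeFinset.card - 2) (by omega)
  have hne : u ≠ z := by rintro rfl; exact huz .rfl
  have hvz : v ≠ z := by rintro rfl; exact huz huv.reachable
  have hvu : (F ⊔ SimpleGraph.edge u z).Adj v u := Or.inl huv.symm
  have huzA : (F ⊔ SimpleGraph.edge u z).Adj u z :=
    Or.inr (by rw [SimpleGraph.edge_adj]; exact ⟨Or.inl ⟨rfl, rfl⟩, hne⟩)
  have hwu : w ≠ u := by rintro rfl; exact hvw hvu.reachable
  have hwz : w ≠ z := by rintro rfl; exact hvw (hvu.reachable.trans huzA.reachable)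
  -- The edge uz is adjoined both to F and to its completion at v; the second ideal is the colon
  -- needed for adjoining vw. Neither edge raises the bound, because each colon ideal has regularity
  -- smaller by one.
  have h2 := regLE_sup_edge hz huz h1 hcu (by omega)
  have h3 := regLE_sup_edge (hz.completeAt v) (fun h => huz (reachable_of_completeAt h)) hcv hcuv
    (by omega)
  rw [← completeAt_sup_edge huv.ne' hvz] at h3
  exact regLE_sup_edge (hw.sup_edge hwu hwz) hvw h2 h3 (by omega)

end PowerBounds

/-! ### Degrees in trees and the almost complete intersection condition -/

section Trees

variable {K : Type*} [Field K] {n : ℕ} {G : SimpleGraph (Fin n)}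

theorem not_adj_of_isAcyclic (hG : G.IsAcyclic) {a b c : Fin n} (hab : G.Adj a b)
    (hac : G.Adj a c) : ¬ G.Adj b c := by
  classical
  exact fun hbc => hG.cliqueFree le_rfl {a, b, c} (SimpleGraph.is3Clique_triple_iff.2 ⟨hab, hac, hbc⟩)

theorem maximal_isClique_pair (hG : G.IsAcyclic) {v a : Fin n} (h : G.Adj v a) :
    Maximal (fun D => G.IsClique D) ({v, a} : Set (Fin n)) := by
  refine ⟨SimpleGraph.isClique_pair.2 fun _ => h, fun D hD hle x hx => ?_⟩
  by_contra hxn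
  simp only [Set.mem_insert_iff, Set.mem_singleton_iff, not_or] at hxn
  exact not_adj_of_isAcyclic hG h (hD (hle (by simp)) hx (Ne.symm hxn.1))
    (hD (hle (by simp)) hx (Ne.symm hxn.2))

/-- In a forest the maximal cliques at a non-isolated vertex are exactly its edges. -/
theorem isSimplicialVertex_iff (hG : G.IsAcyclic) {v a : Fin n} (h : G.Adj v a) :
    IsSimplicialVertex G v ↔ ¬ TwoLEDeg G v := by
  constructor
  · rintro ⟨C, -, hC⟩ ⟨b, c, hbc, hb, hc⟩
    have h1 := (hC _ ⟨maximal_isClique_pair hG hb, by simp⟩).trans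
      (hC _ ⟨maximal_isClique_pair hG hc, by simp⟩).symm
    have h2 : b ∈ ({v, c} : Set (Fin n)) := h1 ▸ by simp
    rcases h2 with rfl | h2
    · exact hb.ne rfl
    · exact hbc h2
  · intro hv
    refine ⟨{v, a}, ⟨maximal_isClique_pair hG h, by simp⟩, ?_⟩
    rintro C ⟨hC, hvC⟩
    refine hC.eq_of_subset (maximal_isClique_pair hG h).prop fun x hx => ?_
    by_contra hxn
    simp only [Set.mem_insert_iff, Set.mem_singleton_iff, not_or] at hxn
    exact hv ⟨x, a, hxn.2, hC.prop hvC hx (Ne.symm hxn.1), h⟩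

open Classical in
theorem two_le_degree_iff {v : Fin n} : 2 ≤ G.degree v ↔ TwoLEDeg G v := by
  rw [← SimpleGraph.card_neighborFinset_eq_degree, Nat.succ_le_iff, Finset.one_lt_card_iff]
  simp only [SimpleGraph.mem_neighborFinset, TwoLEDeg]
  grind

open Classical in
theorem degLETwo_of_degree_lt {v : Fin n} (h : G.degree v < 3) : DegLETwo G v := by
  intro b c d hb hc hd hcb hdb
  by_contra hcd
  rw [← SimpleGraph.card_neighborFinset_eq_degree] at h
  refine absurd (Finset.two_lt_card_iff.2 ⟨b, c, d, ?_⟩) (not_lt.2 (Nat.le_of_lt_succ h))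
  simp only [SimpleGraph.mem_neighborFinset]
  exact ⟨hb, hc, hd, hcb.symm, hdb.symm, hcd⟩

theorem DegLETwo.mono {H : SimpleGraph (Fin n)} (hle : H ≤ G) {v : Fin n} (h : DegLETwo G v) :
    DegLETwo H v :=
  fun b c d hb hc hd => h b c d (hle hb) (hle hc) (hle hd)

theorem degLETwo_of_adj_iff {v a b : Fin n} (h : ∀ x, G.Adj v x → x = a ∨ x = b) :
    DegLETwo G v := by
  intro x y z hx hy hz hyx hzx
  have := h x hx
  have := h y hy
  have := h z hz
  grind

/-- A vertex with at most two neighbours is free after deleting an edge at it. -/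
theorem DegLETwo.isFree {F : SimpleGraph (Fin n)} (hF : F ≤ G) {v w : Fin n} (h : DegLETwo G w)
    (hvw : G.Adj w v) (hF' : ¬ F.Adj w v) : IsFree F w :=
  fun a b ha hb hab => absurd (h v a b hvw (hF ha) (hF hb) (by rintro rfl; exact hF' ha)
    (by rintro rfl; exact hF' hb)) hab

theorem isolate_adj {v a b : Fin n} : (isolate G v).Adj a b ↔ G.Adj a b ∧ a ≠ v ∧ b ≠ v := Iff.rfl

open Classical in
theorem card_edgeFinset_isolate (G : SimpleGraph (Fin n)) (v : Fin n) :
    (isolate G v).edgeFinset.card = G.edgeFinset.card - G.degree v := by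
  rw [← SimpleGraph.card_edgeFinset_deleteIncidenceSet]
  congr 1
  ext e
  induction e using Sym2.ind with
  | _ a b => simp [isolate_adj, SimpleGraph.deleteIncidenceSet_adj]

open Classical in
theorem degree_le_card_edgeFinset (G : SimpleGraph (Fin n)) (v : Fin n) :
    G.degree v ≤ G.edgeFinset.card := by
  rw [← SimpleGraph.card_incidenceFinset_eq_degree]
  exact Finset.card_le_card (SimpleGraph.incidenceFinset_subset G v)

open Classical in
theorem degree_isolate {u v : Fin n} (huv : u ≠ v) (h : ¬ G.Adj u v) :
    (isolate G u).degree v = G.degree v := by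
  rw [← SimpleGraph.card_neighborFinset_eq_degree, ← SimpleGraph.card_neighborFinset_eq_degree]
  congr 1
  ext a
  simp only [SimpleGraph.mem_neighborFinset, isolate_adj]
  refine ⟨fun h => h.1, fun ha => ⟨ha, huv.symm, ?_⟩⟩
  rintro rfl
  exact h ha.symm

/-! ### Consequences of being an almost complete intersection -/

open Classical in
-- Turns an upper bound for the height into one for |E|, the minimal number of generators.
theorem card_edgeFinset_le_of_height_le
    (hJ : IsAlmostCompleteIntersection (binomialEdgeIdeal K G)) {k : ℕ}
    (hk : (binomialEdgeIdeal K G).height ≤ k) : G.edgeFinset.card ≤ k + 1 := by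
  have h1 : (Submodule.spanFinrank (binomialEdgeIdeal K G) : ℕ∞) ≤ ((k + 1 : ℕ) : ℕ∞) := by
    rw [hJ.2]; push_cast; gcongr
  exact (card_edgeFinset_le_spanFinrank (K := K) G).trans (by exact_mod_cast h1)

open Classical in
-- With at most one generator the height would be 0, so J_G would be zero and need no generator, not
-- 0 + 1.
theorem two_le_card_edgeFinset
    (hJ : IsAlmostCompleteIntersection (binomialEdgeIdeal K G)) : 2 ≤ G.edgeFinset.card := by
  by_contra hlt
  have h1 := spanFinrank_le_card_edgeFinset (K := K) G
  have h2 : (binomialEdgeIdeal K G).height + 1 ≤ 0 + 1 := by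
    rw [← hJ.2]; exact_mod_cast (by omega : _ ≤ 1)
  have h3 : (binomialEdgeIdeal K G).height = 0 :=
    le_zero_iff.1 ((ENat.add_le_add_iff_right ENat.one_ne_top).1 h2)
  have h4 := hJ.2
  rw [h3, Ideal.height_eq_zero_iff_eq_bot.1 h3] at h4
  simp at h4

open Classical in
-- Deleting v gives |E| ≤ 1 + 2 + (|E| - deg v).
theorem degree_le_three
    (hJ : IsAlmostCompleteIntersection (binomialEdgeIdeal K G)) (v : Fin n) : G.degree v ≤ 3 := by
  have h1 := card_edgeFinset_le_of_height_le hJ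
    (height_binomialEdgeIdeal_le (K := K) (G := G) (H := isolate G v) {v} fun i j h => by
      by_cases hi : i = v
      · simp [hi]
      by_cases hj : j = v
      · simp [hj]
      exact Or.inl ⟨h, hi, hj⟩)
  rw [card_edgeFinset_isolate, Finset.card_singleton] at h1
  have := degree_le_card_edgeFinset G v
  omega

open Classical in
-- If u and v were not adjacent, deleting both would remove six edges and give |E| ≤ 1 + 4 + (|E| -
-- 6).
theorem adj_of_degree_eq_three
    (hJ : IsAlmostCompleteIntersection (binomialEdgeIdeal K G)) {u v : Fin n} (huv : u ≠ v)
    (hu : G.degree u = 3) (hv : G.degree v = 3) : G.Adj u v := by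
  by_contra hnadj
  have h1 := card_edgeFinset_le_of_height_le hJ
    (height_binomialEdgeIdeal_le (K := K) (G := G) (H := isolate (isolate G u) v) {u, v}
      fun i j h => by
        by_cases hi : i = u ∨ i = v
        · simp [hi]
        by_cases hj : j = u ∨ j = v
        · simp [hj]
        push Not at hi hj
        exact Or.inl ⟨⟨h, hi.1, hj.1⟩, hi.2, hj.2⟩)
  rw [card_edgeFinset_isolate, Finset.card_pair huv, card_edgeFinset_isolate] at h1
  have h2 := degree_le_card_edgeFinset G u
  have h3 := degree_le_card_edgeFinset (isolate G u) v
  rw [card_edgeFinset_isolate] at h3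
  have h4 := degree_isolate huv hnadj
  omega

open Classical in
theorem iv_eq_card (hG : G.IsTree) (h2 : 2 ≤ G.edgeFinset.card) :
    iv G = (Finset.univ.filter fun v => 2 ≤ G.degree v).card := by
  have hn := hG.card_edgeFinset
  have : Nontrivial (Fin n) := Fin.nontrivial_iff_two_le.2 (by rw [Fintype.card_fin] at hn; omega)
  rw [iv, ← Set.ncard_coe_finset]
  congr 1
  ext v
  obtain ⟨a, ha⟩ := (G.degree_pos_iff_exists_adj v).1
    (hG.connected.preconnected.degree_pos_of_nontrivial v)
  simp [isSimplicialVertex_iff hG.isAcyclic ha, two_le_degree_iff]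

open Classical in
/-- The degree sum of a tree with all degrees at most three. -/
theorem iv_add_card (hG : G.IsTree) (h2 : 2 ≤ G.edgeFinset.card) (h3 : ∀ v, G.degree v ≤ 3) :
    iv G + (Finset.univ.filter fun v => G.degree v = 3).card + 1 = G.edgeFinset.card := by
  have hn := hG.card_edgeFinset
  rw [Fintype.card_fin] at hn
  have : Nontrivial (Fin n) := Fin.nontrivial_iff_two_le.2 (by omega)
  have hpos : ∀ v, 0 < G.degree v := fun v =>
    hG.connected.preconnected.degree_pos_of_nontrivial v
  have hsum := G.sum_degrees_eq_twice_card_edges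
  -- Valid since 1 ≤ deg v ≤ 3. Summing gives n + iv(G) + |D| = 2|E|, with n = |E| + 1.
  have hdeg : ∀ v, G.degree v =
      1 + (if 2 ≤ G.degree v then 1 else 0) + (if G.degree v = 3 then 1 else 0) := by
    intro v
    have := hpos v
    have := h3 v
    split_ifs <;> omega
  rw [Finset.sum_congr rfl fun v _ => hdeg v, Finset.sum_add_distrib, Finset.sum_add_distrib,
    ← Finset.card_filter, ← Finset.card_filter, ← iv_eq_card hG h2] at hsum
  simp at hsum
  omega

open Classical in
theorem iv_pos (hG : G.IsTree) (h2 : 2 ≤ G.edgeFinset.card) (h3 : ∀ v, G.degree v ≤ 3) :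
    0 < iv G := by
  have h := iv_add_card hG h2 h3
  have hle : (Finset.univ.filter fun v => G.degree v = 3).card ≤ iv G := by
    rw [iv_eq_card hG h2]
    exact Finset.card_le_card fun v hv => by
      simp only [Finset.mem_filter] at hv ⊢
      exact ⟨hv.1, by omega⟩
  omega

end Trees

/-! ### Upper and lower bounds by the number of vertices of degree three -/

section Trees

variable {K : Type*} [Field K] {n : ℕ} {G : SimpleGraph (Fin n)}

/-- The graph `G` without the edge `vw`. -/
def deleteEdge (G : SimpleGraph (Fin n)) (v w : Fin n) : SimpleGraph (Fin n) :=
  G.deleteEdges {s(v, w)}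

theorem deleteEdge_adj {v w a b : Fin n} :
    (deleteEdge G v w).Adj a b ↔ G.Adj a b ∧ ¬ ((a = v ∧ b = w) ∨ (a = w ∧ b = v)) := by
  rw [deleteEdge, SimpleGraph.deleteEdges_adj, Set.mem_singleton_iff, Sym2.eq_iff]

theorem deleteEdge_le (G : SimpleGraph (Fin n)) (v w : Fin n) : deleteEdge G v w ≤ G :=
  G.deleteEdges_le _

theorem deleteEdge_sup_edge {v w : Fin n} (h : G.Adj v w) :
    deleteEdge G v w ⊔ SimpleGraph.edge v w = G := by
  ext a b
  rw [SimpleGraph.sup_adj, deleteEdge_adj, SimpleGraph.edge_adj]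
  have := h.symm
  have := @SimpleGraph.Adj.ne _ G a b
  grind

open Classical in
theorem card_edgeFinset_deleteEdge {v w : Fin n} (h : G.Adj v w) :
    (deleteEdge G v w).edgeFinset.card + 1 = G.edgeFinset.card := by
  have := SimpleGraph.card_edgeFinset_sup_edge (deleteEdge G v w)
    (by rw [deleteEdge_adj]; tauto : ¬ (deleteEdge G v w).Adj v w) h.ne
  rw [← this]
  congr!
  exact deleteEdge_sup_edge h

theorem not_reachable_deleteEdge (hG : G.IsAcyclic) {v w : Fin n} (h : G.Adj v w) :
    ¬ (deleteEdge G v w).Reachable v w := by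
  have := SimpleGraph.isAcyclic_iff_forall_adj_isBridge.1 hG h
  rwa [SimpleGraph.isBridge_iff] at this

open Classical in
theorem exists_neighbors_of_degree_eq_three {v w : Fin n} (h : G.degree v = 3)
    (hvw : G.Adj v w) : ∃ a b, a ≠ b ∧ a ≠ w ∧ b ≠ w ∧
      ∀ x, G.Adj v x ↔ x = w ∨ x = a ∨ x = b := by
  rw [← SimpleGraph.card_neighborFinset_eq_degree] at h
  have hw : w ∈ G.neighborFinset v := (G.mem_neighborFinset v w).2 hvw
  have h2 : ((G.neighborFinset v).erase w).card = 2 := by rw [Finset.card_erase_of_mem hw, h]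
  obtain ⟨a, b, hab, heq⟩ := Finset.card_eq_two.1 h2
  have key : ∀ x, (x ≠ w ∧ G.Adj v x) ↔ x = a ∨ x = b := by
    intro x
    rw [← SimpleGraph.mem_neighborFinset, ← Finset.mem_erase, heq, Finset.mem_insert,
      Finset.mem_singleton]
  refine ⟨a, b, hab, ((key a).2 (Or.inl rfl)).1, ((key b).2 (Or.inr rfl)).1, fun x => ?_⟩
  rw [← key]
  by_cases hx : x = w
  · simp [hx, hvw]
  · simp [hx]

open Classical in
theorem regLE_pow_of_degree_lt_three (hG : G.IsAcyclic) (h : ∀ a, G.degree a < 3) (s : ℕ) :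
    RegLE (binomialEdgeIdeal K G ^ (s + 1)) (2 * s + G.edgeFinset.card) :=
  (quadricCI_of_linearForest hG fun a => degLETwo_of_degree_lt (h a)).regLE_pow s

open Classical in
-- Deleting any edge vw at v leaves a linear forest in which v is still an inner vertex and w has
-- become free.
theorem regLE_pow_of_degree_eq_three (hG : G.IsAcyclic) {v : Fin n} (hv : G.degree v = 3)
    (h : ∀ a, a ≠ v → G.degree a < 3) (s : ℕ) :
    RegLE (binomialEdgeIdeal K G ^ (s + 1)) (2 * s + (G.edgeFinset.card - 1)) := by
  obtain ⟨w, hw⟩ := (G.degree_pos_iff_exists_adj v).1 (by omega)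
  obtain ⟨a, b, hab, haw, hbw, hN⟩ := exists_neighbors_of_degree_eq_three hv hw
  have hle := deleteEdge_le G v w
  have hdeg : ∀ x, DegLETwo (deleteEdge G v w) x := by
    intro x
    by_cases hx : x = v
    · subst hx
      refine degLETwo_of_adj_iff (a := a) (b := b) fun y hy => ?_
      rw [deleteEdge_adj, hN] at hy
      tauto
    · exact (degLETwo_of_degree_lt (h x hx)).mono hle
  have hv2 : TwoLEDeg (deleteEdge G v w) v := by
    refine ⟨a, b, hab, ?_⟩
    rw [deleteEdge_adj, deleteEdge_adj, hN, hN]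
    grind
  have hfree : IsFree (deleteEdge G v w) w :=
    (degLETwo_of_degree_lt (h w hw.ne')).isFree hle hw.symm (by rw [deleteEdge_adj]; tauto)
  have := regLE_pow_sup_edge (K := K) (hG.anti hle) hdeg hv2 hfree (not_reachable_deleteEdge hG hw) s
  rw [deleteEdge_sup_edge hw] at this
  have hc := card_edgeFinset_deleteEdge hw
  rwa [← hc, Nat.add_sub_cancel]

open Classical in
-- The edge uv is kept and one other edge at each of u and v is removed. Adjoining to the forest G -
-- uv instead would start from regularity |E| - 1, one too large; so the powers are treated with uv
-- removed, but the first power in this way.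
theorem regLE_of_two_degree_eq_three (hG : G.IsAcyclic) {u v : Fin n} (huv : G.Adj u v)
    (hu : G.degree u = 3) (hv : G.degree v = 3)
    (h : ∀ a, a ≠ u → a ≠ v → G.degree a < 3) :
    RegLE (binomialEdgeIdeal K G) (G.edgeFinset.card - 2) := by
  obtain ⟨u', z, huz, hu'v, hzv, hNu⟩ := exists_neighbors_of_degree_eq_three hu huv
  obtain ⟨v', w, hvw, hv'u, hwu, hNv⟩ := exists_neighbors_of_degree_eq_three hv huv.symm
  have hvwA : G.Adj v w := by rw [hNv]; tauto
  have huzA : G.Adj u z := by rw [hNu]; tauto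
  set G₁ := deleteEdge G v w with hG₁
  have hG₁le : G₁ ≤ G := deleteEdge_le G v w
  have huzA₁ : G₁.Adj u z := by rw [hG₁, deleteEdge_adj]; grind [huv.ne]
  set F := deleteEdge G₁ u z with hF
  have hFG₁ : F ≤ G₁ := deleteEdge_le G₁ u z
  have hFle : F ≤ G := hFG₁.trans hG₁le
  have hFG₁' : F ⊔ SimpleGraph.edge u z = G₁ := deleteEdge_sup_edge huzA₁
  have hadj : ∀ x y, F.Adj x y ↔ G.Adj x y ∧ ¬ ((x = v ∧ y = w) ∨ (x = w ∧ y = v)) ∧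
      ¬ ((x = u ∧ y = z) ∨ (x = z ∧ y = u)) := by
    intro x y
    rw [hF, deleteEdge_adj, hG₁, deleteEdge_adj, and_assoc]
  have huv' := huv.ne
  have hdeg : ∀ x, DegLETwo F x := by
    intro x
    by_cases hxu : x = u
    · subst hxu
      refine degLETwo_of_adj_iff (a := v) (b := u') fun y hy => ?_
      rw [hadj, hNu] at hy
      tauto
    by_cases hxv : x = v
    · subst hxv
      refine degLETwo_of_adj_iff (a := u) (b := v') fun y hy => ?_
      rw [hadj, hNv] at hy
      tauto
    · exact (degLETwo_of_degree_lt (h x hxu hxv)).mono hFle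
  have hw : IsFree F w := (degLETwo_of_degree_lt (h w hwu hvwA.ne')).isFree hFle hvwA.symm
    (by rw [hadj]; tauto)
  have hz : IsFree F z := (degLETwo_of_degree_lt (h z huzA.ne' hzv)).isFree hFle huzA.symm
    (by rw [hadj]; tauto)
  have huvF : F.Adj u v := by rw [hadj]; grind
  have huu'F : F.Adj u u' := by rw [hadj, hNu]; grind
  have hvv'F : F.Adj v v' := by rw [hadj, hNv]; grind
  have := regLE_sup_edge_sup_edge (K := K) (hG.anti hFle) hdeg huvF huu'F hvv'F hu'v hv'u hw hz
    (not_reachable_deleteEdge (hG.anti hG₁le) huzA₁)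
    (by rw [hFG₁']; exact not_reachable_deleteEdge hG hvwA)
  rw [hFG₁', deleteEdge_sup_edge hvwA] at this
  have hc := card_edgeFinset_deleteEdge hvwA
  have hc₁ := card_edgeFinset_deleteEdge huzA₁
  rw [← hG₁] at hc
  rw [← hF] at hc₁
  exact this.mono (by omega)

open Classical in
theorem regLE_pow_of_two_degree_eq_three (hG : G.IsAcyclic) {u v : Fin n} (huv : G.Adj u v)
    (hu : G.degree u = 3) (hv : G.degree v = 3)
    (h : ∀ a, a ≠ u → a ≠ v → G.degree a < 3) (s : ℕ) :
    RegLE (binomialEdgeIdeal K G ^ (s + 1)) (2 * s + (G.edgeFinset.card - 2)) := by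
  have hJ := regLE_of_two_degree_eq_three (K := K) hG huv hu hv h
  obtain ⟨u', z, huz, hu'v, hzv, hNu⟩ := exists_neighbors_of_degree_eq_three hu huv
  obtain ⟨v', w, hvw, hv'u, hwu, hNv⟩ := exists_neighbors_of_degree_eq_three hv huv.symm
  have huv' := huv.ne
  have hle := deleteEdge_le G v u
  have hdeg : ∀ x, DegLETwo (deleteEdge G v u) x := by
    intro x
    by_cases hxu : x = u
    · subst hxu
      refine degLETwo_of_adj_iff (a := u') (b := z) fun y hy => ?_
      rw [deleteEdge_adj, hNu] at hy
      tauto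
    by_cases hxv : x = v
    · subst hxv
      refine degLETwo_of_adj_iff (a := v') (b := w) fun y hy => ?_
      rw [deleteEdge_adj, hNv] at hy
      tauto
    · exact (degLETwo_of_degree_lt (h x hxu hxv)).mono hle
  have hu2 : TwoLEDeg (deleteEdge G v u) u := by
    refine ⟨u', z, huz, ?_⟩
    rw [deleteEdge_adj, deleteEdge_adj, hNu, hNu]
    grind
  have hv2 : TwoLEDeg (deleteEdge G v u) v := by
    refine ⟨v', w, hvw, ?_⟩
    rw [deleteEdge_adj, deleteEdge_adj, hNv, hNv]
    grind
  have hc := card_edgeFinset_deleteEdge huv.symm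
  have h2 := hu2.two_le_card
  rw [← deleteEdge_sup_edge huv.symm] at hJ
  have := regLE_pow_sup_edge_of_two_le (K := K) (hG.anti hle) hdeg hu2 hv2
    (not_reachable_deleteEdge hG huv.symm) (ρ := G.edgeFinset.card - 2) (by omega)
    (by convert hJ; exact (deleteEdge_sup_edge huv.symm).symm) s
  rwa [deleteEdge_sup_edge huv.symm] at this

open Classical in
theorem degree_isolate_lt_of_adj {t a : Fin n} (h : G.Adj t a) (ha : G.degree a ≤ 3) :
    (isolate G t).degree a < 3 := by
  refine lt_of_lt_of_le ?_ ha
  rw [← SimpleGraph.card_neighborFinset_eq_degree, ← SimpleGraph.card_neighborFinset_eq_degree]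
  refine Finset.card_lt_card (Finset.ssubset_iff_of_subset ?_ |>.2 ⟨t, ?_, ?_⟩)
  · intro x hx
    rw [SimpleGraph.mem_neighborFinset] at hx ⊢
    exact hx.1
  · rw [SimpleGraph.mem_neighborFinset]; exact h.symm
  · rw [SimpleGraph.mem_neighborFinset]; exact fun h => h.2.2 rfl

open Classical in
-- The strict degree bound leaves an edge after t is deleted, so the ideal of the linear forest is
-- nonzero.
theorem not_torVanishes_pow_of_isolate (hG : G.IsAcyclic) {t : Fin n}
    (hdeg : ∀ a, DegLETwo (isolate G t) a) (ht : G.degree t < G.edgeFinset.card) (s : ℕ) :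
    ¬ TorVanishes (binomialEdgeIdeal K G ^ (s + 1)) (G.edgeFinset.card - G.degree t)
      (2 * (G.edgeFinset.card - G.degree t) + 2 * s) := by
  have hCI := quadricCI_of_linearForest (K := K) (hG.anti (isolate_le G t)) hdeg
  rw [card_edgeFinset_isolate] at hCI
  refine not_torVanishes_of_isolate (hCI.not_torVanishes_pow (fun h => ?_) s)
  have h1 := card_edgeFinset_le_spanFinrank (K := K) (isolate G t)
  rw [h, Submodule.spanFinrank_bot, card_edgeFinset_isolate] at h1
  omega

end Trees

/-! ### Case distinction on the vertices of degree three -/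

section Main

variable {K : Type*} [Field K] {n : ℕ} {G : SimpleGraph (Fin n)}

open Classical in
/-- Trees whose binomial edge ideal is an almost complete intersection: bounds in terms of the
number of vertices of degree three. -/
theorem exists_isolate_and_regLE_pow (hG : G.IsTree) (h2 : 2 ≤ G.edgeFinset.card)
    (hJ : IsAlmostCompleteIntersection (binomialEdgeIdeal K G)) :
    (∃ t, G.degree t ≤ (Finset.univ.filter fun v => G.degree v = 3).card + 1 ∧
      ∀ a, DegLETwo (isolate G t) a) ∧
    ∀ s, RegLE (binomialEdgeIdeal K G ^ (s + 1))
      (2 * s + (G.edgeFinset.card - (Finset.univ.filter fun v => G.degree v = 3).card)) := by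
  have h3 := degree_le_three hJ
  have hiv := iv_add_card hG h2 h3
  have hadj : ∀ u v, u ≠ v → G.degree u = 3 → G.degree v = 3 → G.Adj u v :=
    fun u v huv hu hv => adj_of_degree_eq_three hJ huv hu hv
  set D := Finset.univ.filter fun v => G.degree v = 3 with hD
  have hmem : ∀ v, v ∈ D ↔ G.degree v = 3 := fun v => by simp [hD]
  have hlt : ∀ v, v ∉ D → G.degree v < 3 := fun v hv =>
    lt_of_le_of_ne (h3 v) fun h => hv ((hmem v).2 h)
  have hD2 : D.card ≤ 2 := by
    by_contra hc
    obtain ⟨a, b, c, ha, hb, hc, hab, hac, hbc⟩ := Finset.two_lt_card_iff.1 (not_le.1 hc)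
    rw [hmem] at ha hb hc
    exact not_adj_of_isAcyclic hG.isAcyclic (hadj a b hab ha hb) (hadj a c hac ha hc)
      (hadj b c hbc hb hc)
  have hcases : D.card = 0 ∨ D.card = 1 ∨ D.card = 2 := by omega
  -- The vertex t to delete is a leaf if |D| = 0, a neighbour of the branch vertex if |D| = 1, and
  -- one of the two adjacent branch vertices if |D| = 2; each choice lowers every degree 3 below 3
  -- and has deg t ≤ |D| + 1.
  rcases hcases with h0 | h1 | h2
  · have hlt' : ∀ a, G.degree a < 3 := fun a => hlt a (by simp [Finset.card_eq_zero.1 h0])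
    refine ⟨?_, fun s => by rw [h0]; exact regLE_pow_of_degree_lt_three hG.isAcyclic hlt' s⟩
    have hn := hG.card_edgeFinset
    have : Nontrivial (Fin n) := Fin.nontrivial_iff_two_le.2 (by rw [Fintype.card_fin] at hn; omega)
    obtain ⟨t, ht⟩ := hG.exists_vert_degree_one_of_nontrivial
    exact ⟨t, by rw [ht]; omega,
      fun a => (degLETwo_of_degree_lt (hlt' a)).mono (isolate_le G t)⟩
  · obtain ⟨v, hv⟩ := Finset.card_eq_one.1 h1
    have hv3 : G.degree v = 3 := (hmem v).1 (by simp [hv])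
    have hlt' : ∀ a, a ≠ v → G.degree a < 3 := fun a ha => hlt a (by simpa [hv] using ha)
    refine ⟨?_, fun s => by
      rw [h1]; exact regLE_pow_of_degree_eq_three hG.isAcyclic hv3 hlt' s⟩
    obtain ⟨t, ht⟩ := (G.degree_pos_iff_exists_adj v).1 (by omega)
    refine ⟨t, by have := hlt' t ht.ne'; omega, fun a => ?_⟩
    by_cases ha : a = v
    · exact degLETwo_of_degree_lt (degree_isolate_lt_of_adj (ha ▸ ht.symm) (h3 a))
    · exact (degLETwo_of_degree_lt (hlt' a ha)).mono (isolate_le G t)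
  · obtain ⟨u, v, huv, hDuv⟩ := Finset.card_eq_two.1 h2
    have hu3 : G.degree u = 3 := (hmem u).1 (by simp [hDuv])
    have hv3 : G.degree v = 3 := (hmem v).1 (by simp [hDuv])
    have hlt' : ∀ a, a ≠ u → a ≠ v → G.degree a < 3 := fun a ha hb =>
      hlt a (by simp [hDuv, ha, hb])
    have huvA := hadj u v huv hu3 hv3
    refine ⟨⟨u, by omega, fun a => ?_⟩, fun s => by
      rw [h2]; exact regLE_pow_of_two_degree_eq_three hG.isAcyclic huvA hu3 hv3 hlt' s⟩
    by_cases hau : a = u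
    · intro b c d hb
      exact absurd hau hb.2.1
    by_cases hav : a = v
    · exact degLETwo_of_degree_lt (degree_isolate_lt_of_adj (hav ▸ huvA) (h3 a))
    · exact (degLETwo_of_degree_lt (hlt' a hau hav)).mono (isolate_le G u)

end Main

end BinomialEdge

end

theorem mainTheorem9 {K : Type*} [Field K] {n : ℕ} (G : SimpleGraph (Fin n))
    (hG : G.IsTree)
    (hJ : BinomialEdge.IsAlmostCompleteIntersection (BinomialEdge.binomialEdgeIdeal K G))
    (s : ℕ) (hs : 1 ≤ s) :
    ((2 * (s : ℝ) + (BinomialEdge.iv G : ℝ) - 2 : ℝ) : EReal) ≤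
        BinomialEdge.regQuotient (BinomialEdge.binomialEdgeIdeal K G ^ s) ∧
      BinomialEdge.regQuotient (BinomialEdge.binomialEdgeIdeal K G ^ s) ≤
        ((2 * (s : ℝ) + (BinomialEdge.iv G : ℝ) - 1 : ℝ) : EReal) := by
  classical
  -- From here the exponent is s + 1, so the target bounds are 2s + iv(G) and 2s + iv(G) + 1.
  obtain ⟨s, rfl⟩ := Nat.exists_eq_add_of_le' hs
  have h2 := BinomialEdge.two_le_card_edgeFinset hJ
  have hiv := BinomialEdge.iv_add_card hG h2 (BinomialEdge.degree_le_three hJ)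
  obtain ⟨⟨t, ht, hdeg⟩, hup⟩ := BinomialEdge.exists_isolate_and_regLE_pow hG h2 hJ
  have hpos : 0 < BinomialEdge.iv G := BinomialEdge.iv_pos hG h2 (BinomialEdge.degree_le_three hJ)
  constructor
  · have hlow := BinomialEdge.le_regQuotient (BinomialEdge.not_torVanishes_pow_of_isolate
      (K := K) hG.isAcyclic hdeg (by omega) s)
    refine le_trans (EReal.coe_le_coe_iff.2 ?_) hlow
    -- From deg t ≤ |D| + 1 and |E| = iv(G) + |D| + 1.
    have h : BinomialEdge.iv G ≤ G.edgeFinset.card - G.degree t := by omega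
    have h' : (BinomialEdge.iv G : ℝ) ≤ ((G.edgeFinset.card - G.degree t : ℕ) : ℝ) := by
      exact_mod_cast h
    push_cast
    linarith
  · refine (BinomialEdge.regQuotient_le (hup s)).trans (EReal.coe_le_coe_iff.2 ?_)
    have h : 2 * s + (G.edgeFinset.card -
        (Finset.univ.filter fun v => G.degree v = 3).card) = 2 * s + BinomialEdge.iv G + 1 := by
      omega
    rw [h]
    push_cast
    linarith
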